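/- All functions are real-valued on $\mathbb T=\mathbb R/2\pi\mathbb Z$ and have mean zero; $H^k=H^k(\mathbb T)$ denotes the Sobolev space of such functions, $L^2=H^0$, and $H$ is the Hilbert transform, $\widehat{Hf}(n)=-i\,\mathrm{sgn}(n)\hat f(n)$. There is a curve $\epsilon\mapsto(u_\epsilon,v_\epsilon)$, $|\epsilon|<\delta$, with $(\epsilon,x)\mapsto u_\epsilon(x)$ and $\epsilon\mapsto v_\epsilon$ real analytic, such that $u_\epsilon$ is even in $x$, $Hu_\epsilon-v_\epsilon u_\epsilon'+u_\epsilon u_\epsilon'=0$ (so that $u_\epsilon(x+v_\epsilon t)$ is a traveling wave of the Burgers–Hilbert equation $f_t=Hf+ff_x$), $u_0=0$, $v_0=-1$, and the coefficient of $\cos x$ in the Fourier series of $u_\epsilon$ is $\epsilon$. Let $(u_\epsilon,v_\epsilon)$ be any such curve. Let $L_\epsilon g=-v_\epsilon g_x+Hg+(u_\epsilon g)_x$ be the linearized operator on $L^2$. For all sufficiently small $\epsilon\ne0$, say $0<|\epsilon|<\rho$, there are spectral projections $P_0^\pm(\epsilon)$ of $L_\epsilon$ for the eigenvalue $0$: bounded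 projections of $L^2$ onto the lines spanned by $\varphi_0^+(\epsilon)=\partial_\epsilon u_\epsilon$ and $\varphi_0^-(\epsilon)=-\epsilon^{-1}u_\epsilon'$ respectively, with $P_0^+P_0^-=P_0^-P_0^+=0$ and with $P_0^++P_0^-$ commuting with $L_\epsilon$. Let $k\ge2$ be an integer. Then there are $r=r(k)\in(0,\rho]$ and $C=C(k)$ such that for every $\epsilon_0$ with $|\epsilon_0|<r$ and every $f\in H^k$ with $\|f-u_{\epsilon_0}\|_{H^k}<r|\epsilon_0|$ there are $\epsilon\in\mathbb R$ with $0<|\epsilon|<\rho$, $a\in\mathbb R$ (giving a class in $\mathbb R/2\pi\mathbb Z$) and $g\in H^k$ with $$f(x)=u_\epsilon(x+a)+g(x+a),\qquad P_0^\pm(\epsilon)g=0,$$ $$|\epsilon-\epsilon_0|+\|g\|_{H^2}\le C\|f-u_{\epsilon_0}\|_{H^2},\qquad |\epsilon-\epsilon_0|+\|g\|_{H^k}\le C\|f-u_{\epsilon_0}\|_{H^k}.$$ Moreover, for each $\epsilon_0$, $\epsilon$, $a$ and $g$ can be chosen to depend smoothly on $f$ in the ball $\{\|f-u_{\epsilon_0}\|_{H^k}<r|\epsilon_0|\}$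 of $H^k$, in the following sense: $\epsilon$ and $a$ are $C^\infty$ functions of $f$, and $f\mapsto g$ is of class $C^j$ as a map into $H^{k-j}$ for every $0\le j\le k$. -/

import Mathlib

open Real Set MeasureTheory
open scoped ContDiff ENNReal

noncomputable section

namespace BurgersHilbert

instance fact_two_pi_pos : Fact (0 < 2 * π) := ⟨Real.two_pi_pos⟩

/-- The torus `ℝ / 2πℤ`. -/
abbrev Torus : Type := AddCircle (2 * π)

/-- The invariant probability measure `dx / 2π` on the torus. -/
abbrev torusMeasure : Measure Torus := AddCircle.haarAddCircle

/-- The `n`-th Fourier coefficient `(1 / 2π) ∫ f(x) e^{-inx} dx` of a real function on the torus. -/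
def coef (f : Torus → ℝ) (n : ℤ) : ℂ := fourierCoeff (fun x => (f x : ℂ)) n

lemma coef_congr_ae {f g : Torus → ℝ} (h : f =ᵐ[torusMeasure] g) (n : ℤ) :
    coef f n = coef g n := by
  unfold coef
  exact congrFun (fourierCoeff_congr_ae (h.mono fun x hx => by simp [hx])) n

lemma coef_add {f g : Torus → ℝ} (hf : Integrable f torusMeasure)
    (hg : Integrable g torusMeasure) (n : ℤ) :
    coef (f + g) n = coef f n + coef g n := by
  have := congrFun (fourierCoeff.add (T := 2 * π) (E := ℂ) hf.ofReal hg.ofReal) n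
  simp only [Pi.add_apply] at this
  rw [coef, coef, coef]
  erw [← this]
  congr 1
  funext x
  simp

lemma coef_smul (c : ℝ) (f : Torus → ℝ) (n : ℤ) : coef (c • f) n = c * coef f n := by
  have := fourierCoeff.const_mul (T := 2 * π) (fun x => (f x : ℂ)) (c : ℂ) n
  rw [coef, coef, ← this]
  congr 1
  funext x
  simp

/-! ### Real `L²` functions of mean zero and Sobolev spaces on the torus -/

/-- Real square integrable functions on the torus with mean zero. -/
def L2Zero : Submodule ℝ (Lp ℝ 2 torusMeasure) where
  carrier := {f | ∫ x, f x ∂torusMeasure = 0}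
  zero_mem' := by
    change ∫ x, (0 : Lp ℝ 2 torusMeasure) x ∂torusMeasure = 0
    rw [integral_congr_ae (Lp.coeFn_zero ℝ 2 torusMeasure)]
    simp
  add_mem' := by
    intro f g hf hg
    change ∫ x, (f + g) x ∂torusMeasure = 0
    rw [integral_congr_ae (Lp.coeFn_add f g)]
    simp only [Pi.add_apply]
    rw [integral_add ((Lp.memLp f).integrable (by norm_num))
      ((Lp.memLp g).integrable (by norm_num))]
    rw [mem_ofPred_eq] at hf hg
    rw [hf, hg, add_zero]
  smul_mem' := by
    intro c f hf
    change ∫ x, (c • f) x ∂torusMeasure = 0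
    rw [integral_congr_ae (Lp.coeFn_smul c f)]
    simp only [Pi.smul_apply, integral_smul]
    rw [mem_ofPred_eq] at hf
    rw [hf, smul_zero]

/-- A representative of an element of `L2Zero`, as a function on the torus. -/
def l2fn (f : L2Zero) : Torus → ℝ := (f : Lp ℝ 2 torusMeasure)

/-- `f'` is the weak derivative of `f`, expressed by Fourier coefficients. -/
def IsWeakDeriv (f f' : L2Zero) : Prop :=
  ∀ n : ℤ, coef (l2fn f') n = Complex.I * n * coef (l2fn f) n

lemma L2Zero.coef_add (f g : L2Zero) (n : ℤ) :
    coef (l2fn (f + g)) n = coef (l2fn f) n + coef (l2fn g) n := by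
  have h := BurgersHilbert.coef_add ((Lp.memLp f.1).integrable (by norm_num))
    ((Lp.memLp g.1).integrable (by norm_num)) n
  exact (coef_congr_ae (Lp.coeFn_add f.1 g.1) n).trans h

lemma L2Zero.coef_smul (c : ℝ) (f : L2Zero) (n : ℤ) :
    coef (l2fn (c • f)) n = c * coef (l2fn f) n := by
  rw [← BurgersHilbert.coef_smul]
  exact coef_congr_ae (Lp.coeFn_smul c f.1) n

lemma L2Zero.coef_zero (n : ℤ) : coef (l2fn (0 : L2Zero)) n = 0 := by
  have := L2Zero.coef_smul 0 (0 : L2Zero) n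
  simpa using this

/-- The Sobolev space `H^k` of real mean zero functions on the torus. An element is the tuple
`(f, f', …, f^{(k)})` of a function and its weak derivatives, so that the norm inherited from the
`ℓ²` product is `‖f‖² = ∑_{j ≤ k} ‖f^{(j)}‖²_{L²}`. -/
def Sob (k : ℕ) : Submodule ℝ (PiLp 2 (fun _ : Fin (k + 1) => L2Zero)) where
  carrier := {F | ∀ j : Fin k, IsWeakDeriv (F j.castSucc) (F j.succ)}
  zero_mem' := by
    intro j n
    change coef (l2fn 0) n = Complex.I * n * coef (l2fn 0) n
    rw [L2Zero.coef_zero, mul_zero]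
  add_mem' := by
    intro F G hF hG j n
    rw [PiLp.add_apply, PiLp.add_apply, L2Zero.coef_add, L2Zero.coef_add, hF j n, hG j n]
    ring
  smul_mem' := by
    intro c F hF j n
    rw [PiLp.smul_apply, PiLp.smul_apply, L2Zero.coef_smul, L2Zero.coef_smul, hF j n]
    ring

/-- The function in `L²` underlying an element of `H^k`. -/
def sobToL2 {k : ℕ} (F : Sob k) : L2Zero := F.1 0

/-- The function on the torus underlying an element of `H^k`. -/
def sobFn {k : ℕ} (F : Sob k) : Torus → ℝ := l2fn (sobToL2 F)

/-- The inclusion `H^k ⊆ H^j` for `j ≤ k`. -/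
def sobIncl {j k : ℕ} (h : j ≤ k) (F : Sob k) : Sob j :=
  ⟨WithLp.toLp 2 fun i => F.1 (i.castLE (Nat.succ_le_succ h)), fun i =>
    F.2 (i.castLE h)⟩

/-! ### Smooth periodic functions -/

/-- Smooth `2π`-periodic real functions with mean zero. -/
structure SmoothZero where
  toFun : ℝ → ℝ
  smooth : ContDiff ℝ ∞ toFun
  periodic : Function.Periodic toFun (2 * π)
  mean_zero : ∫ x in (0 : ℝ)..(2 * π), toFun x = 0

instance : CoeFun SmoothZero (fun _ => ℝ → ℝ) := ⟨SmoothZero.toFun⟩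

/-- The derivative `w'`. -/
def SmoothZero.diff (w : SmoothZero) : SmoothZero where
  toFun := deriv w
  smooth := (contDiff_infty_iff_deriv.1 w.smooth).2
  periodic := fun x => by
    have h : (fun y => w (y + 2 * π)) = w := funext w.periodic
    rw [← deriv_comp_add_const, h]
  mean_zero := by
    rw [intervalIntegral.integral_deriv_eq_sub
      (fun x _ => (w.smooth.differentiable (by simp)).differentiableAt)
      ((contDiff_infty_iff_deriv.1 w.smooth).2.continuous.intervalIntegrable _ _)]
    have := w.periodic 0
    rw [zero_add] at this
    rw [this, sub_self]

/-- `w` as a function on the torus. -/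
def SmoothZero.fn (w : SmoothZero) : Torus → ℝ := w.periodic.lift

lemma SmoothZero.continuous_fn (w : SmoothZero) : Continuous w.fn :=
  continuous_coinduced_dom.mpr w.smooth.continuous

lemma SmoothZero.memLp (w : SmoothZero) : MemLp w.fn 2 torusMeasure :=
  (w.continuous_fn.memLp_of_hasCompactSupport (HasCompactSupport.of_compactSpace _))

/-- `w` as an element of `L²`. -/
def SmoothZero.toL2 (w : SmoothZero) : L2Zero :=
  ⟨w.memLp.toLp, by
    change ∫ x, (w.memLp.toLp : Lp ℝ 2 torusMeasure) x ∂torusMeasure = 0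
    rw [integral_congr_ae w.memLp.coeFn_toLp, AddCircle.integral_haarAddCircle,
      ← AddCircle.intervalIntegral_preimage (2 * π) 0]
    have : (∫ a in (0 : ℝ)..0 + 2 * π, w.fn a) = ∫ x in (0 : ℝ)..(2 * π), w x := by
      rw [zero_add]; rfl
    rw [this, w.mean_zero, smul_zero]⟩

lemma SmoothZero.coef_diff (w : SmoothZero) (n : ℤ) :
    coef w.diff.fn n = Complex.I * n * coef w.fn n := by
  have hw : ∀ x : ℝ, HasDerivAt (fun y : ℝ => (w y : ℂ)) ((deriv w x : ℝ) : ℂ) x := fun x =>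
    ((w.smooth.differentiable (by simp)).differentiableAt.hasDerivAt).ofReal_comp
  have he : ∀ x : ℝ, HasDerivAt (fun y : ℝ => fourier (-n) (y : Torus))
      (-2 * π * Complex.I * n / (2 * π : ℝ) * fourier (-n) (x : Torus)) x := fun x =>
    hasDerivAt_fourier_neg (2 * π) n x
  have hc : Continuous fun y : ℝ => (fourier (-n) (y : Torus) : ℂ) :=
    continuous_iff_continuousAt.2 fun x => (he x).continuousAt
  have hd : Continuous (deriv w) := (contDiff_infty_iff_deriv.1 w.smooth).2.continuous
  have key := intervalIntegral.integral_mul_deriv_eq_deriv_mul (a := 0) (b := 2 * π)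
    (fun x _ => he x) (fun x _ => hw x)
    ((continuous_const.mul hc).intervalIntegrable _ _)
    ((Complex.continuous_ofReal.comp hd).intervalIntegrable _ _)
  have hb : (w (2 * π) : ℂ) = w 0 := by
    have := w.periodic 0
    rw [zero_add] at this
    rw [this]
  have hp : ((2 * π : ℝ) : Torus) = ((0 : ℝ) : Torus) := AddCircle.coe_period (2 * π)
  rw [hb, hp, sub_self, zero_sub] at key
  rw [coef, coef, fourierCoeff_eq_intervalIntegral _ n 0, fourierCoeff_eq_intervalIntegral _ n 0,
    zero_add]
  simp only [smul_eq_mul]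
  change (1 / (2 * π) : ℝ) • (∫ x in (0 : ℝ)..(2 * π), fourier (-n) (x : Torus) *
      ((deriv w x : ℝ) : ℂ)) = Complex.I * n * ((1 / (2 * π) : ℝ) •
      ∫ x in (0 : ℝ)..(2 * π), fourier (-n) (x : Torus) * (w x : ℂ))
  rw [key]
  simp only [mul_assoc]
  simp only [intervalIntegral.integral_const_mul, Complex.real_smul]
  have hpi : (π : ℂ) ≠ 0 := by exact_mod_cast Real.pi_ne_zero
  push_cast
  field_simp

lemma SmoothZero.isWeakDeriv (w : SmoothZero) : IsWeakDeriv w.toL2 w.diff.toL2 := by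
  intro n
  have h1 : coef (l2fn w.diff.toL2) n = coef w.diff.fn n := coef_congr_ae w.diff.memLp.coeFn_toLp n
  have h2 : coef (l2fn w.toL2) n = coef w.fn n := coef_congr_ae w.memLp.coeFn_toLp n
  rw [h1, h2, w.coef_diff]

/-- `w` as an element of `H^k`. -/
def SmoothZero.toSob (k : ℕ) (w : SmoothZero) : Sob k :=
  ⟨WithLp.toLp 2 fun j => (SmoothZero.diff^[(j : ℕ)] w).toL2, fun j => by
    have := (SmoothZero.diff^[(j : ℕ)] w).isWeakDeriv
    rw [← Function.iterate_succ_apply' SmoothZero.diff (j : ℕ) w] at this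
    exact this⟩

/-! ### Traveling waves of the Burgers–Hilbert equation and the linearized operator -/

/-- `h = Hf` for the periodic Hilbert transform, the Fourier multiplier `-i sgn n`. -/
def IsHilbertTransform (f h : Torus → ℝ) : Prop :=
  ∀ n : ℤ, coef h n = -Complex.I * (n.sign : ℂ) * coef f n

/-- `u(x + vt)` solves `f_t = Hf + f f_x`, that is, `Hu - v u' + u u' = 0`. -/
def IsTravelingWave (u : SmoothZero) (v : ℝ) : Prop :=
  IsHilbertTransform u.fn (fun x => v * u.diff.fn x - u.fn x * u.diff.fn x)

/-- `ε ↦ (u_ε, v_ε)`, `|ε| < δ`, is the analytic curve of even traveling waves of mean zero that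
bifurcates from `(0, -1)` in the direction of `cos x`, parametrized by the coefficient of `cos x`
in `u_ε`. Comparing powers of `ε` shows that there is at most one such curve for each `δ`. -/
structure IsBifurcationCurve (δ : ℝ) (u : ℝ → SmoothZero) (v : ℝ → ℝ) : Prop where
  pos : 0 < δ
  analytic_u : AnalyticOnNhd ℝ (fun p : ℝ × ℝ => u p.1 p.2) (Ioo (-δ) δ ×ˢ univ)
  analytic_v : AnalyticOnNhd ℝ v (Ioo (-δ) δ)
  u_zero : ∀ x, u 0 x = 0
  v_zero : v 0 = -1
  wave : ∀ ε ∈ Ioo (-δ) δ, IsTravelingWave (u ε) (v ε)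
  even : ∀ ε ∈ Ioo (-δ) δ, ∀ x, u ε (-x) = u ε x
  amplitude : ∀ ε ∈ Ioo (-δ) δ, (1 / π) * ∫ x in (0 : ℝ)..(2 * π), u ε x * cos x = ε

/-- `w = L g` in `L²`, where `L g = -v g_x + H g + (u g)_x` is the linearization of the equation
around the traveling wave `(u, v)`, with the derivatives taken in the weak sense. This is the
graph of `L` as an unbounded operator on `L²` functions of mean zero, with its maximal domain. -/
def IsLinearization (u : SmoothZero) (v : ℝ) (g w : L2Zero) : Prop :=
  ∀ n : ℤ, coef (l2fn w) n =
    Complex.I * n * coef (fun x => (u.fn x - v) * l2fn g x) n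
      - Complex.I * (n.sign : ℂ) * coef (l2fn g) n

/-- `P⁺` and `P⁻` are the spectral projections `P₀^±(ε)` of `L_ε` belonging to the eigenvalue `0`:
bounded projections on `L²` functions of mean zero, onto the lines spanned by
`φ₀⁺ = ∂_ε u_ε` and `φ₀⁻ = -ε⁻¹ u_ε'` respectively, that annihilate each other's range and whose
sum commutes with `L_ε` (so that the kernel of the sum is the complementary spectral subspace).
For small `ε ≠ 0` the generalized kernel of `L_ε` is spanned by `φ₀^±`, and such `P^±` are then
unique. -/
structure IsZeroModeProjection (u : ℝ → SmoothZero) (v : ℝ → ℝ) (ε : ℝ)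
    (Pp Pm : L2Zero →L[ℝ] L2Zero) : Prop where
  idem_plus : ∀ g, Pp (Pp g) = Pp g
  idem_minus : ∀ g, Pm (Pm g) = Pm g
  plus_minus : ∀ g, Pp (Pm g) = 0
  minus_plus : ∀ g, Pm (Pp g) = 0
  range_plus : ∀ w : L2Zero, (∃ g, Pp g = w) ↔
    ∃ c : ℝ, ∀ᵐ x : ℝ, l2fn w (x : Torus) = c * deriv (fun e => u e x) ε
  range_minus : ∀ w : L2Zero, (∃ g, Pm g = w) ↔
    ∃ c : ℝ, ∀ᵐ x : ℝ, l2fn w (x : Torus) = c * (-ε⁻¹ * deriv (u ε) x)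
  commute : ∀ g w : L2Zero, IsLinearization (u ε) (v ε) g w →
    IsLinearization (u ε) (v ε) (Pp g + Pm g) (Pp w + Pm w)

end BurgersHilbert

end

/-! Existence and uniqueness of the branch. Integrated once, the wave equation reads u²/2 - |D|⁻¹u -
vu = const. With u = ε(cos x + w) and v = -1 + εμ, mode 1 determines μ, and the modes n ≥ 2, where 1
- 1/n is invertible, give w = εG(w) with G analytic on a weighted ℓ¹ algebra of cosine coefficients.
The implicit function theorem solves this (`exists_isProfile`), and the exponential weights give
analyticity in x (`contDiff_evalSeries`). Any other curve agrees with this one near ε = 0 by a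
contraction estimate in L² (`travelingWave_unique`), so it suffices to treat the constructed branch.

Projections. Differentiating the wave equation in x and in ε gives Lu' = 0 and L∂_εu = v'(ε)u'.
Dually, L*u = 0 and L*(∂ₓ⁻¹∂_εu) = -v'(ε)u modulo constants. Hence P⁺g = D⁻¹⟨g, u⟩∂_εu and P⁻g =
-D⁻¹⟨g, ∂ₓ⁻¹∂_εu⟩u' with D = ⟨u, ∂_εu⟩. Parity makes each annihilate the range of the other, and D ≈
ε/2 does not vanish for small ε ≠ 0 (`isZeroModeProjection`).

Decomposition. For g = f(· - a) - u_e the conditions P^±g = 0 are two scalar equations for (e, a).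
They degenerate as ε₀ → 0 and are therefore rescaled: f = ε₀h, e = ε₀σ, u_e = e b(e). The rescaled
system `modEq` is smooth up to ε₀ = 0, where its Jacobian in (σ, a) at h = cos x, σ = 1, a = 0 is
diag(-1/2, 1/2). The implicit function theorem gives σ and a, Lipschitz in h, on balls of a size
uniform in ε₀ (`exists_modulation`). Undoing the scaling produces the radius r|ε₀| and the bound of
|e - ε₀| + |ε₀||a| by the L² norm of f - u_{ε₀}, from which the bounds on g follow
(`exists_decomposition`).

Regularity. In `modEq` the translation acts on the analytic profile and not on f, so e and a are
smooth in f even for the L² topology. Only g contains a translate of f itself, and each derivative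
in a costs one Sobolev derivative; hence class C^j into H^{k-j} (`contDiff_transIncl_uncurry`). -/

noncomputable section

namespace BurgersHilbert

open Filter Topology ComplexConjugate

/-! ### Fourier coefficients of square integrable functions -/

/-- Complexification of real square integrable functions. -/
def toComplexL2 : Lp ℝ 2 torusMeasure →L[ℝ] Lp ℂ 2 torusMeasure :=
  Complex.ofRealCLM.compLpL 2 torusMeasure

lemma toComplexL2_ae (f : Lp ℝ 2 torusMeasure) :
    toComplexL2 f =ᵐ[torusMeasure] fun x => (f x : ℂ) :=
  Complex.ofRealCLM.coeFn_compLpL f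

lemma coef_eq_repr (f : Lp ℝ 2 torusMeasure) (n : ℤ) :
    coef f n = fourierBasis.repr (toComplexL2 f) n := by
  rw [fourierBasis_repr]
  exact (congrFun (fourierCoeff_congr_ae (toComplexL2_ae f)) n).symm

lemma inner_toComplexL2 (f g : Lp ℝ 2 torusMeasure) :
    inner ℂ (toComplexL2 f) (toComplexL2 g) = ((inner ℝ f g : ℝ) : ℂ) := by
  rw [L2.inner_def, L2.inner_def, ← integral_complex_ofReal]
  refine integral_congr_ae ?_
  filter_upwards [toComplexL2_ae f, toComplexL2_ae g] with x hf hg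
  rw [hf, hg]
  simp

/-- Polarized Parseval identity for the complex Fourier basis. Every later computation of an inner
product is a comparison of such sums. -/
lemma hasSum_coef_mul_conj (f g : Lp ℝ 2 torusMeasure) :
    HasSum (fun n : ℤ => coef f n * conj (coef g n)) ((inner ℝ f g : ℝ) : ℂ) := by
  have h := (fourierBasis (T := 2 * π)).hasSum_inner_mul_inner (toComplexL2 g) (toComplexL2 f)
  rw [inner_toComplexL2, real_inner_comm] at h
  refine h.congr_fun ?_
  intro n
  rw [coef_eq_repr, coef_eq_repr, HilbertBasis.repr_apply_apply, HilbertBasis.repr_apply_apply,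
    inner_conj_symm, mul_comm]

lemma hasSum_norm_coef_sq (f : Lp ℝ 2 torusMeasure) :
    HasSum (fun n : ℤ => ‖coef f n‖ ^ 2) (‖f‖ ^ 2) := by
  have h := Complex.hasSum_re (hasSum_coef_mul_conj f f)
  rw [Complex.ofReal_re, real_inner_self_eq_norm_sq] at h
  refine h.congr_fun fun n => ?_
  rw [Complex.mul_conj, Complex.ofReal_re, Complex.normSq_eq_norm_sq]

lemma norm_coef_le (f : Lp ℝ 2 torusMeasure) (n : ℤ) : ‖coef f n‖ ≤ ‖f‖ := by
  have h := hasSum_norm_coef_sq f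
  have := le_hasSum h n fun m _ => sq_nonneg _
  exact le_of_sq_le_sq this (norm_nonneg _)

/-- The `n`-th Fourier coefficient as a continuous linear map on `L²`. -/
def coefLp (n : ℤ) : Lp ℝ 2 torusMeasure →L[ℝ] ℂ :=
  LinearMap.mkContinuous
    { toFun := fun f => coef f n
      map_add' := fun f g => (coef_congr_ae (Lp.coeFn_add f g) n).trans
        (coef_add ((Lp.memLp f).integrable (by norm_num)) ((Lp.memLp g).integrable (by norm_num)) n)
      map_smul' := fun c f => (coef_congr_ae (Lp.coeFn_smul c f) n).trans
        ((coef_smul c f n).trans (by simp)) } 1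
    fun f => by rw [one_mul]; exact norm_coef_le f n

/-- The `n`-th Fourier coefficient as a continuous linear map on `L²` functions of mean zero. -/
def coefL (n : ℤ) : L2Zero →L[ℝ] ℂ := (coefLp n).comp L2Zero.subtypeL

/-- The `n`-th Fourier coefficient as a continuous linear map on continuous functions. -/
def coefC (n : ℤ) : C(Torus, ℝ) →L[ℝ] ℂ :=
  (coefLp n).comp (ContinuousMap.toLp 2 torusMeasure ℝ)

lemma coefC_apply (n : ℤ) (f : C(Torus, ℝ)) : coefC n f = coef f n :=
  coef_congr_ae (ContinuousMap.coeFn_toLp torusMeasure f) n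

lemma Lp_ext_coef {f g : Lp ℝ 2 torusMeasure} (h : ∀ n, coef f n = coef g n) : f = g := by
  have h1 : toComplexL2 f = toComplexL2 g := by
    apply (fourierBasis (T := 2 * π)).repr.injective
    ext n
    rw [← coef_eq_repr, ← coef_eq_repr, h]
  refine Lp.ext ?_
  filter_upwards [toComplexL2_ae f, toComplexL2_ae g] with x hf hg
  rw [h1] at hf
  exact_mod_cast hf.symm.trans hg

lemma L2Zero.ext_coef {f g : L2Zero} (h : ∀ n, coef (l2fn f) n = coef (l2fn g) n) : f = g :=
  Subtype.ext (Lp_ext_coef h)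

lemma ae_eq_of_coef_eq {f g : Torus → ℝ} (hf : MemLp f 2 torusMeasure)
    (hg : MemLp g 2 torusMeasure) (h : ∀ n, coef f n = coef g n) : f =ᵐ[torusMeasure] g := by
  have : hf.toLp = hg.toLp := Lp_ext_coef fun n => by
    rw [coef_congr_ae hf.coeFn_toLp, coef_congr_ae hg.coeFn_toLp, h]
  exact hf.coeFn_toLp.symm.trans ((EventuallyEq.of_eq (by rw [this])).trans hg.coeFn_toLp)

lemma memLp_of_continuous {f : Torus → ℝ} (hf : Continuous f) : MemLp f 2 torusMeasure :=
  hf.memLp_of_hasCompactSupport (HasCompactSupport.of_compactSpace _)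

lemma integrable_of_continuous {f : Torus → ℝ} (hf : Continuous f) : Integrable f torusMeasure :=
  (memLp_of_continuous hf).integrable (by norm_num)

lemma eq_of_coef_eq {f g : Torus → ℝ} (hf : Continuous f) (hg : Continuous g)
    (h : ∀ n, coef f n = coef g n) : f = g :=
  (Continuous.ae_eq_iff_eq torusMeasure hf hg).1
    (ae_eq_of_coef_eq (memLp_of_continuous hf) (memLp_of_continuous hg) h)

lemma inner_toLp {f g : Torus → ℝ} (hf : MemLp f 2 torusMeasure) (hg : MemLp g 2 torusMeasure) :
    inner ℝ hf.toLp hg.toLp = ∫ x, f x * g x ∂torusMeasure := by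
  rw [L2.inner_def]
  refine integral_congr_ae ?_
  filter_upwards [hf.coeFn_toLp, hg.coeFn_toLp] with x h1 h2
  rw [h1, h2]
  simp [mul_comm]

lemma hasSum_coef_mul_conj_of_memLp {f g : Torus → ℝ} (hf : MemLp f 2 torusMeasure)
    (hg : MemLp g 2 torusMeasure) :
    HasSum (fun n : ℤ => coef f n * conj (coef g n)) ((∫ x, f x * g x ∂torusMeasure : ℝ) : ℂ) := by
  have h := hasSum_coef_mul_conj hf.toLp hg.toLp
  rw [inner_toLp] at h
  refine h.congr_fun fun n => ?_
  rw [coef_congr_ae hf.coeFn_toLp, coef_congr_ae hg.coeFn_toLp]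

lemma coef_zero_eq (f : Torus → ℝ) : coef f 0 = ((∫ x, f x ∂torusMeasure : ℝ) : ℂ) := by
  rw [coef, fourierCoeff, ← integral_complex_ofReal]
  simp

lemma L2Zero.coef_at_zero (f : L2Zero) : coef (l2fn f) 0 = 0 := by
  rw [coef_zero_eq]
  have : ∫ x, l2fn f x ∂torusMeasure = 0 := f.2
  rw [this]; simp

lemma coef_comp_sub (f : Torus → ℝ) (a : Torus) (n : ℤ) :
    coef (fun x => f (x - a)) n = fourier (-n) a * coef f n := by
  rw [coef, coef, fourierCoeff, fourierCoeff, ← integral_const_mul,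
    ← integral_sub_right_eq_self (μ := torusMeasure) _ (-a)]
  congr 1
  funext x
  simp only [sub_neg_eq_add, add_sub_cancel_right, smul_eq_mul]
  rw [fourier_apply, fourier_apply, fourier_apply, smul_add, AddCircle.toCircle_add]
  push_cast
  ring

lemma coef_comp_neg (f : Torus → ℝ) (n : ℤ) :
    coef (fun x => f (-x)) n = coef f (-n) := by
  rw [coef, coef, fourierCoeff, fourierCoeff,
    ← integral_neg_eq_self (μ := torusMeasure)]
  congr 1
  funext x
  simp [fourier_apply]

/-! ### Bounded linear maps on `ℓ¹` -/

/-- Absolutely summable real sequences. -/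
abbrev Ell : Type := lp (fun _ : ℕ => ℝ) 1

/-- The `n`-th unit vector of `ℓ¹`. -/
def unitVec (n : ℕ) : Ell := lp.single 1 n (1 : ℝ)

@[simp] lemma norm_unitVec (n : ℕ) : ‖unitVec n‖ = 1 := by
  rw [unitVec, lp.norm_single (by norm_num)]; simp

lemma unitVec_apply (n m : ℕ) : unitVec n m = if m = n then 1 else 0 := by
  rw [unitVec, lp.single_apply]
  split_ifs with h
  · subst h; simp
  · simp [h]

lemma Ell.hasSum_norm (b : Ell) : HasSum (fun n => ‖b n‖) ‖b‖ := by
  have := lp.hasSum_norm (p := 1) (by norm_num) b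
  simpa using this

section EllMap

variable {Y : Type*} [NormedAddCommGroup Y] [NormedSpace ℝ Y] [CompleteSpace Y]

lemma summable_smul_of_bounded {v : ℕ → Y} {C : ℝ} (hv : ∀ n, ‖v n‖ ≤ C) (b : Ell) :
    Summable fun n => b n • v n :=
  Summable.of_norm_bounded ((Ell.hasSum_norm b).summable.mul_right C) fun n => by
    rw [norm_smul]; exact mul_le_mul_of_nonneg_left (hv n) (norm_nonneg _)

/-- The bounded linear map on `ℓ¹` that sends the `n`-th unit vector to `v n`, for a bounded
sequence `v`. -/
def ellMap (v : ℕ → Y) (C : ℝ) (hv : ∀ n, ‖v n‖ ≤ C) : Ell →L[ℝ] Y :=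
  LinearMap.mkContinuous
    { toFun := fun b => ∑' n, b n • v n
      map_add' := fun b c => by
        rw [← (summable_smul_of_bounded hv b).tsum_add (summable_smul_of_bounded hv c)]
        simp [add_smul]
      map_smul' := fun r b => by
        rw [RingHom.id_apply, ← (summable_smul_of_bounded hv b).tsum_const_smul]
        simp [mul_smul] } C
    fun b => by
      have h := (Ell.hasSum_norm b).mul_left C
      refine tsum_of_norm_bounded h fun n => ?_
      rw [norm_smul, mul_comm]
      exact mul_le_mul_of_nonneg_right (hv n) (norm_nonneg _)

lemma norm_ellMap_le {v : ℕ → Y} {C : ℝ} (hv : ∀ n, ‖v n‖ ≤ C) : ‖ellMap v C hv‖ ≤ C :=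
  LinearMap.mkContinuous_norm_le _ ((norm_nonneg _).trans (hv 0)) _

@[simp] lemma ellMap_unitVec {v : ℕ → Y} {C : ℝ} (hv : ∀ n, ‖v n‖ ≤ C) (n : ℕ) :
    ellMap v C hv (unitVec n) = v n := by
  change ∑' m, unitVec n m • v m = v n
  rw [tsum_eq_single n]
  · simp [unitVec_apply]
  · intro m hm
    simp [unitVec_apply, hm]

end EllMap

/-- Finite combinations of unit vectors are dense in ℓ¹. This reduces the operator identities below
to trigonometric identities for single modes. -/
lemma Ell.clm_ext {Y : Type*} [NormedAddCommGroup Y] [NormedSpace ℝ Y]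
    {S T : Ell →L[ℝ] Y} (h : ∀ n, S (unitVec n) = T (unitVec n)) : S = T := by
  ext b
  have hb := lp.hasSum_single (p := 1) (by norm_num) b
  have key : ∀ R : Ell →L[ℝ] Y, HasSum (fun n => b n • R (unitVec n)) (R b) := fun R => by
    refine (hb.mapL R).congr_fun fun n => ?_
    rw [← R.map_smul, unitVec, ← lp.single_smul]
    simp
  have h1 := key S
  simp only [h] at h1
  exact h1.unique (key T)

lemma Ell.bilin_ext {Y : Type*} [NormedAddCommGroup Y] [NormedSpace ℝ Y]
    {S T : Ell →L[ℝ] Ell →L[ℝ] Y}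
    (h : ∀ m n, S (unitVec m) (unitVec n) = T (unitVec m) (unitVec n)) : S = T :=
  Ell.clm_ext fun m => Ell.clm_ext fun n => h m n

/-- The `n`-th coordinate on `ℓ¹`. -/
def coord (n : ℕ) : Ell →L[ℝ] ℝ :=
  ellMap (fun m => if m = n then 1 else 0) 1 fun m => by split_ifs <;> simp

lemma coord_unitVec (n m : ℕ) : coord n (unitVec m) = if m = n then 1 else 0 := by
  simp [coord]

lemma Ell.ext_coord {b c : Ell} (h : ∀ n, coord n b = coord n c) : b = c := by
  have : ∀ n, ∀ d : Ell, coord n d = d n := fun n d => by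
    change ∑' m, d m • (if m = n then (1 : ℝ) else 0) = d n
    rw [tsum_eq_single n]
    · simp
    · intro m hm; simp [hm]
  ext n
  rw [← this, ← this, h]

/-! ### Cosine and sine series with exponentially decaying coefficients -/

/-- The function `cos (n x)` on the torus. -/
def cosT (n : ℤ) : C(Torus, ℝ) := ⟨fun x => (fourier n x).re, by fun_prop⟩

/-- The function `sin (n x)` on the torus. -/
def sinT (n : ℤ) : C(Torus, ℝ) := ⟨fun x => (fourier n x).im, by fun_prop⟩

lemma cosT_apply (n : ℤ) (x : Torus) : cosT n x = (fourier n x).re := rfl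

lemma sinT_apply (n : ℤ) (x : Torus) : sinT n x = (fourier n x).im := rfl

lemma fourier_coe_torus (n : ℤ) (x : ℝ) :
    (fourier n (x : Torus) : ℂ) = Complex.exp (((n * x : ℝ) : ℂ) * Complex.I) := by
  rw [fourier_coe_apply]
  congr 1
  have : (π : ℂ) ≠ 0 := by exact_mod_cast Real.pi_ne_zero
  push_cast
  field_simp

lemma cosT_coe (n : ℤ) (x : ℝ) : cosT n (x : Torus) = cos (n * x) := by
  rw [cosT_apply, fourier_coe_torus, Complex.exp_ofReal_mul_I_re]

lemma sinT_coe (n : ℤ) (x : ℝ) : sinT n (x : Torus) = sin (n * x) := by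
  rw [sinT_apply, fourier_coe_torus, Complex.exp_ofReal_mul_I_im]

lemma Torus.funext {f g : C(Torus, ℝ)} (h : ∀ x : ℝ, f (x : Torus) = g (x : Torus)) : f = g := by
  ext x
  induction x using QuotientAddGroup.induction_on with
  | H x => exact h x

lemma norm_cosT_le (n : ℤ) : ‖cosT n‖ ≤ 1 := by
  refine (ContinuousMap.norm_le _ zero_le_one).2 fun x => ?_
  refine (Complex.abs_re_le_norm _).trans ?_
  exact (Circle.norm_coe _).le

lemma norm_sinT_le (n : ℤ) : ‖sinT n‖ ≤ 1 := by
  refine (ContinuousMap.norm_le _ zero_le_one).2 fun x => ?_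
  refine (Complex.abs_im_le_norm _).trans ?_
  exact (Circle.norm_coe _).le

lemma fourierCoeff_add_mul (m n : ℤ) (a b : ℂ) (k : ℤ) :
    fourierCoeff (fun x : Torus => a * fourier m x + b * fourier n x) k =
      a * (if k = m then 1 else 0) + b * (if k = n then 1 else 0) := by
  have hi : ∀ (j : ℤ) (c : ℂ), Integrable (fun x : Torus => c * fourier j x) torusMeasure :=
    fun j c => Continuous.integrable_of_hasCompactSupport (by fun_prop)
      (HasCompactSupport.of_compactSpace _)
  have h := congrFun (fourierCoeff.add (hi m a) (hi n b)) k
  have h2 : fourierCoeff (fun x : Torus => a * fourier m x + b * fourier n x) k = _ := h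
  rw [h2, Pi.add_apply]
  have hf : ∀ j : ℤ, fourierCoeff (fun x : Torus => (fourier j x : ℂ)) k = if k = j then 1 else 0 := by
    intro j
    have := congrFun (fourierCoeff_fourier (T := 2 * π) j) k
    rw [Pi.single_apply] at this
    exact this
  rw [fourierCoeff.const_mul, fourierCoeff.const_mul, hf, hf]

lemma coef_cosT (n k : ℤ) :
    coef (cosT n) k = ((if k = n then 1 else 0) + (if k = -n then 1 else 0)) / 2 := by
  have : (fun x => ((cosT n x : ℝ) : ℂ)) =
      fun x : Torus => (1 / 2 : ℂ) * fourier n x + (1 / 2) * fourier (-n) x := by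
    funext x
    rw [cosT_apply, fourier_neg, Complex.re_eq_add_conj]
    ring
  rw [coef, this, fourierCoeff_add_mul]
  ring

lemma coef_sinT (n k : ℤ) :
    coef (sinT n) k =
      -Complex.I * ((if k = n then 1 else 0) - (if k = -n then 1 else 0)) / 2 := by
  have : (fun x => ((sinT n x : ℝ) : ℂ)) =
      fun x : Torus => (-Complex.I / 2 : ℂ) * fourier n x + (Complex.I / 2) * fourier (-n) x := by
    funext x
    rw [sinT_apply, fourier_neg, Complex.im_eq_sub_conj]
    field_simp
    rw [Complex.I_sq]
    ring
  rw [coef, this, fourierCoeff_add_mul]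
  ring

/-- The decay rate of the Fourier coefficients. -/
def decay : ℝ := 1 / 4

lemma decay_pos : 0 < decay := by norm_num [decay]

lemma decay_pow_le_one (n : ℕ) : decay ^ n ≤ 1 := pow_le_one₀ decay_pos.le (by norm_num [decay])

/-- The exponential weight absorbs the factor n of one derivative, which makes `derivSeries` bounded
on `Ell`. -/
lemma mul_decay_pow_le_one (n : ℕ) : (n : ℝ) * decay ^ n ≤ 1 := by
  have : (n : ℝ) ≤ 4 ^ n := by exact_mod_cast (Nat.lt_pow_self (by norm_num)).le
  rw [decay, div_pow, one_pow, mul_one_div, div_le_one (by positivity)]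
  exact this

lemma norm_smul_cosT_le {c : ℝ} (hc : |c| ≤ 1) (n : ℤ) : ‖c • cosT n‖ ≤ 1 := by
  rw [norm_smul]; exact mul_le_one₀ hc (norm_nonneg _) (norm_cosT_le n)

lemma norm_smul_sinT_le {c : ℝ} (hc : |c| ≤ 1) (n : ℤ) : ‖c • sinT n‖ ≤ 1 := by
  rw [norm_smul]; exact mul_le_one₀ hc (norm_nonneg _) (norm_sinT_le n)

lemma abs_decay_pow_le (n : ℕ) : |decay ^ n| ≤ 1 := by
  rw [abs_of_nonneg (pow_nonneg decay_pos.le n)]; exact decay_pow_le_one n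

lemma abs_neg_mul_decay_pow_le (n : ℕ) : |-(n * decay ^ n)| ≤ 1 := by
  rw [abs_neg, abs_of_nonneg (mul_nonneg n.cast_nonneg (pow_nonneg decay_pos.le n))]
  exact mul_decay_pow_le_one n

lemma abs_inv_nat_le (n : ℕ) : |(n : ℝ)⁻¹| ≤ 1 := by
  rw [abs_of_nonneg (by positivity)]
  rcases Nat.eq_zero_or_pos n with rfl | h
  · simp
  · exact inv_le_one_of_one_le₀ (by exact_mod_cast h)

lemma abs_inv_mul_decay_pow_le (n : ℕ) : |(n : ℝ)⁻¹ * decay ^ n| ≤ 1 := by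
  rw [abs_mul]
  exact mul_le_one₀ (abs_inv_nat_le n) (abs_nonneg _) (abs_decay_pow_le n)

/-- The series `∑ bₙ qⁿ cos (n x)`. -/
def cosSeries : Ell →L[ℝ] C(Torus, ℝ) :=
  ellMap (fun n => decay ^ n • cosT n) 1 fun n => norm_smul_cosT_le (abs_decay_pow_le n) n

/-- The termwise derivative `-∑ n bₙ qⁿ sin (n x)` of `cosSeries`. -/
def derivSeries : Ell →L[ℝ] C(Torus, ℝ) :=
  ellMap (fun n => (-(n * decay ^ n)) • sinT n) 1
    fun n => norm_smul_sinT_le (abs_neg_mul_decay_pow_le n) n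

/-- The series `∑ bₙ qⁿ sin (n x)`, the Hilbert transform of `cosSeries`. -/
def sinSeries : Ell →L[ℝ] C(Torus, ℝ) :=
  ellMap (fun n => decay ^ n • sinT n) 1 fun n => norm_smul_sinT_le (abs_decay_pow_le n) n

/-- The termwise antiderivative `∑ n⁻¹ bₙ qⁿ sin (n x)` of `cosSeries`. -/
def antiderivSeries : Ell →L[ℝ] C(Torus, ℝ) :=
  ellMap (fun n => ((n : ℝ)⁻¹ * decay ^ n) • sinT n) 1
    fun n => norm_smul_sinT_le (abs_inv_mul_decay_pow_le n) n

/-- The Fourier multiplier `|n|⁻¹`. -/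
def invLam : Ell →L[ℝ] Ell :=
  ellMap (fun n => (n : ℝ)⁻¹ • unitVec n) 1 fun n => by
    rw [norm_smul, norm_unitVec, mul_one]; exact abs_inv_nat_le n

/-- The product of two unit vectors, from
`cos m x cos n x = (cos (m + n) x + cos (m - n) x) / 2`. -/
def unitProd (m n : ℕ) : Ell :=
  -- With truncated subtraction, `m - n + (n - m)` is |m - n|. Since q^(m+n) = q^(2 min(m,n))
  -- q^|m-n|, the lower mode keeps the factor q^(2 min(m,n)).
  (1 / 2 : ℝ) • (unitVec (m + n) + decay ^ (2 * min m n) • unitVec (m - n + (n - m)))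

lemma norm_unitProd_le (m n : ℕ) : ‖unitProd m n‖ ≤ 1 := by
  rw [unitProd, norm_smul]
  have h1 : ‖unitVec (m + n) + decay ^ (2 * min m n) • unitVec (m - n + (n - m))‖ ≤ 1 + 1 := by
    refine (norm_add_le _ _).trans ?_
    rw [norm_unitVec, norm_smul, norm_unitVec, mul_one]
    gcongr
    exact abs_decay_pow_le _
  have h2 : ‖(1 / 2 : ℝ)‖ = 1 / 2 := by norm_num
  rw [h2]
  linarith

/-- The product of cosine series, as a bounded bilinear map on `ℓ¹`. -/
def ellMul : Ell →L[ℝ] Ell →L[ℝ] Ell :=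
  ellMap (fun m => ellMap (fun n => unitProd m n) 1 (norm_unitProd_le m)) 1
    fun m => norm_ellMap_le (norm_unitProd_le m)

lemma ellMul_unitVec (m n : ℕ) : ellMul (unitVec m) (unitVec n) = unitProd m n := by
  simp [ellMul]

lemma unitProd_comm (m n : ℕ) : unitProd m n = unitProd n m := by
  rw [unitProd, unitProd, add_comm m n, min_comm, add_comm (m - n)]

lemma ellMul_comm (b c : Ell) : ellMul b c = ellMul c b := by
  have : ellMul = ellMul.flip := Ell.bilin_ext fun m n => by
    rw [ContinuousLinearMap.flip_apply, ellMul_unitVec, ellMul_unitVec, unitProd_comm]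
  exact congrArg (fun S => S b c) this

lemma decay_pow_split {m n : ℕ} (h : m ≤ n) : decay ^ (2 * m) * decay ^ (n - m) = decay ^ (m + n) := by
  rw [← pow_add]; congr 1; omega

lemma cosSeries_unitProd (m n : ℕ) :
    cosSeries (unitProd m n) = (decay ^ m • cosT m) * (decay ^ n • cosT n) := by
  wlog h : m ≤ n generalizing m n
  · rw [unitProd_comm, this n m (le_of_not_ge h)]; exact mul_comm _ _
  refine Torus.funext fun x => ?_
  have h1 : ((n - m : ℕ) : ℝ) = n - m := by push_cast [h]; ring
  simp only [unitProd, min_eq_left h, Nat.sub_eq_zero_of_le h, zero_add, map_smul, map_add,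
    cosSeries, ellMap_unitVec, ContinuousMap.smul_apply, ContinuousMap.add_apply,
    ContinuousMap.mul_apply, smul_eq_mul, cosT_coe, Int.cast_natCast]
  rw [← mul_assoc (decay ^ (2 * m)), decay_pow_split h, h1, Nat.cast_add, add_mul, sub_mul, cos_add,
    cos_sub, pow_add]
  ring

lemma derivSeries_unitProd (m n : ℕ) :
    derivSeries (unitProd m n) = ((-(m * decay ^ m)) • sinT m) * (decay ^ n • cosT n) +
      (decay ^ m • cosT m) * ((-(n * decay ^ n)) • sinT n) := by
  wlog h : m ≤ n generalizing m n
  · rw [unitProd_comm, this n m (le_of_not_ge h)]; ring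
  refine Torus.funext fun x => ?_
  have h1 : ((n - m : ℕ) : ℝ) = n - m := by push_cast [h]; ring
  simp only [unitProd, min_eq_left h, Nat.sub_eq_zero_of_le h, zero_add, map_smul, map_add,
    derivSeries, ellMap_unitVec, ContinuousMap.smul_apply, ContinuousMap.add_apply,
    ContinuousMap.mul_apply, smul_eq_mul, cosT_coe, sinT_coe, Int.cast_natCast]
  have h2 : decay ^ (2 * m) * (-(((n - m : ℕ) : ℝ) * decay ^ (n - m)) * sin ((n - m : ℕ) * x)) =
      -((n - m : ℕ) : ℝ) * (decay ^ (2 * m) * decay ^ (n - m)) * sin ((n - m : ℕ) * x) := by ring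
  rw [h2, decay_pow_split h, h1, Nat.cast_add, add_mul (m : ℝ) n x, sub_mul, sin_add,
    sin_sub, pow_add]
  ring

lemma cosSeries_ellMul (b c : Ell) : cosSeries (ellMul b c) = cosSeries b * cosSeries c := by
  have : (ContinuousLinearMap.compL ℝ Ell Ell _ cosSeries).comp ellMul =
      (ContinuousLinearMap.mul ℝ C(Torus, ℝ)).bilinearComp cosSeries cosSeries :=
    Ell.bilin_ext fun m n => by
      change cosSeries (ellMul (unitVec m) (unitVec n)) =
        cosSeries (unitVec m) * cosSeries (unitVec n)
      rw [ellMul_unitVec, cosSeries_unitProd]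
      simp [cosSeries]
  exact congrArg (fun S => S b c) this

lemma derivSeries_ellMul (b c : Ell) :
    derivSeries (ellMul b c) = derivSeries b * cosSeries c + cosSeries b * derivSeries c := by
  have : (ContinuousLinearMap.compL ℝ Ell Ell _ derivSeries).comp ellMul =
      (ContinuousLinearMap.mul ℝ C(Torus, ℝ)).bilinearComp derivSeries cosSeries +
      (ContinuousLinearMap.mul ℝ C(Torus, ℝ)).bilinearComp cosSeries derivSeries :=
    Ell.bilin_ext fun m n => by
      change derivSeries (ellMul (unitVec m) (unitVec n)) =
        derivSeries (unitVec m) * cosSeries (unitVec n) +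
        cosSeries (unitVec m) * derivSeries (unitVec n)
      rw [ellMul_unitVec, derivSeries_unitProd]
      simp [cosSeries, derivSeries]
  exact congrArg (fun S => S b c) this

/-- This is ∂ₓ|D|⁻¹ = -H on even series. Through it the wave equation is the x-derivative of an
equation with bounded operators only. -/
lemma derivSeries_invLam (b : Ell) : derivSeries (invLam b) = -sinSeries b := by
  have : derivSeries.comp invLam = -sinSeries := Ell.clm_ext fun n => by
    rcases Nat.eq_zero_or_pos n with rfl | h
    · refine Torus.funext fun x => ?_
      simp [derivSeries, invLam, sinSeries, sinT_coe]
    · have : (n : ℝ) ≠ 0 := by positivity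
      simp only [derivSeries, invLam, sinSeries, ContinuousLinearMap.comp_apply, ellMap_unitVec,
        map_smul, smul_smul, neg_apply, ← neg_smul]
      congr 1
      field_simp
  exact congrArg (fun S => S b) this

/-- Two termwise computed maps have proportional Fourier coefficients if this holds for unit
vectors. -/
lemma coef_eq_mul_coef {S T : Ell →L[ℝ] C(Torus, ℝ)} (k : ℤ) (z : ℂ)
    (h : ∀ n, coef (S (unitVec n)) k = z * coef (T (unitVec n)) k) (b : Ell) :
    coef (S b) k = z * coef (T b) k := by
  have : (coefC k).comp S = (ContinuousLinearMap.mul ℝ ℂ z).comp ((coefC k).comp T) :=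
    Ell.clm_ext fun n => by
      simp only [ContinuousLinearMap.comp_apply, ContinuousLinearMap.mul_apply', coefC_apply, h]
  have := congrArg (fun S => S b) this
  simpa only [ContinuousLinearMap.comp_apply, ContinuousLinearMap.mul_apply', coefC_apply] using this

lemma coef_smul_fn (c : ℝ) (f : C(Torus, ℝ)) (k : ℤ) : coef (c • f : C(Torus, ℝ)) k = c * coef f k := by
  rw [ContinuousMap.coe_smul, coef_smul]

lemma coef_derivSeries (b : Ell) (k : ℤ) :
    coef (derivSeries b) k = Complex.I * k * coef (cosSeries b) k := by
  refine coef_eq_mul_coef k _ (fun n => ?_) b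
  simp only [derivSeries, cosSeries, ellMap_unitVec, coef_smul_fn, coef_cosT, coef_sinT]
  by_cases h1 : k = n
  · by_cases h2 : k = -n
    · have : n = 0 := by omega
      subst this; simp_all
    · subst h1; simp [h2]; ring
  · by_cases h2 : k = -n
    · subst h2; simp [h1]; ring
    · simp [h1, h2]

lemma coef_sinSeries (b : Ell) (k : ℤ) :
    coef (sinSeries b) k = -Complex.I * (k.sign : ℂ) * coef (cosSeries b) k := by
  refine coef_eq_mul_coef k _ (fun n => ?_) b
  simp only [sinSeries, cosSeries, ellMap_unitVec, coef_smul_fn, coef_cosT, coef_sinT]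
  rcases Nat.eq_zero_or_pos n with rfl | hn
  · by_cases h : k = 0 <;> simp [h]
  by_cases h1 : k = n
  · have h2 : ¬ k = -n := by omega
    have : k.sign = 1 := Int.sign_eq_one_of_pos (by omega)
    rw [if_pos h1, if_neg h2, this]; push_cast; ring
  · by_cases h2 : k = -n
    · have : k.sign = -1 := Int.sign_eq_neg_one_of_neg (by omega)
      rw [if_neg h1, if_pos h2, this]; push_cast; ring
    · simp [h1, h2]

lemma coef_antiderivSeries (b : Ell) (k : ℤ) (hk : k ≠ 0) :
    coef (cosSeries b) k = Complex.I * k * coef (antiderivSeries b) k := by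
  refine coef_eq_mul_coef k _ (fun n => ?_) b
  simp only [antiderivSeries, cosSeries, ellMap_unitVec, coef_smul_fn, coef_cosT, coef_sinT]
  rcases Nat.eq_zero_or_pos n with rfl | hn
  · simp [hk]
  have hn' : (n : ℂ) ≠ 0 := by exact_mod_cast hn.ne'
  push_cast
  by_cases h1 : k = n
  · have h2 : ¬ k = -n := by omega
    rw [if_pos h1, if_neg h2, h1]; push_cast; field_simp; rw [Complex.I_sq]; ring
  · by_cases h2 : k = -n
    · rw [if_neg h1, if_pos h2, h2]; push_cast; field_simp; rw [Complex.I_sq]; ring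
    · simp [h1, h2]

lemma coef_antiderivSeries_zero (b : Ell) : coef (antiderivSeries b) 0 = 0 := by
  have := coef_eq_mul_coef (S := antiderivSeries) (T := antiderivSeries) 0 0 (fun n => ?_) b
  · simpa using this
  · simp only [antiderivSeries, ellMap_unitVec, coef_smul_fn, coef_sinT]
    by_cases h : (0 : ℤ) = n
    · have : n = 0 := by omega
      subst this; simp
    · have h2 : ¬ (0 : ℤ) = -n := by omega
      simp [h, h2]

lemma coef_cosSeries_nat (b : Ell) (n : ℕ) (hn : n ≠ 0) :
    coef (cosSeries b) n = (decay ^ n * coord n b / 2 : ℝ) := by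
  have : (coefC n).comp cosSeries =
      (Complex.ofRealCLM).comp ((decay ^ n / 2) • coord n) :=
    Ell.clm_ext fun m => by
      simp only [ContinuousLinearMap.comp_apply, coefC_apply, cosSeries, ellMap_unitVec,
        coef_smul_fn, coef_cosT, smul_apply, coord_unitVec]
      have h2 : ¬ (n : ℤ) = -m := by omega
      by_cases h : n = m
      · subst h; simp [h2]; ring
      · have : ¬ m = n := fun h' => h h'.symm
        simp [h, h2, this]
  have := congrArg (fun S => S b) this
  simp only [ContinuousLinearMap.comp_apply, coefC_apply, smul_apply,
    Complex.ofRealCLM_apply] at this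
  rw [this]
  push_cast [smul_eq_mul]
  ring

lemma coef_cosSeries_zero (b : Ell) : coef (cosSeries b) 0 = (coord 0 b : ℝ) := by
  have : (coefC 0).comp cosSeries = (Complex.ofRealCLM).comp (coord 0) :=
    Ell.clm_ext fun m => by
      simp only [ContinuousLinearMap.comp_apply, coefC_apply, cosSeries, ellMap_unitVec,
        coef_smul_fn, coef_cosT, coord_unitVec]
      rcases Nat.eq_zero_or_pos m with rfl | h
      · simp
      · have h1 : ¬ (0 : ℤ) = m := by omega
        have h2 : ¬ m = 0 := by omega
        simp [h1, h2]
  have := congrArg (fun S => S b) this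
  simpa only [ContinuousLinearMap.comp_apply, coefC_apply, Complex.ofRealCLM_apply] using this

lemma cosT_neg (n : ℤ) (x : Torus) : cosT n (-x) = cosT n x := by
  induction x using QuotientAddGroup.induction_on with
  | H x =>
    change cosT n ((-x : ℝ) : Torus) = cosT n (x : Torus)
    rw [cosT_coe, cosT_coe, mul_neg, cos_neg]

lemma cosSeries_neg (b : Ell) (x : Torus) : cosSeries b (-x) = cosSeries b x := by
  have : (ContinuousMap.evalCLM ℝ (-x)).comp cosSeries = (ContinuousMap.evalCLM ℝ x).comp cosSeries :=
    Ell.clm_ext fun n => by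
      change cosSeries (unitVec n) (-x) = cosSeries (unitVec n) x
      simp [cosSeries, cosT_neg]
  exact congrArg (fun S => S b) this

/-! ### Analyticity of cosine series -/

/-- The left shift on `ℓ¹`. -/
def shift : Ell →L[ℝ] Ell :=
  ellMap (fun n => if n = 0 then 0 else unitVec (n - 1)) 1 fun n => by split_ifs <;> simp

lemma norm_shift_le : ‖shift‖ ≤ 1 := norm_ellMap_le _

/-- The value of a cosine series at a point. -/
def evalSeries (x : ℝ) : Ell →L[ℝ] ℝ := (ContinuousMap.evalCLM ℝ (x : Torus)).comp cosSeries

lemma evalSeries_apply (x : ℝ) (b : Ell) : evalSeries x b = cosSeries b (x : Torus) := rfl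

lemma evalSeries_unitVec (x : ℝ) (n : ℕ) : evalSeries x (unitVec n) = decay ^ n * cos (n * x) := by
  simp [evalSeries_apply, cosSeries, cosT_coe]

/-- The operator `1 - 2 q cos x T + q² T²`, where `T` is the left shift. -/
def shiftPoly (x : ℝ) : Ell →L[ℝ] Ell :=
  1 - ((2 * decay * cos x) • shift - decay ^ 2 • (shift * shift))

/-- Neumann series: the perturbation of 1 has norm at most 2q + q² = 9/16 for q = 1/4. -/
lemma isUnit_shiftPoly (x : ℝ) : IsUnit (shiftPoly x) := by
  refine isUnit_one_sub_of_norm_lt_one ?_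
  have h1 : ‖(2 * decay * cos x) • shift‖ ≤ 1 / 2 := by
    rw [norm_smul, norm_mul, norm_eq_abs (cos x)]
    have : ‖2 * decay‖ = 1 / 2 := by norm_num [decay]
    rw [this]
    have := mul_le_one₀ (abs_cos_le_one x) (norm_nonneg shift) norm_shift_le
    rw [mul_assoc]; linarith
  have h2 : ‖decay ^ 2 • (shift * shift)‖ ≤ 1 / 16 := by
    rw [norm_smul]
    have : ‖decay ^ 2‖ = 1 / 16 := by norm_num [decay]
    rw [this]
    have := (norm_mul_le shift shift).trans
      (mul_le_one₀ norm_shift_le (norm_nonneg shift) norm_shift_le)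
    linarith
  linarith [norm_sub_le ((2 * decay * cos x) • shift) (decay ^ 2 • (shift * shift))]

/-- The Chebyshev recursion cos((n+1)x) = 2 cos x cos(nx) - cos((n-1)x) cancels every mode n ≥ 2, so
that only the boundary terms n = 0, 1 remain. It is the operator form of the generating function of
q^n cos(nx). -/
lemma evalSeries_comp_shiftPoly (x : ℝ) :
    (evalSeries x).comp (shiftPoly x) = (coord 0).comp (1 - (decay * cos x) • shift) := by
  refine Ell.clm_ext fun n => ?_
  simp only [shiftPoly, ContinuousLinearMap.comp_apply, sub_apply, one_apply_eq_self,
    smul_apply, mul_apply_eq_comp, map_sub, map_smul,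
    evalSeries_unitVec, coord_unitVec, smul_eq_mul]
  rcases n with _ | _ | n
  · simp [shift]
  · simp [shift, evalSeries_unitVec, coord_unitVec]; ring
  · simp only [shift, ellMap_unitVec]
    simp only [Nat.add_eq_zero_iff, one_ne_zero, and_false, if_false, Nat.add_sub_cancel,
      ellMap_unitVec, evalSeries_unitVec, coord_unitVec]
    push_cast
    have e1 : ((n : ℝ) + 1 + 1) * x = (n + 1) * x + x := by ring
    have e2 : (n : ℝ) * x = (n + 1) * x - x := by ring
    rw [e1, e2, cos_add, cos_sub]
    ring

lemma evalSeries_eq (x : ℝ) :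
    evalSeries x = (coord 0).comp ((1 - (decay * cos x) • shift) * Ring.inverse (shiftPoly x)) := by
  have h := congrArg (fun S : Ell →L[ℝ] ℝ => S.comp (Ring.inverse (shiftPoly x)))
    (evalSeries_comp_shiftPoly x)
  have h2 : (shiftPoly x).comp (Ring.inverse (shiftPoly x)) = 1 :=
    Ring.mul_inverse_cancel _ (isUnit_shiftPoly x)
  simp only [ContinuousLinearMap.comp_assoc, h2] at h
  exact h

/-- In the resolvent formula x occurs only through cos x, and inversion is analytic on units; so
evaluation is analytic in x in the dual norm. Applied to an analytic curve in `Ell`, it yields joint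
analyticity in (ε, x). -/
lemma contDiff_evalSeries : ContDiff ℝ ω evalSeries := by
  have h : evalSeries = fun x => (coord 0).comp
      ((1 - (decay * cos x) • shift) * Ring.inverse (shiftPoly x)) := funext evalSeries_eq
  rw [h]
  have hs : ContDiff ℝ ω shiftPoly := by unfold shiftPoly; fun_prop
  have hi : ContDiff ℝ ω fun x => Ring.inverse (shiftPoly x) := contDiff_iff_contDiffAt.2 fun x => by
    obtain ⟨y, hy⟩ := isUnit_shiftPoly x
    exact ContDiffAt.comp x (by rw [← hy]; exact contDiffAt_ringInverse ℝ y) hs.contDiffAt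
  have hm : ContDiff ℝ ω fun x => (1 - (decay * cos x) • shift) * Ring.inverse (shiftPoly x) :=
    ContDiff.mul (by fun_prop) hi
  exact contDiff_const.clm_comp hm

lemma intervalIntegral_coe_torus (f : Torus → ℝ) :
    ∫ x in (0 : ℝ)..(2 * π), f (x : Torus) = 2 * π * ∫ x, f x ∂torusMeasure := by
  have h := AddCircle.intervalIntegral_preimage (2 * π) 0 f
  rw [zero_add] at h
  rw [h, AddCircle.integral_haarAddCircle, smul_eq_mul, ← mul_assoc,
    mul_inv_cancel₀ Real.two_pi_pos.ne', one_mul]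

/-- The smooth function of mean zero defined by a cosine series. -/
def seriesZero (b : Ell) : SmoothZero where
  toFun := fun x => evalSeries x b - coord 0 b
  smooth := ((contDiff_evalSeries.of_le le_top).clm_apply contDiff_const).sub contDiff_const
  periodic := fun x => by
    simp only [evalSeries_apply]
    rw [AddCircle.coe_add_period]
  mean_zero := by
    have h := intervalIntegral_coe_torus fun x => cosSeries b x - coord 0 b
    have h2 : ∫ x, (cosSeries b x - coord 0 b) ∂torusMeasure = 0 := by
      rw [integral_sub (integrable_of_continuous (cosSeries b).continuous) (integrable_const _)]
      have := coef_cosSeries_zero b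
      rw [coef_zero_eq] at this
      rw [Complex.ofReal_inj.1 this]
      simp
    rw [h2, mul_zero] at h
    exact h

lemma seriesZero_fn (b : Ell) (x : Torus) : (seriesZero b).fn x = cosSeries b x - coord 0 b := by
  induction x using QuotientAddGroup.induction_on with
  | H x => rfl

lemma coef_sub_const (f : C(Torus, ℝ)) (c : ℝ) {n : ℤ} (hn : n ≠ 0) :
    coef (fun x => f x - c) n = coef f n := by
  have h : (fun x => f x - c) = (f - c • cosT 0 : C(Torus, ℝ)) := by
    funext x; simp [cosT_apply]
  rw [h, ← coefC_apply, map_sub, map_smul, coefC_apply, coefC_apply, coef_cosT]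
  simp [hn]

lemma SmoothZero.coef_zero (w : SmoothZero) : coef w.fn 0 = 0 := by
  rw [coef_zero_eq]
  have := intervalIntegral_coe_torus w.fn
  have h2 : ∫ x in (0 : ℝ)..(2 * π), w.fn (x : Torus) = 0 := w.mean_zero
  rw [h2, zero_eq_mul] at this
  rw [this.resolve_left Real.two_pi_pos.ne']
  simp

lemma coef_seriesZero (b : Ell) {n : ℤ} (hn : n ≠ 0) :
    coef (seriesZero b).fn n = coef (cosSeries b) n := by
  rw [funext (seriesZero_fn b), coef_sub_const _ _ hn]

lemma seriesZero_diff_fn (b : Ell) : (seriesZero b).diff.fn = derivSeries b := by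
  refine eq_of_coef_eq (SmoothZero.continuous_fn _) (derivSeries b).continuous fun n => ?_
  rw [SmoothZero.coef_diff, coef_derivSeries]
  rcases eq_or_ne n 0 with rfl | hn
  · simp
  · rw [coef_seriesZero b hn]

/-! ### The branch of traveling waves -/

/-- The sequence of the function `cos x`. -/
def cosVec : Ell := decay⁻¹ • unitVec 1

/-- The inverse of the multiplier `1 - |n|⁻¹` on the modes `n ≥ 2`. -/
def modeInv : Ell →L[ℝ] Ell :=
  ellMap (fun n => (if n ≤ 1 then 0 else (n : ℝ) / (n - 1)) • unitVec n) 2 fun n => by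
    rw [norm_smul, norm_unitVec, mul_one]
    split_ifs with h
    · simp
    · have : (2 : ℝ) ≤ n := by exact_mod_cast (by omega : 2 ≤ n)
      rw [norm_eq_abs, abs_of_nonneg (div_nonneg (by linarith) (by linarith)),
        div_le_iff₀ (by linarith)]
      linarith

lemma coord_modeInv (n : ℕ) (b : Ell) :
    coord n (modeInv b) = (if n ≤ 1 then 0 else (n : ℝ) / (n - 1)) * coord n b := by
  have : (coord n).comp modeInv = (if n ≤ 1 then 0 else (n : ℝ) / (n - 1)) • coord n :=
    Ell.clm_ext fun m => by
      simp only [ContinuousLinearMap.comp_apply, modeInv, ellMap_unitVec, map_smul, coord_unitVec,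
        smul_apply, smul_eq_mul]
      by_cases h : m = n
      · subst h; simp
      · simp [h]
  exact congrArg (fun S => S b) this

lemma coord_invLam (n : ℕ) (b : Ell) : coord n (invLam b) = (n : ℝ)⁻¹ * coord n b := by
  have : (coord n).comp invLam = (n : ℝ)⁻¹ • coord n :=
    Ell.clm_ext fun m => by
      simp only [ContinuousLinearMap.comp_apply, invLam, ellMap_unitVec, map_smul, coord_unitVec,
        smul_apply, smul_eq_mul]
      by_cases h : m = n
      · subst h; simp
      · simp [h]
  exact congrArg (fun S => S b) this

/-- Half the square of the profile `cos x + w`. -/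
def halfSq (w : Ell) : Ell := (1 / 2 : ℝ) • ellMul (cosVec + w) (cosVec + w)

/-- The right hand side of the fixed point equation `w = ε G(w)` for the profile `cos x + w`. -/
def profileMap (w : Ell) : Ell :=
  modeInv ((decay * coord 1 (halfSq w)) • w - halfSq w)

lemma contDiff_halfSq : ContDiff ℝ ω halfSq := by
  unfold halfSq
  have h1 : ContDiff ℝ ω fun w : Ell => cosVec + w := contDiff_const.add contDiff_id
  have h2 : ContDiff ℝ ω fun w : Ell => ellMul (cosVec + w) := ellMul.contDiff.comp h1
  exact (h2.clm_apply h1).const_smul (1 / 2 : ℝ)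

lemma contDiff_profileMap : ContDiff ℝ ω profileMap := by
  unfold profileMap
  have h := contDiff_halfSq
  have h1 : ContDiff ℝ ω fun w => coord 1 (halfSq w) := (coord 1).contDiff.comp h
  exact modeInv.contDiff.comp (((contDiff_const.mul h1).smul contDiff_id).sub h)

/-- At ε = 0 the map w - εG(w) is the identity in w, so the implicit function theorem applies in the
analytic class. The linear part was already inverted by `modeInv`. -/
lemma exists_fixedPoint_curve :
    ∃ δ > 0, ∃ W : ℝ → Ell, W 0 = 0 ∧ ∀ ε ∈ Ioo (-δ) δ,
      ContDiffAt ℝ ω W ε ∧ W ε = ε • profileMap (W ε) := by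
  set F : ℝ × Ell → Ell := fun p => p.2 - p.1 • profileMap p.2 with hF
  have hsm : ContDiff ℝ ω F :=
    contDiff_snd.sub (contDiff_fst.smul (contDiff_profileMap.comp contDiff_snd))
  have hd : fderiv ℝ F ((0 : ℝ), (0 : Ell)) ∘L .inr ℝ ℝ Ell = .id ℝ Ell := by
    have h1 : HasFDerivAt F (fderiv ℝ F (0, 0)) ((0 : ℝ), (0 : Ell)) :=
      ((hsm.differentiable (by simp)) _).hasFDerivAt
    have h2 : HasFDerivAt (fun w : Ell => ((0 : ℝ), w)) (.inr ℝ ℝ Ell) 0 :=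
      (ContinuousLinearMap.inr ℝ ℝ Ell).hasFDerivAt
    have h3 := h1.comp (0 : Ell) h2
    have h4 : F ∘ (fun w : Ell => ((0 : ℝ), w)) = id := by funext w; simp [hF]
    rw [h4] at h3
    exact h3.unique (hasFDerivAt_id _)
  have cdf : ContDiffAt ℝ ω F (0, 0) := hsm.contDiffAt
  have hinv : (fderiv ℝ F ((0 : ℝ), (0 : Ell)) ∘L .inr ℝ ℝ Ell).IsInvertible := by
    rw [hd]; exact ⟨ContinuousLinearEquiv.refl ℝ Ell, rfl⟩
  have pn : (ω : WithTop ℕ∞) ≠ 0 := by simp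
  set W := cdf.implicitFunction pn hinv
  have e1 := cdf.eventually_apply_implicitFunction pn hinv
  have e2 : ∀ᶠ ε in 𝓝 (0 : ℝ), ContDiffAt ℝ ω W ε :=
    (cdf.contDiffAt_implicitFunction pn hinv).eventually (by simp)
  obtain ⟨δ, hδ, h⟩ := Metric.eventually_nhds_iff_ball.1 (e1.and e2)
  refine ⟨δ, hδ, W, cdf.implicitFunction_apply_self pn hinv, fun ε hε => ?_⟩
  have hb : ε ∈ Metric.ball (0 : ℝ) δ := by
    rw [Real.ball_eq_Ioo, zero_sub, zero_add]; exact hε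
  refine ⟨(h ε hb).2, ?_⟩
  have h1 := (h ε hb).1
  simp only [hF, zero_smul, sub_zero] at h1
  exact sub_eq_zero.1 h1

/-- `ε ↦ (b ε, ν ε)` describes the branch of traveling waves: the wave is the cosine series of
`ε • b ε` and its velocity is `ν ε`. -/
structure IsProfile (δ : ℝ) (b : ℝ → Ell) (ν : ℝ → ℝ) : Prop where
  pos : 0 < δ
  smooth : ∀ ε ∈ Ioo (-δ) δ, ContDiffAt ℝ ω b ε
  smooth_vel : ∀ ε ∈ Ioo (-δ) δ, ContDiffAt ℝ ω ν ε
  at_zero : b 0 = cosVec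
  vel_zero : ν 0 = -1
  coord_zero : ∀ ε ∈ Ioo (-δ) δ, coord 0 (b ε) = 0
  coord_one : ∀ ε ∈ Ioo (-δ) δ, coord 1 (b ε) = decay⁻¹
  eqn : ∀ ε ∈ Ioo (-δ) δ, ∃ κ : ℝ, (1 / 2 : ℝ) • ellMul (ε • b ε) (ε • b ε) - invLam (ε • b ε)
    - ν ε • (ε • b ε) = κ • unitVec 0

lemma exists_isProfile : ∃ δ b ν, IsProfile δ b ν := by
  obtain ⟨δ, hδ, W, hW0, hW⟩ := exists_fixedPoint_curve
  -- `modeInv` annihilates modes 0 and 1, so the correction to cos x has neither; this is the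
  -- normalization of mean and amplitude.
  have hc : ∀ ε ∈ Ioo (-δ) δ, ∀ n ≤ 1, coord n (W ε) = 0 := fun ε hε n hn => by
    rw [(hW ε hε).2, map_smul, profileMap, coord_modeInv, if_pos hn]; simp
  -- The velocity is forced by mode 1: there the linear part vanishes at speed -1, and the quadratic
  -- term has to be balanced by the change of speed.
  refine ⟨δ, fun ε => cosVec + W ε, fun ε => -1 + ε * (decay * coord 1 (halfSq (W ε))),
    hδ, ?_, ?_, ?_, ?_, ?_, ?_, ?_⟩
  · exact fun ε hε => contDiffAt_const.add (hW ε hε).1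
  · intro ε hε
    have h1 : ContDiffAt ℝ ω (fun ε => coord 1 (halfSq (W ε))) ε :=
      (coord 1).contDiff.contDiffAt.comp ε (contDiff_halfSq.contDiffAt.comp ε (hW ε hε).1)
    exact contDiffAt_const.add (contDiffAt_id.mul (contDiffAt_const.mul h1))
  · simp [hW0]
  · simp
  · intro ε hε
    rw [map_add, hc ε hε 0 (by norm_num), cosVec, map_smul, coord_unitVec]; simp
  · intro ε hε
    rw [map_add, hc ε hε 1 le_rfl, cosVec, map_smul, coord_unitVec]; simp
  · intro ε hε
    refine ⟨coord 0 ((1 / 2 : ℝ) • ellMul (ε • (cosVec + W ε)) (ε • (cosVec + W ε))),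
      Ell.ext_coord fun n => ?_⟩
    have hq : (1 / 2 : ℝ) • ellMul (ε • (cosVec + W ε)) (ε • (cosVec + W ε)) =
        ε ^ 2 • halfSq (W ε) := by
      rw [halfSq, map_smul, map_smul, smul_apply, smul_smul, smul_smul, smul_smul]
      congr 1; ring
    rw [hq]
    simp only [map_sub, map_smul, map_add, coord_invLam, coord_unitVec, smul_eq_mul, cosVec]
    have hd := decay_pos.ne'
    -- Mode 0 is absorbed into κ, mode 1 is the choice of the velocity, and the modes n ≥ 2 follow
    -- from the fixed point equation times ε.
    rcases n with _ | _ | n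
    · simp [hc ε hε 0 (by norm_num)]
    · simp [hc ε hε 1 le_rfl]
      field_simp
      ring
    · have h := congrArg (coord (n + 1 + 1)) (hW ε hε).2
      rw [map_smul, profileMap, coord_modeInv, if_neg (by omega), map_sub, map_smul] at h
      simp only [smul_eq_mul] at h
      push_cast at h ⊢
      have h1 : (n : ℝ) + 1 + 1 ≠ 0 := by positivity
      have h2 : (n : ℝ) + 1 + 1 - 1 ≠ 0 := by
        have : (n : ℝ) + 1 + 1 - 1 = n + 1 := by ring
        rw [this]; positivity
      simp only [mul_zero, zero_add]
      generalize coord (n + 1 + 1) (W ε) = w at *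
      generalize coord (n + 1 + 1) (halfSq (W ε)) = Q at *
      generalize coord 1 (halfSq (W ε)) = R at *
      field_simp at h ⊢
      linear_combination ε * h

lemma integral_mul_cosT_one {f : Torus → ℝ} (hf : Continuous f) :
    ((2 * ∫ x, f x * cosT 1 x ∂torusMeasure : ℝ) : ℂ) = coef f 1 + coef f (-1) := by
  have hi : ∀ n : ℤ, Integrable (fun x : Torus => fourier n x • (f x : ℂ)) torusMeasure := fun n =>
    Continuous.integrable_of_hasCompactSupport (by fun_prop) (HasCompactSupport.of_compactSpace _)
  rw [coef, coef, fourierCoeff, fourierCoeff, ← integral_add (hi _) (hi _), ← integral_const_mul,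
    ← integral_complex_ofReal]
  congr 1
  funext x
  rw [neg_neg, fourier_neg, cosT_apply, smul_eq_mul, smul_eq_mul, Complex.ofReal_mul,
    Complex.ofReal_mul, Complex.re_eq_add_conj]
  push_cast
  ring

lemma SmoothZero.amplitude_eq (w : SmoothZero) :
    (((1 / π) * ∫ x in (0 : ℝ)..(2 * π), w x * cos x : ℝ) : ℂ) = coef w.fn 1 + coef w.fn (-1) := by
  rw [← integral_mul_cosT_one w.continuous_fn]
  have h := intervalIntegral_coe_torus fun x => w.fn x * cosT 1 x
  have h2 : ∫ x in (0 : ℝ)..(2 * π), w.fn (x : Torus) * cosT 1 (x : Torus) =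
      ∫ x in (0 : ℝ)..(2 * π), w x * cos x := by
    congr 1
    funext x
    rw [cosT_coe, Int.cast_one, one_mul]; rfl
  rw [← h2, h]
  congr 1
  field_simp

lemma SmoothZero.coef_neg_of_even (w : SmoothZero) (h : ∀ x, w (-x) = w x) (n : ℤ) :
    coef w.fn (-n) = coef w.fn n := by
  rw [← coef_comp_neg]
  congr 1
  funext x
  induction x using QuotientAddGroup.induction_on with
  | H x => exact h x

lemma SmoothZero.ext {w z : SmoothZero} (h : ∀ x, w x = z x) : w = z := by
  cases w; cases z
  congr
  exact funext h

namespace IsProfile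

variable {δ : ℝ} {b : ℝ → Ell} {ν : ℝ → ℝ}

lemma coord_zero_wave (h : IsProfile δ b ν) {ε : ℝ} (hε : ε ∈ Ioo (-δ) δ) :
    coord 0 (ε • b ε) = 0 := by
  rw [map_smul, h.coord_zero ε hε, smul_zero]

lemma fn_eq (h : IsProfile δ b ν) {ε : ℝ} (hε : ε ∈ Ioo (-δ) δ) :
    (seriesZero (ε • b ε)).fn = cosSeries (ε • b ε) := by
  funext x
  rw [seriesZero_fn, h.coord_zero_wave hε, sub_zero]

lemma derivSeries_unitVec_zero : derivSeries (unitVec 0) = 0 := by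
  simp [derivSeries]

/-- The x-derivative of `eqn`: the constant κ disappears and -|D|⁻¹u becomes Hu. -/
lemma wave_eq (h : IsProfile δ b ν) {ε : ℝ} (hε : ε ∈ Ioo (-δ) δ) :
    ν ε • derivSeries (ε • b ε) - cosSeries (ε • b ε) * derivSeries (ε • b ε) =
      sinSeries (ε • b ε) := by
  obtain ⟨κ, hκ⟩ := h.eqn ε hε
  generalize ε • b ε = A at hκ ⊢
  have h2 := congrArg derivSeries hκ
  rw [map_sub, map_sub, map_smul _ κ, derivSeries_unitVec_zero, smul_zero, map_smul,
    derivSeries_ellMul, derivSeries_invLam, map_smul _ (ν ε)] at h2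
  have h3 : derivSeries A * cosSeries A = cosSeries A * derivSeries A := mul_comm _ _
  rw [h3, ← two_smul ℝ, smul_smul] at h2
  norm_num at h2
  rw [sub_eq_zero] at h2
  rw [← h2]
  abel

lemma isBifurcationCurve (h : IsProfile δ b ν) :
    IsBifurcationCurve δ (fun ε => seriesZero (ε • b ε)) ν where
  pos := h.pos
  analytic_u := by
    rintro ⟨ε, x⟩ ⟨hε, -⟩
    refine ContDiffAt.analyticAt ?_
    have h1 : ContDiffAt ℝ ω (fun p : ℝ × ℝ => p.1 • b p.1) (ε, x) :=
      contDiffAt_fst.smul ((h.smooth ε hε).comp (ε, x) contDiffAt_fst)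
    have h2 : ContDiffAt ℝ ω (fun p : ℝ × ℝ => evalSeries p.2) (ε, x) :=
      contDiff_evalSeries.contDiffAt.comp (ε, x) contDiffAt_snd
    exact (h2.clm_apply h1).sub ((coord 0).contDiff.contDiffAt.comp _ h1)
  analytic_v := fun ε hε => (h.smooth_vel ε hε).analyticAt
  u_zero := fun x => by
    change evalSeries x ((0 : ℝ) • b 0) - coord 0 ((0 : ℝ) • b 0) = 0
    simp
  v_zero := h.vel_zero
  wave := fun ε hε n => by
    rw [h.fn_eq hε, seriesZero_diff_fn, ← coef_sinSeries, ← h.wave_eq hε]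
    rfl
  even := fun ε hε x => by
    change evalSeries (-x) _ - _ = evalSeries x _ - _
    rw [evalSeries_apply, evalSeries_apply]
    congr 1
    exact cosSeries_neg _ (x : Torus)
  amplitude := fun ε hε => by
    have h1 : coef (cosSeries (ε • b ε)) 1 = ((ε / 2 : ℝ) : ℂ) := by
      have := coef_cosSeries_nat (ε • b ε) 1 one_ne_zero
      rw [map_smul (coord 1), h.coord_one ε hε, smul_eq_mul] at this
      rw [Nat.cast_one] at this
      rw [this]
      congr 1
      have := decay_pos.ne'
      field_simp
    have h2 : coef (cosSeries (ε • b ε)) (-1) = ((ε / 2 : ℝ) : ℂ) := by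
      rw [← coef_comp_neg, funext (cosSeries_neg _), h1]
    rw [← Complex.ofReal_inj, SmoothZero.amplitude_eq, h.fn_eq hε, h1, h2, ← Complex.ofReal_add,
      add_halves]

end IsProfile

/-! ### Uniqueness of the branch -/

/-- The equation of traveling waves, in terms of Fourier coefficients of `u` and `u²`. -/
lemma IsTravelingWave.coef_sq {u : SmoothZero} {v : ℝ} (h : IsTravelingWave u v) {n : ℤ}
    (hn : n ≠ 0) : (v + 1 / |(n : ℝ)| : ℝ) * coef u.fn n = (1 / 2) * coef (fun x => u.fn x ^ 2) n := by
  -- Subtracting its mean makes u²/2 a `SmoothZero`, so that `coef_diff` gives the coefficients of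
  -- uu'; coefficients with n ≠ 0 do not see m.
  obtain ⟨m, hm⟩ : ∃ m : ℝ, ∫ x in (0 : ℝ)..(2 * π), (u x ^ 2 / 2 - m) = 0 := by
    refine ⟨(2 * π)⁻¹ * ∫ x in (0 : ℝ)..(2 * π), u x ^ 2 / 2, ?_⟩
    have hc : Continuous fun x => u x ^ 2 / 2 := (u.smooth.continuous.pow 2).div_const 2
    rw [intervalIntegral.integral_sub (hc.intervalIntegrable _ _) (by simp)]
    rw [intervalIntegral.integral_const, smul_eq_mul, sub_zero, ← mul_assoc,
      mul_inv_cancel₀ Real.two_pi_pos.ne', one_mul, sub_self]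
  let w : SmoothZero :=
    { toFun := fun x => u x ^ 2 / 2 - m
      smooth := ((u.smooth.pow 2).div_const 2).sub contDiff_const
      periodic := fun x => by simp only [u.periodic x]
      mean_zero := hm }
  have hwd : w.diff.fn = fun x => u.fn x * u.diff.fn x := by
    funext x
    induction x using QuotientAddGroup.induction_on with
    | H x =>
      change deriv (fun x => u x ^ 2 / 2 - m) x = u x * deriv u x
      have hu : HasDerivAt u (deriv u x) x :=
        ((u.smooth.differentiable (by simp)) x).hasDerivAt
      have := (((hu.pow 2).div_const 2).sub_const m).deriv
      refine this.trans ?_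
      push_cast
      ring
  let sq : C(Torus, ℝ) := ⟨fun x => u.fn x ^ 2, u.continuous_fn.pow 2⟩
  have hw : coef w.fn n = (1 / 2) * coef (fun x => u.fn x ^ 2) n := by
    have h1 : w.fn = fun x => ((1 / 2 : ℝ) • sq) x - m := by
      funext x
      induction x using QuotientAddGroup.induction_on with
      | H x =>
        change u x ^ 2 / 2 - m = (1 / 2) * u x ^ 2 - m
        ring
    rw [h1, coef_sub_const _ _ hn, coef_smul_fn]
    push_cast
    rfl
  have h1 := h n
  let a : C(Torus, ℝ) := ⟨u.diff.fn, u.diff.continuous_fn⟩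
  let c : C(Torus, ℝ) := ⟨w.diff.fn, w.diff.continuous_fn⟩
  have h2 : (fun x => v * u.diff.fn x - u.fn x * u.diff.fn x) = (v • a - c : C(Torus, ℝ)) := by
    funext x
    change _ = v * u.diff.fn x - w.diff.fn x
    rw [hwd]
  rw [h2, ← coefC_apply, map_sub, map_smul, coefC_apply, coefC_apply] at h1
  change (v : ℝ) • coef u.diff.fn n - coef w.diff.fn n = _ at h1
  rw [SmoothZero.coef_diff, SmoothZero.coef_diff, hw, Complex.real_smul] at h1
  have hs : (n.sign : ℂ) = n * ((1 / |(n : ℝ)| : ℝ) : ℂ) := by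
    have : (n.sign : ℝ) = n * (1 / |(n : ℝ)|) := by
      have hn' : |(n : ℝ)| ≠ 0 := by simpa using hn
      field_simp
      have := Int.sign_mul_abs n
      exact_mod_cast this
    exact_mod_cast this
  rw [hs] at h1
  have hI : Complex.I * n ≠ 0 := mul_ne_zero Complex.I_ne_zero (by exact_mod_cast hn)
  apply mul_left_cancel₀ hI
  push_cast at h1 ⊢
  linear_combination h1

/-- The embedding of continuous functions into `L²`. -/
abbrev contToLp : C(Torus, ℝ) →L[ℝ] Lp ℝ 2 torusMeasure := ContinuousMap.toLp 2 torusMeasure ℝ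

lemma norm_contToLp_mul_le {f g : C(Torus, ℝ)} {K : ℝ} (hf : ∀ x, |f x| ≤ K) :
    ‖contToLp (f * g)‖ ≤ K * ‖contToLp g‖ := by
  refine Lp.norm_le_mul_norm_of_ae_le_mul ?_
  filter_upwards [ContinuousMap.coeFn_toLp (p := 2) (𝕜 := ℝ) torusMeasure (f * g),
    ContinuousMap.coeFn_toLp (p := 2) (𝕜 := ℝ) torusMeasure g] with x h1 h2
  rw [h1, h2, ContinuousMap.mul_apply, norm_mul]
  exact mul_le_mul_of_nonneg_right (hf x) (norm_nonneg _)

lemma norm_contToLp_le {f : C(Torus, ℝ)} {K : ℝ} (hf : ∀ x, |f x| ≤ K) : ‖contToLp f‖ ≤ K := by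
  have h := norm_contToLp_mul_le (g := cosT 0) hf
  have h1 : ‖contToLp (cosT 0)‖ ^ 2 = 1 := by
    rw [← real_inner_self_eq_norm_sq, L2.inner_def]
    have : ∫ x, inner ℝ (contToLp (cosT 0) x) (contToLp (cosT 0) x) ∂torusMeasure =
        ∫ _, (1 : ℝ) ∂torusMeasure := by
      refine integral_congr_ae ?_
      filter_upwards [ContinuousMap.coeFn_toLp (p := 2) (𝕜 := ℝ) torusMeasure (cosT 0)] with x h1
      rw [h1]; simp [cosT_apply]
    rw [this]; simp
  have h2 : ‖contToLp (cosT 0)‖ = 1 := by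
    have := norm_nonneg (contToLp (cosT 0))
    nlinarith
  have h3 : f * cosT 0 = f := by ext x; simp [cosT_apply]
  rwa [h2, h3, mul_one] at h

lemma norm_le_of_norm_coef_le {f g : Lp ℝ 2 torusMeasure} {C : ℝ} (hC : 0 ≤ C)
    (h : ∀ n, ‖coef f n‖ ≤ C * ‖coef g n‖) : ‖f‖ ≤ C * ‖g‖ := by
  have h1 := hasSum_norm_coef_sq f
  have h2 := (hasSum_norm_coef_sq g).mul_left (C ^ 2)
  have h3 := hasSum_le (fun n => by
    rw [← mul_pow]; exact pow_le_pow_left₀ (norm_nonneg _) (h n) 2) h1 h2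
  rw [← mul_pow] at h3
  exact le_of_sq_le_sq h3 (by positivity)

lemma contToLp_injective {f : C(Torus, ℝ)} (h : contToLp f = 0) : f = 0 :=
  ContinuousMap.toLp_injective (p := 2) (𝕜 := ℝ) torusMeasure (by rw [h, map_zero])

/-- Two small traveling waves with the same nonzero amplitude coincide. -/
lemma travelingWave_unique {u w : SmoothZero} {v z ε K : ℝ} (hε : ε ≠ 0)
    (hK : 0 ≤ K) (hu : IsTravelingWave u v) (hw : IsTravelingWave w z)
    (hu1 : ∀ n : ℤ, |n| = 1 → coef u.fn n = (ε / 2 : ℝ))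
    (hw1 : ∀ n : ℤ, |n| = 1 → coef w.fn n = (ε / 2 : ℝ))
    (hub : ∀ x, |u.fn x| ≤ K * |ε|) (hwb : ∀ x, |w.fn x| ≤ K * |ε|) (hv : |v + 1| ≤ 1 / 4)
    (hsmall : 4 * (K + 2 * K ^ 2) * |ε| < 1) : u.fn = w.fn ∧ v = z := by
  let U : C(Torus, ℝ) := ⟨u.fn, u.continuous_fn⟩
  let W : C(Torus, ℝ) := ⟨w.fn, w.continuous_fn⟩
  set d := U - W with hd
  set Q : C(Torus, ℝ) := ((1 / 2 : ℝ) • (U + W)) * d with hQ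
  set R : C(Torus, ℝ) := Q - (v - z) • W with hR
  have hε' : 0 < |ε| := abs_pos.2 hε
  have cU : ∀ n, coefC n U = coef u.fn n := fun n => coefC_apply n U
  have cW : ∀ n, coefC n W = coef w.fn n := fun n => coefC_apply n W
  have hQ' : Q = (1 / 2 : ℝ) • (⟨fun x => u.fn x ^ 2, u.continuous_fn.pow 2⟩ : C(Torus, ℝ)) -
      (1 / 2 : ℝ) • (⟨fun x => w.fn x ^ 2, w.continuous_fn.pow 2⟩ : C(Torus, ℝ)) := by
    ext x
    change (1 / 2) * (u.fn x + w.fn x) * (u.fn x - w.fn x) =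
      (1 / 2) * u.fn x ^ 2 - (1 / 2) * w.fn x ^ 2
    ring
  have eqn : ∀ n : ℤ, n ≠ 0 → ((v + 1 / |(n : ℝ)| : ℝ) : ℂ) * coefC n d = coefC n R := by
    intro n hn
    have h1 := hu.coef_sq hn
    have h2 := hw.coef_sq hn
    have h3 : coefC n Q = (1 / 2 : ℝ) • coef (fun x => u.fn x ^ 2) n -
        (1 / 2 : ℝ) • coef (fun x => w.fn x ^ 2) n := by
      rw [hQ', map_sub, map_smul, map_smul, coefC_apply, coefC_apply]; rfl
    have h4 : coefC n R = coefC n Q - (v - z) • coefC n W := by rw [hR, map_sub, map_smul]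
    have h5 : coefC n d = coefC n U - coefC n W := map_sub _ _ _
    rw [h4, h5, h3, cU, cW]
    simp only [Complex.real_smul]
    push_cast at h1 h2 ⊢
    linear_combination h1 - h2
  have hd1 : ∀ n : ℤ, |n| = 1 → coefC n d = 0 := fun n hn => by
    rw [hd, map_sub, cU, cW, hu1 n hn, hw1 n hn, sub_self]
  have hQn : ‖contToLp Q‖ ≤ K * |ε| * ‖contToLp d‖ := by
    refine norm_contToLp_mul_le fun x => ?_
    change |(1 / 2) * (u.fn x + w.fn x)| ≤ _
    rw [abs_mul, abs_of_nonneg (by norm_num : (0 : ℝ) ≤ 1 / 2)]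
    linarith [abs_add_le (u.fn x) (w.fn x), hub x, hwb x]
  -- The difference has no mode 1, so there the equation reads (v - z)ε/2 = coefficient of Q. The
  -- division by ε is paid for by the factor |ε| in `hQn`.
  have hvz : |v - z| ≤ 2 * K * ‖contToLp d‖ := by
    have h1 := eqn 1 one_ne_zero
    rw [hd1 1 (by simp), mul_zero, hR, map_sub, map_smul, cW, hw1 1 (by simp), eq_comm,
      sub_eq_zero] at h1
    have h2 : ‖coefC 1 Q‖ ≤ K * |ε| * ‖contToLp d‖ :=
      (norm_coef_le (contToLp Q) 1).trans hQn
    rw [h1, Complex.real_smul, ← Complex.ofReal_mul, Complex.norm_real, norm_eq_abs, abs_mul,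
      abs_div, abs_two] at h2
    have h3 : |ε| * (|v - z| / 2) ≤ |ε| * (K * ‖contToLp d‖) := by linarith
    have := le_of_mul_le_mul_left h3 hε'
    linarith
  have hWn : ‖contToLp W‖ ≤ K * |ε| := norm_contToLp_le hwb
  have hRn : ‖contToLp R‖ ≤ (K + 2 * K ^ 2) * |ε| * ‖contToLp d‖ := by
    rw [hR, map_sub, map_smul]
    refine (norm_sub_le _ _).trans ?_
    rw [norm_smul, norm_eq_abs]
    have := mul_le_mul hvz hWn (norm_nonneg _) (by positivity)
    linarith
  -- For |n| ≥ 2 the multiplier satisfies v + 1/|n| ≤ -3/4 + 1/2 = -1/4, hence the factor 4; the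
  -- modes with |n| ≤ 1 of the difference vanish.
  have hdR : ‖contToLp d‖ ≤ 4 * ‖contToLp R‖ := by
    refine norm_le_of_norm_coef_le (by norm_num) fun n => ?_
    change ‖coefC n d‖ ≤ 4 * ‖coefC n R‖
    rcases eq_or_ne n 0 with rfl | hn
    · rw [hd, map_sub, cU, cW, SmoothZero.coef_zero, SmoothZero.coef_zero]
      simp
    by_cases h1 : |n| = 1
    · rw [hd1 n h1]; simp
    have h2 : (2 : ℝ) ≤ |(n : ℝ)| := by
      have : 2 ≤ |n| := by
        have := abs_pos.2 hn
        omega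
      exact_mod_cast this
    have h3 : 1 / |(n : ℝ)| ≤ 1 / 2 := one_div_le_one_div_of_le (by norm_num) h2
    have h4 : 1 / 4 ≤ |v + 1 / (|(n : ℝ)|)| := by
      rw [le_abs]; right
      linarith [(abs_le.1 hv).2]
    rw [← eqn n hn, norm_mul, Complex.norm_real, norm_eq_abs]
    nlinarith [norm_nonneg (coefC n d)]
  have hzero : ‖contToLp d‖ = 0 := by
    by_contra h
    have hpos : 0 < ‖contToLp d‖ := lt_of_le_of_ne (norm_nonneg _) (Ne.symm h)
    have : ‖contToLp d‖ ≤ 4 * (K + 2 * K ^ 2) * |ε| * ‖contToLp d‖ := by linarith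
    nlinarith
  constructor
  · have h0 : d = 0 := contToLp_injective (norm_eq_zero.1 hzero)
    funext x
    have := congrArg (fun f : C(Torus, ℝ) => f x) h0
    exact sub_eq_zero.1 this
  · rw [hzero, mul_zero] at hvz
    exact sub_eq_zero.1 (abs_nonpos_iff.1 hvz)

namespace IsBifurcationCurve

variable {δ : ℝ} {u : ℝ → SmoothZero} {v : ℝ → ℝ}

/-- The waves vanish at ε = 0 and are Lipschitz in (ε, x) on the compact set of one period and |ε| ≤
δ/2, so their sup norm is O(|ε|). -/
lemma exists_bound (h : IsBifurcationCurve δ u v) :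
    ∃ K : ℝ, 0 ≤ K ∧ ∀ ε, |ε| ≤ δ / 2 → ∀ x : Torus, |(u ε).fn x| ≤ K * |ε| := by
  have hδ := h.pos
  set s : Set (ℝ × ℝ) := Icc (-(δ / 2)) (δ / 2) ×ˢ Icc 0 (2 * π) with hs
  have hl : LocallyLipschitzOn s (fun p : ℝ × ℝ => u p.1 p.2) := by
    intro p hp
    have ha := h.analytic_u p ⟨⟨by linarith [hp.1.1], by linarith [hp.1.2]⟩, mem_univ _⟩
    obtain ⟨K, t, ht, hK⟩ := (ha.contDiffAt (n := 1)).exists_lipschitzOnWith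
    exact ⟨K, t, mem_nhdsWithin_of_mem_nhds ht, hK⟩
  obtain ⟨K, hK⟩ := hl.exists_lipschitzOnWith_of_compact (isCompact_Icc.prod isCompact_Icc)
  refine ⟨K, K.2, fun ε hε x => ?_⟩
  obtain ⟨y, hy, rfl⟩ : ∃ y ∈ Icc 0 (2 * π), (y : Torus) = x := by
    obtain ⟨y, hy, hyx⟩ := AddCircle.coe_image_Icc_eq (2 * π) 0 ▸ mem_univ x
    rw [zero_add] at hy
    exact ⟨y, hy, hyx⟩
  have h1 := hK.dist_le_mul (ε, y) ⟨abs_le.1 hε, hy⟩ (0, y) ⟨⟨by linarith, by linarith⟩, hy⟩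
  simp only [h.u_zero, Prod.dist_eq, dist_self, Real.dist_eq, sub_zero] at h1
  rw [max_eq_left (abs_nonneg _)] at h1
  exact h1

lemma coef_one (h : IsBifurcationCurve δ u v) {ε : ℝ} (hε : ε ∈ Ioo (-δ) δ) (n : ℤ)
    (hn : |n| = 1) : coef (u ε).fn n = (ε / 2 : ℝ) := by
  have h1 := (u ε).amplitude_eq
  rw [h.amplitude ε hε, SmoothZero.coef_neg_of_even _ (h.even ε hε)] at h1
  have h2 : coef (u ε).fn 1 = (ε / 2 : ℝ) := by
    push_cast
    linear_combination (-1 / 2 : ℂ) * h1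
  rcases (abs_eq zero_le_one).1 hn with rfl | rfl
  · exact h2
  · rw [SmoothZero.coef_neg_of_even _ (h.even ε hε), h2]

/-- The branch of traveling waves is unique. -/
lemma eventually_eq {δ' : ℝ} {u' : ℝ → SmoothZero} {v' : ℝ → ℝ} (h : IsBifurcationCurve δ u v)
    (h' : IsBifurcationCurve δ' u' v') :
    ∀ᶠ ε in 𝓝 (0 : ℝ), u ε = u' ε ∧ v ε = v' ε := by
  obtain ⟨K, hK0, hK⟩ := h.exists_bound
  obtain ⟨K', -, hK'⟩ := h'.exists_bound
  set M := max K K'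
  have hM : 0 ≤ M := hK0.trans (le_max_left _ _)
  have t1 : Tendsto (fun ε : ℝ => |ε|) (𝓝 0) (𝓝 0) := by
    simpa using (continuous_abs.tendsto (0 : ℝ))
  have e1 : ∀ᶠ ε : ℝ in 𝓝 0, |ε| < δ / 2 := t1.eventually_lt_const (by linarith [h.pos])
  have e2 : ∀ᶠ ε : ℝ in 𝓝 0, |ε| < δ' / 2 := t1.eventually_lt_const (by linarith [h'.pos])
  have e3 : ∀ᶠ ε : ℝ in 𝓝 0, 4 * (M + 2 * M ^ 2) * |ε| < 1 := by
    have := t1.const_mul (4 * (M + 2 * M ^ 2))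
    rw [mul_zero] at this
    exact this.eventually_lt_const one_pos
  have e4 : ∀ᶠ ε : ℝ in 𝓝 0, |v ε + 1| ≤ 1 / 4 := by
    have hc : ContinuousAt (fun ε => |v ε + 1|) 0 :=
      (((h.analytic_v 0 ⟨by linarith [h.pos], h.pos⟩).continuousAt).add continuousAt_const).abs
    have : (fun ε => |v ε + 1|) 0 < 1 / 4 := by simp [h.v_zero]
    exact (hc.eventually_lt_const this).mono fun _ => le_of_lt
  filter_upwards [e1, e2, e3, e4] with ε h1 h2 h3 h4
  have hm : ε ∈ Ioo (-δ) δ := abs_lt.1 (by linarith [h.pos])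
  have hm' : ε ∈ Ioo (-δ') δ' := abs_lt.1 (by linarith [h'.pos])
  rcases eq_or_ne ε 0 with rfl | hε
  · exact ⟨SmoothZero.ext fun x => by rw [h.u_zero, h'.u_zero], by rw [h.v_zero, h'.v_zero]⟩
  obtain ⟨hfn, hv⟩ := travelingWave_unique hε hM (h.wave ε hm) (h'.wave ε hm') (h.coef_one hm)
    (h'.coef_one hm')
    (fun x => (hK ε h1.le x).trans (mul_le_mul_of_nonneg_right (le_max_left _ _) (abs_nonneg _)))
    (fun x => (hK' ε h2.le x).trans (mul_le_mul_of_nonneg_right (le_max_right _ _) (abs_nonneg _)))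
    h4 h3
  exact ⟨SmoothZero.ext fun x => congrFun hfn (x : Torus), hv⟩

end IsBifurcationCurve

/-! ### Completeness of the Sobolev spaces -/

lemma mem_L2Zero_iff (f : Lp ℝ 2 torusMeasure) : f ∈ L2Zero ↔ coefLp 0 f = 0 := by
  change ∫ x, f x ∂torusMeasure = 0 ↔ coef f 0 = 0
  rw [coef_zero_eq, Complex.ofReal_eq_zero]

lemma isClosed_L2Zero : IsClosed (L2Zero : Set (Lp ℝ 2 torusMeasure)) := by
  have : (L2Zero : Set (Lp ℝ 2 torusMeasure)) = {f | coefLp 0 f = 0} :=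
    Set.ext fun f => mem_L2Zero_iff f
  rw [this]
  exact isClosed_eq (coefLp 0).continuous continuous_const

instance : CompleteSpace L2Zero := isClosed_L2Zero.completeSpace_coe

/-- Weak differentiability is a family of closed conditions on Fourier coefficients. The resulting
completeness is needed for series and integrals with values in H^k. -/
lemma isClosed_Sob (k : ℕ) : IsClosed (Sob k : Set (PiLp 2 fun _ : Fin (k + 1) => L2Zero)) := by
  have : (Sob k : Set (PiLp 2 fun _ : Fin (k + 1) => L2Zero)) =
      ⋂ (j : Fin k) (n : ℤ), {F | coefL n (F j.succ) = Complex.I * n * coefL n (F j.castSucc)} := by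
    ext F
    simp only [mem_iInter]
    rfl
  rw [this]
  refine isClosed_iInter fun j => isClosed_iInter fun n => isClosed_eq ?_ ?_
  · exact (coefL n).continuous.comp (PiLp.continuous_apply 2 _ _)
  · exact continuous_const.mul ((coefL n).continuous.comp (PiLp.continuous_apply 2 _ _))

lemma sob_norm_sq {k : ℕ} (F : Sob k) : ‖F‖ ^ 2 = ∑ i, ‖F.1 i‖ ^ 2 :=
  PiLp.norm_sq_eq_of_L2 _ F.1

/-! ### The spaces `L²` and `H^k` as abstract Banach spaces

The following synonyms carry their normed space structure as a single instance. -/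

/-- `L²` functions of mean zero. -/
def LZ : Type := L2Zero

instance : NormedAddCommGroup LZ := inferInstanceAs (NormedAddCommGroup L2Zero)

instance : InnerProductSpace ℝ LZ := inferInstanceAs (InnerProductSpace ℝ L2Zero)

instance : CompleteSpace LZ := isClosed_L2Zero.completeSpace_coe

/-- The Sobolev space `H^k` of functions of mean zero. -/
def HSob (k : ℕ) : Type := Sob k

instance (k : ℕ) : NormedAddCommGroup (HSob k) := inferInstanceAs (NormedAddCommGroup (Sob k))

instance (k : ℕ) : NormedSpace ℝ (HSob k) := inferInstanceAs (NormedSpace ℝ (Sob k))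

instance (k : ℕ) : CompleteSpace (HSob k) := (isClosed_Sob k).completeSpace_coe

/-- The `n`-th Fourier coefficient. -/
def LZ.coef (n : ℤ) : LZ →L[ℝ] ℂ := coefL n

lemma LZ.coef_apply (n : ℤ) (f : LZ) : LZ.coef n f = BurgersHilbert.coef (l2fn f) n := rfl

lemma LZ.ext_coef {f g : LZ} (h : ∀ n, LZ.coef n f = LZ.coef n g) : f = g := L2Zero.ext_coef h

lemma LZ.coef_zero (f : LZ) : LZ.coef 0 f = 0 := L2Zero.coef_at_zero f

lemma LZ.hasSum_inner (f g : LZ) :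
    HasSum (fun n : ℤ => LZ.coef n f * conj (LZ.coef n g)) ((inner ℝ f g : ℝ) : ℂ) :=
  hasSum_coef_mul_conj f.1 g.1

namespace HSob

variable {k : ℕ}

/-- The `i`-th derivative of an element of `H^k`, `i ≤ k`. -/
def compFun (i : Fin (k + 1)) (F : HSob k) : LZ := F.1 i

lemma norm_sq (F : HSob k) : ‖F‖ ^ 2 = ∑ i, ‖compFun i F‖ ^ 2 := sob_norm_sq F

lemma norm_compFun_le (i : Fin (k + 1)) (F : HSob k) : ‖compFun i F‖ ≤ ‖F‖ := by
  refine le_of_sq_le_sq ?_ (norm_nonneg _)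
  rw [norm_sq]
  exact Finset.single_le_sum (f := fun i => ‖compFun i F‖ ^ 2) (fun j _ => sq_nonneg _)
    (Finset.mem_univ i)

/-- The `i`-th derivative as a continuous linear map from `H^k` to `L²`, `i ≤ k`. -/
def comp (i : Fin (k + 1)) : HSob k →L[ℝ] LZ :=
  LinearMap.mkContinuous
    { toFun := compFun i
      map_add' := fun _ _ => rfl
      map_smul' := fun _ _ => rfl } 1 fun F => by rw [one_mul]; exact norm_compFun_le i F

lemma norm_comp_le (i : Fin (k + 1)) (F : HSob k) : ‖comp i F‖ ≤ ‖F‖ := norm_compFun_le i F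

lemma norm_sq_eq (F : HSob k) : ‖F‖ ^ 2 = ∑ i, ‖comp i F‖ ^ 2 := norm_sq F

lemma ext_comp {F G : HSob k} (h : ∀ i, comp i F = comp i G) : F = G :=
  Subtype.ext (PiLp.ext h)

lemma coef_succ (F : HSob k) (i : Fin k) (n : ℤ) :
    LZ.coef n (comp i.succ F) = Complex.I * n * LZ.coef n (comp i.castSucc F) := F.2 i n

lemma coef_comp (F : HSob k) (i : Fin (k + 1)) (n : ℤ) :
    LZ.coef n (comp i F) = (Complex.I * n) ^ (i : ℕ) * LZ.coef n (comp 0 F) := by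
  obtain ⟨i, hi⟩ := i
  induction i with
  | zero => simp
  | succ i ih =>
    have h1 := coef_succ F ⟨i, by omega⟩ n
    have h2 := ih (by omega)
    simp only [Fin.castSucc_mk, Fin.succ_mk] at h1
    rw [h1, h2, pow_succ]
    simp only
    ring

lemma ext_coef {F G : HSob k} (h : ∀ n, LZ.coef n (comp 0 F) = LZ.coef n (comp 0 G)) : F = G :=
  ext_comp fun i => LZ.ext_coef fun n => by rw [coef_comp, coef_comp G, h]

lemma norm_le_sum (F : HSob k) : ‖F‖ ≤ ∑ i, ‖comp i F‖ := by
  refine le_of_sq_le_sq ?_ (Finset.sum_nonneg fun i _ => norm_nonneg _)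
  rw [norm_sq_eq]
  exact Finset.sum_sq_le_sq_sum_of_nonneg fun i _ => norm_nonneg _

/-- An element of `H^k` from its derivatives. -/
def mk (w : Fin (k + 1) → LZ)
    (hw : ∀ (i : Fin k) (n : ℤ), LZ.coef n (w i.succ) = Complex.I * n * LZ.coef n (w i.castSucc)) :
    HSob k := (⟨WithLp.toLp 2 w, hw⟩ : Sob k)

@[simp] lemma comp_mk (w : Fin (k + 1) → LZ)
    (hw : ∀ (i : Fin k) (n : ℤ), LZ.coef n (w i.succ) = Complex.I * n * LZ.coef n (w i.castSucc))
    (i : Fin (k + 1)) : comp i (mk w hw) = w i := rfl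

/-- A continuous linear map into `H^k` from its components. -/
def lift {E : Type*} [NormedAddCommGroup E] [NormedSpace ℝ E] (A : Fin (k + 1) → E →L[ℝ] LZ)
    (hA : ∀ x (i : Fin k) (n : ℤ),
      LZ.coef n (A i.succ x) = Complex.I * n * LZ.coef n (A i.castSucc x)) : E →L[ℝ] HSob k :=
  LinearMap.mkContinuous
    { toFun := fun x => mk (fun i => A i x) (hA x)
      map_add' := fun x y => ext_comp fun i => by simp
      map_smul' := fun c x => ext_comp fun i => by simp } (∑ i, ‖A i‖)
    fun x => by
      refine (norm_le_sum _).trans ?_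
      rw [Finset.sum_mul]
      exact Finset.sum_le_sum fun i _ => (A i).le_opNorm x

lemma continuous_of_comp {Z : Type*} [TopologicalSpace Z] {f : Z → HSob k}
    (h : ∀ i, Continuous fun z => comp i (f z)) : Continuous f := by
  refine continuous_iff_continuousAt.2 fun z => ?_
  rw [ContinuousAt, tendsto_iff_norm_sub_tendsto_zero]
  have h1 : Tendsto (fun y => ∑ i, ‖comp i (f y - f z)‖) (𝓝 z) (𝓝 (∑ i : Fin (k + 1), (0 : ℝ))) := by
    refine tendsto_finsetSum _ fun i _ => ?_
    simp only [map_sub]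
    exact tendsto_iff_norm_sub_tendsto_zero.1 (h i).continuousAt
  rw [Finset.sum_const_zero] at h1
  exact squeeze_zero (fun _ => norm_nonneg _) (fun y => norm_le_sum _) h1

/-- The inclusion `H^k ⊆ H^j`, `j ≤ k`. -/
def incl {j : ℕ} (h : j ≤ k) : HSob k →L[ℝ] HSob j :=
  lift (fun i => comp (i.castLE (Nat.succ_le_succ h))) fun F i n => coef_succ F (i.castLE h) n

/-- The derivative `H^{k+1} → H^k`. -/
def der : HSob (k + 1) →L[ℝ] HSob k :=
  lift (fun i => comp i.succ) fun F i n => coef_succ F i.succ n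

lemma comp_zero_incl {j : ℕ} (h : j ≤ k) (F : HSob k) : comp 0 (incl h F) = comp 0 F := rfl

lemma coef_der (F : HSob (k + 1)) (n : ℤ) :
    LZ.coef n (comp 0 (der F)) = Complex.I * n * LZ.coef n (comp 0 F) := coef_succ F 0 n

end HSob

/-! ### Translations -/

/-- The translation `f ↦ f(· - a)` on `L²`. -/
def transLp (a : Torus) : Lp ℝ 2 torusMeasure →ₗᵢ[ℝ] Lp ℝ 2 torusMeasure :=
  Lp.compMeasurePreservingₗᵢ ℝ (fun x => x - a) (measurePreserving_sub_right torusMeasure a)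

lemma transLp_ae (a : Torus) (f : Lp ℝ 2 torusMeasure) :
    transLp a f =ᵐ[torusMeasure] fun x => f (x - a) :=
  Lp.coeFn_compMeasurePreserving f (measurePreserving_sub_right torusMeasure a)

lemma coef_transLp (a : Torus) (f : Lp ℝ 2 torusMeasure) (n : ℤ) :
    coef (transLp a f) n = fourier (-n) a * coef f n := by
  rw [coef_congr_ae (transLp_ae a f), coef_comp_sub]

lemma continuous_transLp (f : Lp ℝ 2 torusMeasure) : Continuous fun a : Torus => transLp a f := by
  let g : C(Torus, C(Torus, Torus)) :=
    (ContinuousMap.mk (fun p : Torus × Torus => p.2 - p.1)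
      (continuous_snd.sub continuous_fst)).curry
  exact continuous_const.compMeasurePreservingLp (g := g) g.continuous
    (fun a => measurePreserving_sub_right torusMeasure a) (by norm_num)

lemma transLp_mem (a : Torus) {f : Lp ℝ 2 torusMeasure} (hf : f ∈ L2Zero) :
    transLp a f ∈ L2Zero := by
  rw [mem_L2Zero_iff] at hf ⊢
  change coef f 0 = 0 at hf
  change coef (transLp a f) 0 = 0
  rw [coef_transLp, hf, mul_zero]

/-- The translation `f ↦ f(· - a)` on `L²` functions of mean zero. -/
def LZ.trans (a : ℝ) : LZ →ₗᵢ[ℝ] LZ where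
  toFun f := (⟨transLp a f.1, transLp_mem a f.2⟩ : L2Zero)
  map_add' f g := Subtype.ext ((transLp a).map_add f.1 g.1)
  map_smul' c f := Subtype.ext ((transLp a).map_smul c f.1)
  norm_map' f := (transLp a).norm_map f.1

lemma LZ.coef_trans (a : ℝ) (f : LZ) (n : ℤ) :
    LZ.coef n (LZ.trans a f) = fourier (-n) (a : Torus) * LZ.coef n f :=
  coef_transLp a f.1 n

lemma LZ.trans_ae (a : ℝ) (f : LZ) :
    l2fn (LZ.trans a f) =ᵐ[torusMeasure] fun x => l2fn f (x - a) := transLp_ae a f.1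

lemma LZ.continuous_trans (f : LZ) : Continuous fun a : ℝ => LZ.trans a f := by
  have h : Continuous fun a : ℝ => transLp (a : Torus) f.1 :=
    (continuous_transLp f.1).comp (AddCircle.continuous_mk' (2 * π))
  exact continuous_induced_rng.2 h

namespace HSob

variable {k : ℕ}

/-- The translation `f ↦ f(· - a)` as a continuous linear map on `H^k`. -/
def transL (a : ℝ) : HSob k →L[ℝ] HSob k :=
  lift (fun i => (LZ.trans a).toContinuousLinearMap.comp (comp i)) fun F i n => by
    change LZ.coef n (LZ.trans a (comp i.succ F)) =
      Complex.I * n * LZ.coef n (LZ.trans a (comp i.castSucc F))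
    rw [LZ.coef_trans, LZ.coef_trans, coef_succ]; ring

lemma comp_transL (a : ℝ) (F : HSob k) (i : Fin (k + 1)) :
    comp i (transL a F) = LZ.trans a (comp i F) := rfl

lemma norm_transL (a : ℝ) (F : HSob k) : ‖transL a F‖ = ‖F‖ := by
  have h : ‖transL a F‖ ^ 2 = ‖F‖ ^ 2 := by
    rw [norm_sq_eq, norm_sq_eq]
    refine Finset.sum_congr rfl fun i _ => ?_
    rw [comp_transL, LinearIsometry.norm_map]
  exact (sq_eq_sq₀ (norm_nonneg _) (norm_nonneg _)).1 h

lemma coef_transL (a : ℝ) (F : HSob k) (n : ℤ) :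
    LZ.coef n (comp 0 (transL a F)) = fourier (-n) (a : Torus) * LZ.coef n (comp 0 F) := by
  rw [comp_transL, LZ.coef_trans]

lemma transL_zero (F : HSob k) : transL 0 F = F :=
  ext_coef fun n => by rw [coef_transL]; simp

lemma continuous_transL_left (F : HSob k) : Continuous fun a : ℝ => transL a F :=
  continuous_of_comp fun i => LZ.continuous_trans (comp i F)

/-- Strong continuity becomes joint continuity because translations are isometries. -/
lemma continuous_transL : Continuous fun p : ℝ × HSob k => transL p.1 p.2 := by
  refine continuous_iff_continuousAt.2 fun ⟨a, F⟩ => ?_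
  rw [ContinuousAt, tendsto_iff_norm_sub_tendsto_zero]
  have h1 : Tendsto (fun p : ℝ × HSob k => ‖p.2 - F‖ + ‖transL p.1 F - transL a F‖) (𝓝 (a, F))
      (𝓝 (‖F - F‖ + ‖transL a F - transL a F‖)) := by
    have hc : Continuous fun p : ℝ × HSob k => ‖p.2 - F‖ + ‖transL p.1 F - transL a F‖ :=
      (continuous_snd.sub continuous_const).norm.add
        (((continuous_transL_left F).comp continuous_fst).sub continuous_const).norm
    exact hc.tendsto (a, F)
  rw [sub_self, sub_self, norm_zero, add_zero] at h1
  refine squeeze_zero (fun _ => norm_nonneg _) (fun p => ?_) h1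
  have h2 : transL p.1 p.2 - transL a F = transL p.1 (p.2 - F) + (transL p.1 F - transL a F) := by
    rw [map_sub]; abel
  rw [h2]
  refine (norm_add_le _ _).trans ?_
  rw [norm_transL]

end HSob

/-! ### Differentiability of translations with loss of derivatives -/

lemma hasDerivAt_fourier_neg_torus (n : ℤ) (t : ℝ) :
    HasDerivAt (fun t : ℝ => (fourier (-n) (t : Torus) : ℂ))
      (-(Complex.I * n) * fourier (-n) (t : Torus)) t := by
  have h := hasDerivAt_fourier_neg (2 * π) n t
  refine h.congr_deriv ?_
  have hpi : (π : ℂ) ≠ 0 := by exact_mod_cast Real.pi_ne_zero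
  push_cast
  field_simp

namespace HSob

/-- Tested against a Fourier mode, both sides have the same derivative in t and the same value at 0.
The integral form makes the derivative hold in the H^k norm by the fundamental theorem of calculus.
-/
lemma transL_eq_sub_integral {k : ℕ} (F : HSob (k + 1)) (t : ℝ) :
    transL t (incl k.le_succ F) = incl k.le_succ F - ∫ s in (0 : ℝ)..t, transL s (der F) := by
  refine ext_coef fun n => ?_
  let ℓ : HSob k →L[ℝ] ℂ := (LZ.coef n).comp (comp 0)
  change ℓ (transL t (incl k.le_succ F)) =
    ℓ (incl k.le_succ F - ∫ s in (0 : ℝ)..t, transL s (der F))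
  have hY : ∀ t, HasDerivAt (fun t => ℓ (incl k.le_succ F -
      ∫ s in (0 : ℝ)..t, transL s (der F))) (ℓ (-(transL t (der F)))) t := fun t => by
    have h1 := (continuous_transL_left (der F)).integral_hasStrictDerivAt 0 t
    exact ℓ.hasFDerivAt.comp_hasDerivAt t (h1.hasDerivAt.const_sub (incl k.le_succ F))
  have hZ : ∀ t, HasDerivAt (fun t => ℓ (transL t (incl k.le_succ F)))
      (ℓ (-(transL t (der F)))) t := fun t => by
    have h1 : (fun t : ℝ => ℓ (transL t (incl k.le_succ F))) =
        fun t : ℝ => fourier (-n) (t : Torus) * LZ.coef n (comp 0 F) :=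
      funext fun t => coef_transL t _ n
    rw [h1]
    refine ((hasDerivAt_fourier_neg_torus n t).mul_const _).congr_deriv ?_
    rw [map_neg]
    change _ = -LZ.coef n (comp 0 (transL t (der F)))
    rw [coef_transL, coef_der]
    ring
  have hd : ∀ t, HasDerivAt (fun t => ℓ (transL t (incl k.le_succ F)) -
      ℓ (incl k.le_succ F - ∫ s in (0 : ℝ)..t, transL s (der F))) 0 t := fun t => by
    have := (hZ t).sub (hY t)
    rwa [sub_self] at this
  have hc := is_const_of_deriv_eq_zero (fun t => (hd t).differentiableAt) (fun t => (hd t).deriv) t 0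
  simp only [intervalIntegral.integral_same, sub_zero, transL_zero, sub_self] at hc
  exact sub_eq_zero.1 hc

lemma hasDerivAt_transL {k : ℕ} (F : HSob (k + 1)) (t : ℝ) :
    HasDerivAt (fun t => transL t (incl k.le_succ F)) (-(transL t (der F))) t := by
  rw [funext (transL_eq_sub_integral F)]
  exact ((continuous_transL_left (der F)).integral_hasStrictDerivAt 0 t).hasDerivAt.const_sub
    (incl k.le_succ F)

/-- The translation `f ↦ f(· - a)` as a map from `H^k` to `H^m`, `m ≤ k`. -/
def transIncl {m k : ℕ} (h : m ≤ k) (a : ℝ) : HSob k →L[ℝ] HSob m :=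
  (incl h).comp (transL a)

lemma transIncl_apply {m k : ℕ} (h : m ≤ k) (a : ℝ) (F : HSob k) :
    transIncl h a F = incl h (transL a F) := rfl

lemma norm_transIncl_apply_le {m k : ℕ} (h : m ≤ k) (a : ℝ) (F : HSob k) :
    ‖transIncl h a F‖ ≤ ‖incl h‖ * ‖F‖ := by
  have := (incl h).le_opNorm (transL a F)
  rwa [norm_transL] at this

lemma hasDerivAt_transIncl_apply {m k : ℕ} (h : m ≤ k) (F : HSob (k + 1)) (t : ℝ) :
    HasDerivAt (fun t => transIncl (h.trans k.le_succ) t F) (-(transIncl h t (der F))) t := by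
  have := (incl h).hasFDerivAt.comp_hasDerivAt t (hasDerivAt_transL F t)
  rw [map_neg] at this
  exact this

lemma norm_transIncl_sub_le {m k : ℕ} (h : m ≤ k) (F : HSob (k + 1)) (s t : ℝ) :
    ‖transIncl (h.trans k.le_succ) t F - transIncl (h.trans k.le_succ) s F‖ ≤
      ‖incl h‖ * ‖der F‖ * |t - s| := by
  refine Convex.norm_image_sub_le_of_norm_hasDerivWithin_le (s := univ)
    (f := fun t => transIncl (h.trans k.le_succ) t F)
    (fun x _ => (hasDerivAt_transIncl_apply h F x).hasDerivWithinAt) (fun x _ => ?_)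
    convex_univ (mem_univ s) (mem_univ t)
  rw [norm_neg]
  exact norm_transIncl_apply_le h x _

/-- Giving up one derivative upgrades strong continuity of translations to a Lipschitz bound in
operator norm. -/
lemma exists_norm_transIncl_sub_le {m k : ℕ} (h : m ≤ k) :
    ∃ C : ℝ, 0 ≤ C ∧ ∀ (s t : ℝ), ‖(transIncl (h.trans k.le_succ) t : HSob (k + 1) →L[ℝ] HSob m) -
      transIncl (h.trans k.le_succ) s‖ ≤ C * |t - s| := by
  refine ⟨‖incl h‖ * ‖(der : HSob (k + 1) →L[ℝ] HSob k)‖, by positivity, fun s t => ?_⟩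
  refine ContinuousLinearMap.opNorm_le_bound _ (by positivity) fun F => ?_
  refine (norm_transIncl_sub_le h F s t).trans ?_
  have := (der : HSob (k + 1) →L[ℝ] HSob k).le_opNorm F
  calc ‖incl h‖ * ‖der F‖ * |t - s|
      ≤ ‖incl h‖ * (‖(der : HSob (k + 1) →L[ℝ] HSob k)‖ * ‖F‖) * |t - s| := by gcongr
    _ = _ := by ring

lemma continuous_transIncl {m k : ℕ} (h : m ≤ k) :
    Continuous fun t => (transIncl (h.trans k.le_succ) t : HSob (k + 1) →L[ℝ] HSob m) := by
  obtain ⟨C, hC, hb⟩ := exists_norm_transIncl_sub_le h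
  refine (LipschitzWith.of_dist_le_mul (K := ⟨C, hC⟩) fun t s => ?_).continuous
  rw [dist_eq_norm, dist_eq_norm]
  exact hb s t

lemma hasDerivAt_transIncl {m k : ℕ} (h : m ≤ k) (t : ℝ) :
    HasDerivAt (fun t => (transIncl (h.trans (k.le_succ.trans (k + 1).le_succ)) t :
      HSob (k + 2) →L[ℝ] HSob m))
      (-((transIncl (h.trans k.le_succ) t : HSob (k + 1) →L[ℝ] HSob m).comp der)) t := by
  have h1 : m ≤ k + 1 := h.trans k.le_succ
  obtain ⟨C, hC, hb⟩ := exists_norm_transIncl_sub_le h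
  set D := ‖(der : HSob (k + 2) →L[ℝ] HSob (k + 1))‖
  -- Mean value inequality for x ↦ T_x F + x T_t F', whose derivative is T_t F' - T_x F' and hence
  -- Lipschitz-small. The remainder is quadratic in s - t, at the price of two derivatives.
  have key : ∀ s, ‖(transIncl (h1.trans (k + 1).le_succ) s : HSob (k + 2) →L[ℝ] HSob m) -
      transIncl (h1.trans (k + 1).le_succ) t -
      (s - t) • (-((transIncl h1 t : HSob (k + 1) →L[ℝ] HSob m).comp der))‖ ≤
      C * D * |s - t| * |s - t| := fun s => by
    refine ContinuousLinearMap.opNorm_le_bound _ (by positivity) fun F => ?_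
    have hder : ∀ x ∈ uIcc t s, HasDerivWithinAt
        (fun x => transIncl (h1.trans (k + 1).le_succ) x F + x • transIncl h1 t (der F))
        (-(transIncl h1 x (der F)) + (1 : ℝ) • transIncl h1 t (der F)) (uIcc t s) x :=
      fun x _ => ((hasDerivAt_transIncl_apply h1 F x).add
        ((hasDerivAt_id x).smul_const (transIncl h1 t (der F)))).hasDerivWithinAt
    have hbd : ∀ x ∈ uIcc t s, ‖-(transIncl h1 x (der F)) +
        (1 : ℝ) • transIncl h1 t (der F)‖ ≤ C * D * |s - t| * ‖F‖ := fun x hx => by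
      rw [one_smul, neg_add_eq_sub, ← sub_apply]
      have e1 := ((transIncl h1 t : HSob (k + 1) →L[ℝ] HSob m) - transIncl h1 x).le_of_opNorm_le
        (hb x t) (der F)
      have e2 := (der : HSob (k + 2) →L[ℝ] HSob (k + 1)).le_opNorm F
      have e3 : |t - x| ≤ |s - t| := by
        rw [abs_sub_comm]; exact abs_sub_left_of_mem_uIcc hx
      calc _ ≤ C * |t - x| * ‖der F‖ := e1
        _ ≤ C * |s - t| * (D * ‖F‖) := by gcongr
        _ = _ := by ring
    have := (convex_uIcc t s).norm_image_sub_le_of_norm_hasDerivWithin_le hder hbd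
      left_mem_uIcc right_mem_uIcc
    rw [norm_eq_abs] at this
    calc _ = ‖transIncl (h1.trans (k + 1).le_succ) s F + s • transIncl h1 t (der F) -
        (transIncl (h1.trans (k + 1).le_succ) t F + t • transIncl h1 t (der F))‖ := by
          congr 1
          simp only [sub_apply, smul_apply, neg_apply, ContinuousLinearMap.comp_apply, smul_neg,
            sub_smul]
          abel
      _ ≤ _ := this
      _ = _ := by ring
  refine hasDerivAt_iff_isLittleO.2 ?_
  refine Asymptotics.IsLittleO.of_norm_left ?_
  have hO : (fun s => ‖(transIncl (h1.trans (k + 1).le_succ) s : HSob (k + 2) →L[ℝ] HSob m) -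
      transIncl (h1.trans (k + 1).le_succ) t -
      (s - t) • (-((transIncl h1 t : HSob (k + 1) →L[ℝ] HSob m).comp der))‖) =O[𝓝 t]
      fun s => (s - t) * (s - t) := by
    refine Asymptotics.IsBigO.of_bound (C * D) (Eventually.of_forall fun s => ?_)
    rw [norm_norm, norm_mul, norm_eq_abs, ← mul_assoc]
    exact key s
  refine hO.trans_isLittleO ?_
  have : (fun s : ℝ => (s - t) * (s - t)) =o[𝓝 t] fun s => (1 : ℝ) * (s - t) := by
    refine Asymptotics.IsLittleO.mul_isBigO ?_ (Asymptotics.isBigO_refl _ _)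
    rw [Asymptotics.isLittleO_one_iff]
    have : Tendsto (fun s : ℝ => s - t) (𝓝 t) (𝓝 (t - t)) := tendsto_id.sub_const t
    rwa [sub_self] at this
  simpa using this

/-- Here the map is operator-valued: besides one derivative for each order of smoothness, one more
is spent on continuity in operator norm. This explains the `+ 1`, absent for the map (a, f) ↦ f(· -
a) itself. -/
lemma contDiff_transIncl (j : ℕ) : ∀ {m k : ℕ} (h : m ≤ k), m + j + 1 ≤ k →
    ContDiff ℝ j fun t => (transIncl h t : HSob k →L[ℝ] HSob m) := by
  induction j with
  | zero =>
    intro m k h hj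
    obtain ⟨k, rfl⟩ : ∃ k', k = k' + 1 := ⟨k - 1, by omega⟩
    exact contDiff_zero.2 (continuous_transIncl (by omega))
  | succ j ih =>
    intro m k h hj
    obtain ⟨k, rfl⟩ : ∃ k', k = k' + 2 := ⟨k - 2, by omega⟩
    have hd := fun t => hasDerivAt_transIncl (m := m) (k := k) (by omega) t
    rw [Nat.cast_add, Nat.cast_one, contDiff_succ_iff_deriv]
    refine ⟨fun t => (hd t).differentiableAt, by simp, ?_⟩
    rw [funext fun t => (hd t).deriv]
    exact ((ih (by omega) (by omega)).clm_comp contDiff_const).neg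

/-- The map `(a, f) ↦ f(· - a)` is of class `C^j` from `ℝ × H^k` to `H^m` if `m + j ≤ k`. -/
lemma contDiff_transIncl_uncurry (j : ℕ) : ∀ {m k : ℕ} (h : m ≤ k), m + j ≤ k →
    ContDiff ℝ j fun p : ℝ × HSob k => transIncl h p.1 p.2 := by
  induction j with
  | zero =>
    intro m k h hj
    exact contDiff_zero.2 ((incl h).continuous.comp continuous_transL)
  | succ j ih =>
    intro m k h hj
    obtain ⟨k, rfl⟩ : ∃ k', k = k' + 1 := ⟨k - 1, by omega⟩
    have hm : m ≤ k := by omega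
    rw [Nat.cast_add, Nat.cast_one, contDiff_succ_iff_hasFDerivAt]
    -- The partial derivative in a is a map of the same kind one Sobolev order lower, covered by
    -- `ih`. The partial derivative in f is the operator T_a, covered by `contDiff_transIncl`, whose
    -- extra derivative is available at this order.
    refine ⟨fun p => (ContinuousLinearMap.fst ℝ ℝ (HSob (k + 1))).smulRight
      (-(transIncl hm p.1 (der p.2))) +
      (transIncl h p.1).comp (ContinuousLinearMap.snd ℝ ℝ (HSob (k + 1))), ?_, ?_⟩
    · have h1 : ContDiff ℝ j fun p : ℝ × HSob (k + 1) => -(transIncl hm p.1 (der p.2)) :=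
        ((ih hm (by omega)).comp
          (contDiff_fst.prodMk (der.contDiff.comp contDiff_snd))).neg
      have h2 : ContDiff ℝ j fun p : ℝ × HSob (k + 1) =>
          (transIncl h p.1 : HSob (k + 1) →L[ℝ] HSob m) :=
        (contDiff_transIncl j h (by omega)).comp contDiff_fst
      exact (contDiff_const.smulRight h1).add (h2.clm_comp contDiff_const)
    · rintro ⟨a, F⟩
      obtain ⟨C, hC, hb⟩ := exists_norm_transIncl_sub_le hm
      have d1 : HasFDerivAt (fun p : ℝ × HSob (k + 1) => transIncl h p.1 F)
          ((ContinuousLinearMap.fst ℝ ℝ (HSob (k + 1))).smulRight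
            (-(transIncl hm a (der F)))) (a, F) :=
        HasFDerivAt.congr_fderiv (HasFDerivAt.comp (f := Prod.fst) (a, F)
          (hasDerivAt_transIncl_apply hm F a).hasFDerivAt hasFDerivAt_fst) (by ext <;> simp)
      have d2 : HasFDerivAt (fun p : ℝ × HSob (k + 1) => transIncl h a p.2)
          ((transIncl h a).comp (ContinuousLinearMap.snd ℝ ℝ (HSob (k + 1)))) (a, F) :=
        (transIncl h a).hasFDerivAt.comp (a, F) hasFDerivAt_snd
      -- The mixed term is O(|p.1 - a| ‖p.2 - F‖) by the operator Lipschitz bound, so it does not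
      -- contribute to the derivative.
      have d3 : HasFDerivAt (fun p : ℝ × HSob (k + 1) =>
          transIncl h p.1 (p.2 - F) - transIncl h a (p.2 - F))
          (0 : ℝ × HSob (k + 1) →L[ℝ] HSob m) (a, F) := by
        refine HasFDerivAt.of_isLittleO ?_
        simp only [sub_self, map_zero, sub_zero, zero_apply]
        have hO : (fun p : ℝ × HSob (k + 1) =>
            transIncl h p.1 (p.2 - F) - transIncl h a (p.2 - F)) =O[𝓝 (a, F)]
            fun p => |p.1 - a| * ‖p - (a, F)‖ := by
          refine Asymptotics.IsBigO.of_bound C (Eventually.of_forall fun p => ?_)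
          rw [← sub_apply, norm_mul, norm_norm, norm_eq_abs, abs_abs, ← mul_assoc]
          refine (((transIncl h p.1 : HSob (k + 1) →L[ℝ] HSob m) - transIncl h a).le_of_opNorm_le
            (hb a p.1) (p.2 - F)).trans ?_
          exact mul_le_mul_of_nonneg_left (norm_snd_le (p - (a, F))) (by positivity)
        refine hO.trans_isLittleO ?_
        have : (fun p : ℝ × HSob (k + 1) => |p.1 - a| * ‖p - (a, F)‖) =o[𝓝 (a, F)]
            fun p => (1 : ℝ) * ‖p - (a, F)‖ := by
          refine Asymptotics.IsLittleO.mul_isBigO ?_ (Asymptotics.isBigO_refl _ _)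
          rw [Asymptotics.isLittleO_one_iff]
          have hc : Continuous fun p : ℝ × HSob (k + 1) => |p.1 - a| :=
            (continuous_fst.sub continuous_const).abs
          simpa using hc.tendsto (a, F)
        simpa using this.norm_right
      have hs := ((d1.add d2).add d3).sub_const (transIncl h a F)
      rw [add_zero] at hs
      refine hs.congr_of_eventuallyEq (Eventually.of_forall fun p => ?_)
      simp only [Pi.add_apply, map_sub]
      abel

end HSob

/-! ### Series as elements of `L²` and `H^k` -/

lemma coefC_zero_re (f : C(Torus, ℝ)) : (((coefC 0 f).re : ℝ) : ℂ) = coefC 0 f := by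
  rw [coefC_apply, coef_zero_eq, Complex.ofReal_re]

/-- The map `f ↦ f - ∫ f` from continuous functions to `L²`. -/
def subMean : C(Torus, ℝ) →L[ℝ] Lp ℝ 2 torusMeasure :=
  contToLp - (Complex.reCLM.comp (coefC 0)).smulRight (contToLp (cosT 0))

lemma coefLp_contToLp (n : ℤ) (f : C(Torus, ℝ)) : coefLp n (contToLp f) = coef f n :=
  coefC_apply n f

lemma coefLp_subMean (n : ℤ) (f : C(Torus, ℝ)) :
    coefLp n (subMean f) = if n = 0 then 0 else coef f n := by
  have h : subMean f = contToLp f - (coefC 0 f).re • contToLp (cosT 0) := rfl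
  rw [h, map_sub, map_smul, coefLp_contToLp, coefLp_contToLp, coef_cosT, Complex.real_smul,
    coefC_zero_re, coefC_apply]
  by_cases hn : n = 0
  · simp [hn]
  · simp [hn]

/-- The map `f ↦ f - ∫ f` from continuous functions to `L²` functions of mean zero. -/
def zeroMean : C(Torus, ℝ) →L[ℝ] LZ :=
  LinearMap.mkContinuous
    { toFun := fun f => (⟨subMean f, by rw [mem_L2Zero_iff, coefLp_subMean]; simp⟩ : L2Zero)
      map_add' := fun f g => Subtype.ext (map_add subMean f g)
      map_smul' := fun c f => Subtype.ext (map_smul subMean c f) } ‖subMean‖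
    fun f => subMean.le_opNorm f

lemma coef_zeroMean (n : ℤ) (f : C(Torus, ℝ)) :
    LZ.coef n (zeroMean f) = if n = 0 then 0 else coef f n := coefLp_subMean n f

lemma coef_zeroMean_of_mean {f : C(Torus, ℝ)} (hf : coef f 0 = 0) (n : ℤ) :
    LZ.coef n (zeroMean f) = coef f n := by
  rw [coef_zeroMean]
  split_ifs with h
  · rw [h, hf]
  · rfl

lemma zeroMean_ae {f : C(Torus, ℝ)} (hf : coef f 0 = 0) :
    l2fn (zeroMean f) =ᵐ[torusMeasure] f := by
  refine ae_eq_of_coef_eq (Lp.memLp _) (memLp_of_continuous f.continuous) fun n => ?_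
  exact coef_zeroMean_of_mean hf n

/-- The cosine series in `L²`, without its constant term. -/
def serL2 : Ell →L[ℝ] LZ := zeroMean.comp cosSeries

/-- The derivative of the cosine series in `L²`. -/
def derL2 : Ell →L[ℝ] LZ := zeroMean.comp derivSeries

/-- The antiderivative of the cosine series in `L²`. -/
def antiL2 : Ell →L[ℝ] LZ := zeroMean.comp antiderivSeries

lemma coef_serL2 (b : Ell) {n : ℤ} (hn : n ≠ 0) : LZ.coef n (serL2 b) = coef (cosSeries b) n := by
  rw [serL2, ContinuousLinearMap.comp_apply, coef_zeroMean, if_neg hn]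

lemma coef_derL2 (b : Ell) (n : ℤ) : LZ.coef n (derL2 b) = Complex.I * n * LZ.coef n (serL2 b) := by
  rw [derL2, ContinuousLinearMap.comp_apply, coef_zeroMean]
  split_ifs with h
  · simp [h]
  · rw [coef_serL2 b h, coef_derivSeries]

lemma coef_antiL2 (b : Ell) (n : ℤ) : Complex.I * n * LZ.coef n (antiL2 b) = LZ.coef n (serL2 b) := by
  rw [antiL2, ContinuousLinearMap.comp_apply, coef_zeroMean]
  split_ifs with h
  · rw [h, LZ.coef_zero]; simp
  · rw [coef_serL2 b h, coef_antiderivSeries b n h]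

/-- A smooth function as an element of `L²`. -/
def SmoothZero.toLZ (w : SmoothZero) : LZ := w.toL2

/-- A smooth function as an element of `H^k`. -/
def SmoothZero.toHSob (k : ℕ) (w : SmoothZero) : HSob k := w.toSob k

lemma SmoothZero.comp_toHSob (k : ℕ) (w : SmoothZero) : HSob.comp 0 (w.toHSob k) = w.toLZ := rfl

lemma SmoothZero.coef_toLZ (w : SmoothZero) (n : ℤ) : LZ.coef n w.toLZ = coef w.fn n :=
  coef_congr_ae w.memLp.coeFn_toLp n

lemma toLZ_seriesZero (b : Ell) : (seriesZero b).toLZ = serL2 b :=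
  LZ.ext_coef fun n => by
    rw [SmoothZero.coef_toLZ]
    rcases eq_or_ne n 0 with rfl | hn
    · rw [SmoothZero.coef_zero, LZ.coef_zero]
    · rw [coef_seriesZero b hn, coef_serL2 b hn]

/-! Parity -/

/-- Under n ↦ -n the Parseval sum turns into its negative. -/
lemma LZ.inner_eq_zero_of_odd {f g : LZ}
    (h : ∀ n, LZ.coef (-n) f * conj (LZ.coef (-n) g) = -(LZ.coef n f * conj (LZ.coef n g))) :
    inner ℝ f g = 0 := by
  have h1 := LZ.hasSum_inner f g
  have h2 := (Equiv.neg ℤ).hasSum_iff.2 h1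
  have h3 : HasSum (fun n : ℤ => -(LZ.coef n f * conj (LZ.coef n g)))
      ((inner ℝ f g : ℝ) : ℂ) := by
    refine h2.congr_fun fun n => ?_
    exact (h n).symm
  have h4 := h3.unique h1.neg
  rw [← Complex.ofReal_neg, Complex.ofReal_inj] at h4
  linarith

lemma coef_serL2_neg (b : Ell) (n : ℤ) : LZ.coef (-n) (serL2 b) = LZ.coef n (serL2 b) := by
  rcases eq_or_ne n 0 with rfl | hn
  · simp
  · rw [coef_serL2 b hn, coef_serL2 b (neg_ne_zero.2 hn), ← coef_comp_neg, funext (cosSeries_neg b)]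

lemma coef_antiL2_neg (b : Ell) (n : ℤ) : LZ.coef (-n) (antiL2 b) = -LZ.coef n (antiL2 b) := by
  rcases eq_or_ne n 0 with rfl | hn
  · rw [neg_zero, LZ.coef_zero, neg_zero]
  · have h1 := coef_antiL2 b (-n)
    rw [coef_serL2_neg, ← coef_antiL2] at h1
    have hI : Complex.I * n ≠ 0 := mul_ne_zero Complex.I_ne_zero (by exact_mod_cast hn)
    apply mul_left_cancel₀ hI
    push_cast at h1
    linear_combination -h1

/-- Even against odd. Together with `inner_derL2_serL2` this makes P⁺ and P⁻ annihilate each other's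
ranges, and removes the wave from the second modulation equation. -/
lemma inner_serL2_antiL2 (b c : Ell) : inner ℝ (serL2 b) (antiL2 c) = 0 :=
  LZ.inner_eq_zero_of_odd fun n => by
    rw [coef_serL2_neg, coef_antiL2_neg, map_neg, mul_neg]

lemma inner_derL2_serL2 (b c : Ell) : inner ℝ (derL2 b) (serL2 c) = 0 :=
  LZ.inner_eq_zero_of_odd fun n => by
    rw [coef_derL2, coef_derL2, coef_serL2_neg, coef_serL2_neg]; push_cast; ring

/-- Integration by parts; because of it one number, `pairing`, normalizes both projections. -/
lemma inner_derL2_antiL2 (b c : Ell) :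
    inner ℝ (derL2 b) (antiL2 c) = -inner ℝ (serL2 b) (serL2 c) := by
  have h1 := LZ.hasSum_inner (derL2 b) (antiL2 c)
  have h2 := (LZ.hasSum_inner (serL2 b) (serL2 c)).neg
  have h3 := h1.unique (h2.congr_fun fun n => ?_)
  · exact_mod_cast h3
  · rw [coef_derL2, ← coef_antiL2 c]
    simp only [map_mul, Complex.conj_I]
    have : conj (n : ℂ) = n := map_intCast _ n
    rw [this]
    ring

/-- The mean of cos² x. Its not being zero makes both `pairing` (for small ε ≠ 0) and the Jacobian
of `modEq` nondegenerate. -/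
lemma inner_serL2_cosVec : inner ℝ (serL2 cosVec) (serL2 cosVec) = 1 / 2 := by
  have hc : ∀ n : ℤ, LZ.coef n (serL2 cosVec) =
      ((if n = 1 then 1 else 0) + (if n = -1 then 1 else 0)) / 2 := fun n => by
    rcases eq_or_ne n 0 with rfl | hn
    · rw [LZ.coef_zero]; simp
    · rw [coef_serL2 _ hn]
      have : cosSeries cosVec = cosT 1 := by
        simp [cosVec, cosSeries, smul_smul, inv_mul_cancel₀ decay_pos.ne']
      rw [this, coef_cosT]
  have h1 := LZ.hasSum_inner (serL2 cosVec) (serL2 cosVec)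
  have h2 := hasSum_sum_of_ne_finset_zero (L := .unconditional ℤ) (s := ({1, -1} : Finset ℤ))
    (f := fun n : ℤ => LZ.coef n (serL2 cosVec) * conj (LZ.coef n (serL2 cosVec))) (fun n hn => by
      simp only [Finset.mem_insert, Finset.mem_singleton, not_or] at hn
      rw [hc, if_neg hn.1, if_neg hn.2]; simp)
  have h3 := h1.unique h2
  rw [Finset.sum_pair (by norm_num), hc, hc] at h3
  have hconj : conj (2 : ℂ) = 2 := map_ofNat _ 2
  have h4 : (((inner ℝ (serL2 cosVec) (serL2 cosVec) : ℝ)) : ℂ) = ((1 / 2 : ℝ) : ℂ) := by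
    rw [h3]; norm_num [hconj]
  exact_mod_cast h4

/-! Series in `H^k` -/

lemma LZ.norm_le_of_norm_coef_le {f g : LZ} {C : ℝ} (hC : 0 ≤ C)
    (h : ∀ n, ‖LZ.coef n f‖ ≤ C * ‖LZ.coef n g‖) : ‖f‖ ≤ C * ‖g‖ :=
  BurgersHilbert.norm_le_of_norm_coef_le (f := f.1) (g := g.1) hC h

lemma norm_serL2_unitVec_le (n : ℕ) : ‖serL2 (unitVec n)‖ ≤ decay ^ n := by
  have h1 : ‖contToLp (cosSeries (unitVec n))‖ ≤ decay ^ n := by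
    refine norm_contToLp_le fun x => ?_
    have : cosSeries (unitVec n) x = decay ^ n * cosT n x := by simp [cosSeries]
    rw [this, abs_mul, abs_of_nonneg (pow_nonneg decay_pos.le n)]
    refine mul_le_of_le_one_right (pow_nonneg decay_pos.le n) ?_
    exact ((cosT n).norm_coe_le_norm x).trans (norm_cosT_le n)
  refine le_trans ?_ h1
  have := BurgersHilbert.norm_le_of_norm_coef_le (f := (serL2 (unitVec n) : L2Zero).1)
    (g := contToLp (cosSeries (unitVec n))) (C := 1) zero_le_one fun m => ?_
  · rw [one_mul] at this; exact this
  · change ‖LZ.coef m (serL2 (unitVec n))‖ ≤ 1 * ‖coefLp m (contToLp (cosSeries (unitVec n)))‖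
    rw [coefLp_contToLp, one_mul]
    rcases eq_or_ne m 0 with rfl | hm
    · rw [LZ.coef_zero, norm_zero]; exact norm_nonneg _
    · rw [coef_serL2 _ hm]

/-- A unit vector is a single mode, so its i-th derivative has norm at most n^i q^n, which is
bounded in n. -/
lemma exists_norm_toHSob_le (k : ℕ) :
    ∃ C : ℝ, ∀ n, ‖((seriesZero (unitVec n)).toHSob k)‖ ≤ C := by
  have hb : ∀ i : ℕ, ∃ C : ℝ, ∀ n : ℕ, (n : ℝ) ^ i * decay ^ n ≤ C := fun i => by
    have h := tendsto_pow_const_mul_const_pow_of_abs_lt_one i (r := decay)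
      (by norm_num [decay])
    obtain ⟨C, hC⟩ := h.bddAbove_range
    exact ⟨C, fun n => hC ⟨n, rfl⟩⟩
  choose C hC using hb
  refine ⟨∑ i : Fin (k + 1), C i, fun n => (HSob.norm_le_sum _).trans
    (Finset.sum_le_sum fun i _ => ?_)⟩
  refine le_trans ?_ (hC i n)
  have h0 : ∀ m, LZ.coef m (HSob.comp 0 ((seriesZero (unitVec n)).toHSob k)) =
      LZ.coef m (serL2 (unitVec n)) := fun m => by
    rw [← toLZ_seriesZero, SmoothZero.comp_toHSob]
  refine le_trans (LZ.norm_le_of_norm_coef_le (g := serL2 (unitVec n)) (C := (n : ℝ) ^ (i : ℕ))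
    (by positivity) fun m => ?_) (mul_le_mul_of_nonneg_left (norm_serL2_unitVec_le n) (by positivity))
  rw [HSob.coef_comp, h0]
  by_cases hm : LZ.coef m (serL2 (unitVec n)) = 0
  · rw [hm]; simp
  have hmn : |m| = n := by
    by_contra hne
    apply hm
    rcases eq_or_ne m 0 with rfl | hm0
    · rw [LZ.coef_zero]
    · rw [coef_serL2 _ hm0]
      simp only [cosSeries, ellMap_unitVec, coef_smul_fn, coef_cosT]
      have h1 : ¬ m = n := fun h => hne (by rw [h]; simp)
      have h2 : ¬ m = -n := fun h => hne (by rw [h]; simp)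
      simp [h1, h2]
  have : ‖(Complex.I * m) ^ (i : ℕ)‖ = (n : ℝ) ^ (i : ℕ) := by
    rw [norm_pow, norm_mul, Complex.norm_I, one_mul, Complex.norm_intCast, ← Int.cast_abs, hmn]
    simp
  rw [norm_mul, this]

/-- The cosine series in `H^k`, without its constant term. -/
def serSob (k : ℕ) : Ell →L[ℝ] HSob k :=
  ellMap (fun n => ((seriesZero (unitVec n)).toHSob k)) (exists_norm_toHSob_le k).choose
    (exists_norm_toHSob_le k).choose_spec

lemma comp_zero_serSob (k : ℕ) (b : Ell) : HSob.comp 0 (serSob k b) = serL2 b := by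
  have : (HSob.comp 0).comp (serSob k) = serL2 := Ell.clm_ext fun n => by
    rw [ContinuousLinearMap.comp_apply, serSob, ellMap_unitVec, ← toLZ_seriesZero, SmoothZero.comp_toHSob]
  exact congrArg (fun S => S b) this

lemma toHSob_seriesZero (k : ℕ) (b : Ell) : (seriesZero b).toHSob k = serSob k b :=
  HSob.ext_coef fun n => by
    rw [comp_zero_serSob, ← toLZ_seriesZero, SmoothZero.comp_toHSob]

/-! ### The linearized equation -/

/-- The derivative of `ε ↦ ε • b ε`. -/
def waveDer (b : ℝ → Ell) (ε : ℝ) : Ell := deriv (fun e => e • b e) ε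

namespace IsProfile

variable {δ : ℝ} {b : ℝ → Ell} {ν : ℝ → ℝ} {ε : ℝ}

lemma eventually_mem (hε : ε ∈ Ioo (-δ) δ) : ∀ᶠ e in 𝓝 ε, e ∈ Ioo (-δ) δ := isOpen_Ioo.mem_nhds hε

lemma contDiffAt_wave (h : IsProfile δ b ν) (hε : ε ∈ Ioo (-δ) δ) :
    ContDiffAt ℝ ω (fun e => e • b e) ε := contDiffAt_id.smul (h.smooth ε hε)

lemma hasDerivAt_wave (h : IsProfile δ b ν) (hε : ε ∈ Ioo (-δ) δ) :
    HasDerivAt (fun e => e • b e) (waveDer b ε) ε :=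
  ((h.contDiffAt_wave hε).differentiableAt (by simp)).hasDerivAt

lemma hasDerivAt_vel (h : IsProfile δ b ν) (hε : ε ∈ Ioo (-δ) δ) : HasDerivAt ν (deriv ν ε) ε :=
  ((h.smooth_vel ε hε).differentiableAt (by simp)).hasDerivAt

lemma contDiffAt_waveDer (h : IsProfile δ b ν) (hε : ε ∈ Ioo (-δ) δ) :
    ContDiffAt ℝ ∞ (waveDer b) ε := by
  have h1 : ContDiffOn ℝ ∞ (fun e => e • b e) (Ioo (-δ) δ) := fun e he =>
    ((h.contDiffAt_wave he).of_le le_top).contDiffWithinAt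
  exact (h1.deriv_of_isOpen isOpen_Ioo (by simp)).contDiffAt (isOpen_Ioo.mem_nhds hε)

lemma zero_mem (h : IsProfile δ b ν) : (0 : ℝ) ∈ Ioo (-δ) δ := ⟨by linarith [h.pos], h.pos⟩

lemma waveDer_zero (h : IsProfile δ b ν) : waveDer b 0 = cosVec := by
  have h1 := (hasDerivAt_id (0 : ℝ)).smul
    ((h.smooth 0 h.zero_mem).differentiableAt (by simp)).hasDerivAt
  have h2 := h1.deriv
  simp only [id, zero_smul, zero_add, one_smul, h.at_zero] at h2
  exact h2

/-- A continuous linear functional that vanishes along a curve vanishes on the derivative. -/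
lemma map_deriv_eq_zero {E : Type*} [NormedAddCommGroup E] [NormedSpace ℝ E] {γ : ℝ → E} {γ' : E}
    (h : HasDerivAt γ γ' ε) (ℓ : E →L[ℝ] ℝ) (h0 : ∀ᶠ e in 𝓝 ε, ℓ (γ e) = 0) : ℓ γ' = 0 := by
  have h1 := ℓ.hasFDerivAt.comp_hasDerivAt ε h
  have h2 : HasDerivAt (ℓ ∘ γ) 0 ε :=
    (hasDerivAt_const ε (0 : ℝ)).congr_of_eventuallyEq h0
  exact h1.unique h2

lemma coord_zero_waveDer (h : IsProfile δ b ν) (hε : ε ∈ Ioo (-δ) δ) : coord 0 (waveDer b ε) = 0 :=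
  map_deriv_eq_zero (h.hasDerivAt_wave hε) (coord 0)
    ((eventually_mem hε).mono fun _ he => h.coord_zero_wave he)

/-- The ε-derivative of `eqn`. Nothing is known about how κ there depends on ε, so only the
coordinates n ≠ 0 are differentiated, and the new constant is defined as coordinate 0. -/
lemma linearized_eqn (h : IsProfile δ b ν) (hε : ε ∈ Ioo (-δ) δ) :
    ∃ κ : ℝ, ellMul (ε • b ε) (waveDer b ε) - invLam (waveDer b ε) - ν ε • waveDer b ε -
      deriv ν ε • (ε • b ε) = κ • unitVec 0 := by
  have hA := h.hasDerivAt_wave hε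
  have h1 : HasDerivAt (fun e => ellMul (e • b e)) (ellMul (waveDer b ε)) ε :=
    ellMul.hasFDerivAt.comp_hasDerivAt ε hA
  have h2 := ((h1.clm_apply hA).const_smul (1 / 2 : ℝ)).sub
    (invLam.hasFDerivAt.comp_hasDerivAt ε hA) |>.sub ((h.hasDerivAt_vel hε).smul hA)
  have h3 : ∀ n ≠ 0, coord n ((1 / 2 : ℝ) • (ellMul (waveDer b ε) (ε • b ε) +
      ellMul (ε • b ε) (waveDer b ε)) - invLam (waveDer b ε) -
      (ν ε • waveDer b ε + deriv ν ε • (ε • b ε))) = 0 := fun n hn => by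
    refine map_deriv_eq_zero h2 (coord n) ((eventually_mem hε).mono fun e he => ?_)
    obtain ⟨κ, hκ⟩ := h.eqn e he
    refine (congrArg (coord n) hκ).trans ?_
    rw [map_smul, coord_unitVec, if_neg (Ne.symm hn), smul_zero]
  have h4 : (1 / 2 : ℝ) • (ellMul (waveDer b ε) (ε • b ε) +
      ellMul (ε • b ε) (waveDer b ε)) - invLam (waveDer b ε) -
      (ν ε • waveDer b ε + deriv ν ε • (ε • b ε)) = ellMul (ε • b ε) (waveDer b ε) -
      invLam (waveDer b ε) - ν ε • waveDer b ε - deriv ν ε • (ε • b ε) := by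
    rw [ellMul_comm (waveDer b ε), ← two_smul ℝ (ellMul (ε • b ε) (waveDer b ε)), smul_smul]
    norm_num
    abel
  rw [h4] at h3
  refine ⟨coord 0 (ellMul (ε • b ε) (waveDer b ε) - invLam (waveDer b ε) - ν ε • waveDer b ε -
      deriv ν ε • (ε • b ε)), Ell.ext_coord fun n => ?_⟩
  rw [map_smul (coord n), coord_unitVec]
  rcases eq_or_ne n 0 with rfl | hn
  · simp
  · rw [h3 n hn, if_neg (Ne.symm hn), smul_zero]

lemma linearized_eq (h : IsProfile δ b ν) (hε : ε ∈ Ioo (-δ) δ) :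
    ∃ κ : ℝ, cosSeries (ε • b ε) * cosSeries (waveDer b ε) - ν ε • cosSeries (waveDer b ε) =
      cosSeries (invLam (waveDer b ε)) + deriv ν ε • cosSeries (ε • b ε) + κ • cosT 0 := by
  obtain ⟨κ, hκ⟩ := h.linearized_eqn hε
  refine ⟨κ, ?_⟩
  have h1 := congrArg cosSeries hκ
  generalize ε • b ε = A at h1 ⊢
  rw [map_sub, map_sub, map_sub, map_smul _ κ, cosSeries_ellMul, map_smul _ (ν ε),
    map_smul _ (deriv ν ε)] at h1
  have h2 : cosSeries (unitVec 0) = cosT 0 := by simp [cosSeries]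
  rw [h2] at h1
  rw [← h1]
  abel

lemma coef_cosSeries_wave_zero (h : IsProfile δ b ν) (hε : ε ∈ Ioo (-δ) δ) :
    coef (cosSeries (ε • b ε)) 0 = 0 := by
  rw [coef_cosSeries_zero, h.coord_zero_wave hε, Complex.ofReal_zero]

lemma coef_cosSeries_waveDer_zero (h : IsProfile δ b ν) (hε : ε ∈ Ioo (-δ) δ) :
    coef (cosSeries (waveDer b ε)) 0 = 0 := by
  rw [coef_cosSeries_zero, h.coord_zero_waveDer hε, Complex.ofReal_zero]

end IsProfile

/-- This is |D|⁻¹ = -H∂ₓ⁻¹, used to apply the adjoint to the antiderivative of ∂_εu. -/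
lemma coef_cosSeries_invLam (b : Ell) (k : ℤ) :
    coef (cosSeries (invLam b)) k = Complex.I * (k.sign : ℂ) * coef (antiderivSeries b) k := by
  refine coef_eq_mul_coef (S := cosSeries.comp invLam) k _ (fun n => ?_) b
  simp only [ContinuousLinearMap.comp_apply, invLam, antiderivSeries, cosSeries, ellMap_unitVec,
    map_smul, coef_smul_fn, coef_cosT, coef_sinT]
  rcases Nat.eq_zero_or_pos n with rfl | hn
  · simp
  push_cast
  by_cases h1 : k = n
  · have h2 : ¬ k = -n := by omega
    have : k.sign = 1 := Int.sign_eq_one_of_pos (by omega)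
    rw [if_pos h1, if_neg h2, this]; push_cast
    linear_combination ((1 / 2) * (n : ℂ)⁻¹ * (decay : ℂ) ^ n) * Complex.I_sq
  · by_cases h2 : k = -n
    · have : k.sign = -1 := Int.sign_eq_neg_one_of_neg (by omega)
      rw [if_neg h1, if_pos h2, this]; push_cast
      linear_combination ((1 / 2) * (n : ℂ)⁻¹ * (decay : ℂ) ^ n) * Complex.I_sq
    · simp [h1, h2]

lemma memLp_mul_l2fn (f : C(Torus, ℝ)) (g : LZ) : MemLp (fun x => f x * l2fn g x) 2 torusMeasure := by
  have hg : MemLp (l2fn g) 2 torusMeasure := Lp.memLp _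
  refine MemLp.of_le_mul (c := ‖f‖) hg
    (f.continuous.aestronglyMeasurable.mul hg.aestronglyMeasurable) (ae_of_all _ fun x => ?_)
  rw [norm_mul]
  exact mul_le_mul_of_nonneg_right (f.norm_coe_le_norm x) (norm_nonneg _)

/-- `L g = w`, where the traveling wave is given by a continuous function. -/
def IsLin (f : C(Torus, ℝ)) (g w : LZ) : Prop :=
  ∀ n : ℤ, LZ.coef n w = Complex.I * n * coef (fun x => f x * l2fn g x) n
    - Complex.I * (n.sign : ℂ) * LZ.coef n g

lemma IsLin.add {f : C(Torus, ℝ)} {g w g' w' : LZ} (h : IsLin f g w) (h' : IsLin f g' w') :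
    IsLin f (g + g') (w + w') := fun n => by
  have h1 : coef (fun x => f x * l2fn (g + g') x) n =
      coef (fun x => f x * l2fn g x) n + coef (fun x => f x * l2fn g' x) n := by
    rw [← coef_add ((memLp_mul_l2fn f g).integrable (by norm_num))
      ((memLp_mul_l2fn f g').integrable (by norm_num))]
    refine coef_congr_ae ?_ n
    have := Lp.coeFn_add (g : L2Zero).1 (g' : L2Zero).1
    filter_upwards [this] with x hx
    change f x * _ = f x * _ + f x * _
    rw [← mul_add]
    exact congrArg (f x * ·) hx
  rw [map_add, map_add, h n, h' n, h1]; ring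

lemma IsLin.smul {f : C(Torus, ℝ)} {g w : LZ} (h : IsLin f g w) (c : ℝ) :
    IsLin f (c • g) (c • w) := fun n => by
  have h1 : coef (fun x => f x * l2fn (c • g) x) n = c * coef (fun x => f x * l2fn g x) n := by
    rw [← coef_smul]
    refine coef_congr_ae ?_ n
    have := Lp.coeFn_smul c (g : L2Zero).1
    filter_upwards [this] with x hx
    change f x * _ = c * (f x * _)
    rw [mul_left_comm]
    exact congrArg (f x * ·) hx
  rw [map_smul, map_smul, h n, h1, Complex.real_smul, Complex.real_smul]; ring

/-- Integration by parts: the adjoint of the linearized operator. -/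
lemma IsLin.inner_eq {f : C(Torus, ℝ)} {g w : LZ} (h : IsLin f g w) {p p' hp : C(Torus, ℝ)}
    (hp0 : coef p 0 = 0) (hp' : ∀ n, coef p' n = Complex.I * n * coef p n)
    (hhp : ∀ n : ℤ, coef hp n = -Complex.I * (n.sign : ℂ) * coef p n) :
    inner ℝ w (zeroMean p) = -∫ x, l2fn g x * (f * p' + hp) x ∂torusMeasure := by
  have hg : MemLp (l2fn g) 2 torusMeasure := Lp.memLp _
  have h1 := LZ.hasSum_inner w (zeroMean p)
  have h2 := hasSum_coef_mul_conj_of_memLp (memLp_mul_l2fn f g) (memLp_of_continuous p'.continuous)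
  have h3 := hasSum_coef_mul_conj_of_memLp hg (memLp_of_continuous hp.continuous)
  have h4 := h1.unique ((h2.add h3).neg.congr_fun fun n => ?_)
  · have hi1 : Integrable (fun x => f x * l2fn g x * p' x) torusMeasure :=
      (memLp_mul_l2fn f g).integrable_mul (memLp_of_continuous p'.continuous)
    have hi2 : Integrable (fun x => l2fn g x * hp x) torusMeasure :=
      hg.integrable_mul (memLp_of_continuous hp.continuous)
    rw [← Complex.ofReal_add, ← Complex.ofReal_neg, Complex.ofReal_inj,
      ← integral_add hi1 hi2] at h4
    rw [h4]
    congr 2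
    funext x
    simp only [ContinuousMap.add_apply, ContinuousMap.mul_apply]
    ring
  · have hs : conj ((n.sign : ℤ) : ℂ) = n.sign := map_intCast _ _
    have hn : conj (n : ℂ) = n := map_intCast _ _
    rw [coef_zeroMean_of_mean hp0, h n, hp', hhp]
    simp only [map_mul, map_neg, Complex.conj_I, hs, hn, LZ.coef_apply]
    ring

lemma integral_l2fn_mul {f : C(Torus, ℝ)} (hf : coef f 0 = 0) (g : LZ) :
    ∫ x, l2fn g x * f x ∂torusMeasure = inner ℝ g (zeroMean f) := by
  have hg : MemLp (l2fn g) 2 torusMeasure := Lp.memLp _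
  have h1 := LZ.hasSum_inner g (zeroMean f)
  have h2 := hasSum_coef_mul_conj_of_memLp hg (memLp_of_continuous f.continuous)
  have h3 := h2.unique (h1.congr_fun fun n => ?_)
  · exact_mod_cast h3
  · rw [coef_zeroMean_of_mean hf]; rfl

lemma integral_l2fn (g : LZ) : ∫ x, l2fn g x ∂torusMeasure = 0 := g.2

lemma coef_mul_l2fn_zeroMean (f : C(Torus, ℝ)) {p : C(Torus, ℝ)} (hp : coef p 0 = 0) (n : ℤ) :
    coef (fun x => f x * l2fn (zeroMean p) x) n = coef (f * p : C(Torus, ℝ)) n :=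
  coef_congr_ae ((zeroMean_ae hp).mono fun x hx => by
    change f x * l2fn (zeroMean p) x = f x * p x
    rw [hx]) n

namespace IsProfile

variable {δ : ℝ} {b : ℝ → Ell} {ν : ℝ → ℝ} {ε : ℝ}

/-- The coefficient `u - v` of the linearized operator. -/
def linCoeff (b : ℝ → Ell) (ν : ℝ → ℝ) (ε : ℝ) : C(Torus, ℝ) := cosSeries (ε • b ε) - ν ε • cosT 0

lemma isLinearization_iff (h : IsProfile δ b ν) (hε : ε ∈ Ioo (-δ) δ) (g w : L2Zero) :
    IsLinearization (seriesZero (ε • b ε)) (ν ε) g w ↔ IsLin (linCoeff b ν ε) g w := by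
  have : (fun x => ((seriesZero (ε • b ε)).fn x - ν ε) * l2fn g x) =
      fun x => linCoeff b ν ε x * l2fn g x := by
    funext x
    rw [h.fn_eq hε]
    simp [linCoeff, cosT_apply]
  unfold IsLinearization
  rw [this]
  rfl

lemma linCoeff_mul (f : C(Torus, ℝ)) :
    linCoeff b ν ε * f = cosSeries (ε • b ε) * f - ν ε • f := by
  ext x
  simp [linCoeff, cosT_apply, sub_mul]

lemma coef_derivSeries_zero (c : Ell) : coef (derivSeries c) 0 = 0 := by
  rw [coef_derivSeries]; simp

/-- Translation invariance: ((u - v)u')' + Hu' is the x-derivative of the wave equation. -/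
lemma isLin_derL2 (h : IsProfile δ b ν) (hε : ε ∈ Ioo (-δ) δ) :
    IsLin (linCoeff b ν ε) (derL2 (ε • b ε)) 0 := fun n => by
  have h1 : linCoeff b ν ε * derivSeries (ε • b ε) = (-1 : ℝ) • sinSeries (ε • b ε) := by
    rw [linCoeff_mul, ← h.wave_eq hε, neg_one_smul]; abel
  have h2 : LZ.coef n (derL2 (ε • b ε)) = Complex.I * n * coef (cosSeries (ε • b ε)) n := by
    rw [derL2, ContinuousLinearMap.comp_apply, coef_zeroMean_of_mean (coef_derivSeries_zero _),
      coef_derivSeries]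
  rw [h2, derL2, ContinuousLinearMap.comp_apply,
    coef_mul_l2fn_zeroMean _ (coef_derivSeries_zero _), h1, coef_smul_fn, coef_sinSeries, map_zero]
  push_cast
  ring

/-- The wave equation differentiated in ε: L∂_εu = v'(ε)u', so ∂_εu lies in the generalized kernel.
-/
lemma isLin_serL2 (h : IsProfile δ b ν) (hε : ε ∈ Ioo (-δ) δ) :
    IsLin (linCoeff b ν ε) (serL2 (waveDer b ε)) (deriv ν ε • derL2 (ε • b ε)) := fun n => by
  obtain ⟨κ, hκ⟩ := h.linearized_eq hε
  have h0 := h.coef_cosSeries_waveDer_zero hε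
  rw [← linCoeff_mul] at hκ
  have h2 : LZ.coef n (derL2 (ε • b ε)) = Complex.I * n * coef (cosSeries (ε • b ε)) n := by
    rw [derL2, ContinuousLinearMap.comp_apply, coef_zeroMean_of_mean (coef_derivSeries_zero _),
      coef_derivSeries]
  have h3 : Complex.I * n * coef (cosSeries (invLam (waveDer b ε))) n =
      Complex.I * (n.sign : ℂ) * coef (cosSeries (waveDer b ε)) n := by
    rw [← coef_derivSeries, derivSeries_invLam, ← neg_one_smul ℝ, coef_smul_fn, coef_sinSeries]
    push_cast; ring
  have h4 : Complex.I * n * coef (cosT 0) n = 0 := by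
    rw [coef_cosT]
    by_cases hn : n = 0 <;> simp [hn]
  have h5 : coef (cosSeries (invLam (waveDer b ε)) + deriv ν ε • cosSeries (ε • b ε) + κ • cosT 0 :
      C(Torus, ℝ)) n = coef (cosSeries (invLam (waveDer b ε))) n +
      deriv ν ε * coef (cosSeries (ε • b ε)) n + κ * coef (cosT 0) n := by
    generalize ε • b ε = A
    rw [← coefC_apply, map_add, map_add, map_smul, map_smul, coefC_apply, coefC_apply, coefC_apply,
      Complex.real_smul, Complex.real_smul]
  rw [serL2, ContinuousLinearMap.comp_apply, coef_mul_l2fn_zeroMean _ h0, hκ,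
    coef_zeroMean_of_mean h0, map_smul (LZ.coef n), h2, h5, Complex.real_smul]
  linear_combination -h3 - (κ : ℂ) * h4

/-- The adjoint is L*p = -((u - v)p' + Hp), and L*u = 0 is the wave equation. -/
lemma inner_lin_serL2 (h : IsProfile δ b ν) (hε : ε ∈ Ioo (-δ) δ) {g w : LZ}
    (hl : IsLin (linCoeff b ν ε) g w) : inner ℝ w (serL2 (ε • b ε)) = 0 := by
  have h1 := hl.inner_eq (h.coef_cosSeries_wave_zero hε) (coef_derivSeries _) (coef_sinSeries _)
  have h2 : linCoeff b ν ε * derivSeries (ε • b ε) + sinSeries (ε • b ε) = 0 := by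
    rw [linCoeff_mul, ← h.wave_eq hε]; abel
  rw [h2] at h1
  refine h1.trans ?_
  simp

/-- For p = ∂ₓ⁻¹∂_εu the linearized equation gives L*p = -v'(ε)u up to a constant, and constants are
invisible to functions of mean zero. -/
lemma inner_lin_antiL2 (h : IsProfile δ b ν) (hε : ε ∈ Ioo (-δ) δ) {g w : LZ}
    (hl : IsLin (linCoeff b ν ε) g w) :
    inner ℝ w (antiL2 (waveDer b ε)) = -(deriv ν ε * inner ℝ g (serL2 (ε • b ε))) := by
  obtain ⟨κ, hκ⟩ := h.linearized_eq hε
  rw [← linCoeff_mul] at hκ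
  have hd : ∀ n : ℤ, coef (cosSeries (waveDer b ε)) n =
      Complex.I * n * coef (antiderivSeries (waveDer b ε)) n := fun n => by
    rcases eq_or_ne n 0 with rfl | hn
    · rw [h.coef_cosSeries_waveDer_zero hε]; simp
    · exact coef_antiderivSeries _ n hn
  have hh : ∀ n : ℤ, coef ((-1 : ℝ) • cosSeries (invLam (waveDer b ε)) : C(Torus, ℝ)) n =
      -Complex.I * (n.sign : ℂ) * coef (antiderivSeries (waveDer b ε)) n := fun n => by
    rw [coef_smul_fn, coef_cosSeries_invLam]; push_cast; ring
  have h1 := hl.inner_eq (coef_antiderivSeries_zero (waveDer b ε)) hd hh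
  have h2 : linCoeff b ν ε * cosSeries (waveDer b ε) +
      (-1 : ℝ) • cosSeries (invLam (waveDer b ε)) =
      deriv ν ε • cosSeries (ε • b ε) + κ • cosT 0 := by
    rw [hκ, neg_one_smul]; abel
  rw [h2] at h1
  refine h1.trans ?_
  congr 1
  rw [serL2, ContinuousLinearMap.comp_apply, ← integral_l2fn_mul (h.coef_cosSeries_wave_zero hε)]
  have hg : MemLp (l2fn g) 2 torusMeasure := Lp.memLp _
  have hi : Integrable (fun x => l2fn g x * cosSeries (ε • b ε) x) torusMeasure :=
    hg.integrable_mul (memLp_of_continuous (cosSeries (ε • b ε)).continuous)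
  have h3 : ∀ x, l2fn g x * (deriv ν ε • cosSeries (ε • b ε) + κ • cosT 0) x =
      deriv ν ε * (l2fn g x * cosSeries (ε • b ε) x) + κ * l2fn g x := fun x => by
    simp only [ContinuousMap.add_apply, ContinuousMap.smul_apply, smul_eq_mul, cosT_apply,
      fourier_zero, Complex.one_re]
    ring
  simp only [h3]
  rw [integral_add (hi.const_mul _) ((hg.integrable (by norm_num)).const_mul _),
    integral_const_mul, integral_const_mul, integral_l2fn, mul_zero, add_zero]

end IsProfile

/-! ### The spectral projections -/

lemma ae_torusMeasure_iff {p : Torus → Prop} :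
    (∀ᵐ x ∂torusMeasure, p x) ↔ ∀ᵐ x : Torus, p x := by
  rw [AddCircle.volume_eq_smul_haarAddCircle]
  exact (Measure.ae_ennreal_smul_measure_iff
    (ENNReal.ofReal_pos.2 Real.two_pi_pos).ne').symm

/-- The line is a countable union of periods, each carried onto the torus by a measure preserving
map. -/
lemma ae_real_iff_ae_torus {p : Torus → Prop} (hp : MeasurableSet {x | p x}) :
    (∀ᵐ x : ℝ, p x) ↔ ∀ᵐ x ∂torusMeasure, p x := by
  rw [ae_torusMeasure_iff]
  have key : ∀ t : ℝ, (∀ᵐ x : ℝ ∂(volume.restrict (Ioc t (t + 2 * π))), p (x : Torus)) ↔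
      ∀ᵐ x : Torus, p x := fun t => by
    rw [← (AddCircle.measurePreserving_mk (2 * π) t).map_eq]
    exact (ae_map_iff (AddCircle.measurePreserving_mk (2 * π) t).measurable.aemeasurable hp).symm
  constructor
  · intro h
    exact (key 0).1 (ae_restrict_of_ae h)
  · intro h
    have h1 := iUnion_Ioc_zsmul Real.two_pi_pos
    rw [← Measure.restrict_univ (μ := (volume : Measure ℝ)), ← h1, ae_restrict_iUnion_iff]
    intro n
    have h2 := (key (n • (2 * π))).2 h
    rwa [add_smul, one_smul]

lemma ae_real_eq_iff {f : C(Torus, ℝ)} (hf : coef f 0 = 0) (w : LZ) (c : ℝ) :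
    (∀ᵐ x : ℝ, l2fn w (x : Torus) = c * f x) ↔ w = c • zeroMean f := by
  have hw : StronglyMeasurable (l2fn w) := Lp.stronglyMeasurable _
  rw [ae_real_iff_ae_torus (p := fun x => l2fn w x = c * f x)
    (measurableSet_eq_fun hw.measurable (f.continuous.measurable.const_mul c))]
  constructor
  · intro h
    refine LZ.ext_coef fun n => ?_
    rw [map_smul, coef_zeroMean_of_mean hf, LZ.coef_apply, Complex.real_smul, ← coef_smul]
    exact coef_congr_ae h n
  · rintro rfl
    have h1 := Lp.coeFn_smul c (zeroMean f : L2Zero).1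
    filter_upwards [zeroMean_ae hf, h1] with x hx h1x
    rw [← hx]
    exact h1x

namespace IsProfile

variable {δ : ℝ} {b : ℝ → Ell} {ν : ℝ → ℝ} {ε : ℝ}

/-- The pairing of `u` and `∂_ε u`. -/
def pairing (b : ℝ → Ell) (ε : ℝ) : ℝ := inner ℝ (serL2 (ε • b ε)) (serL2 (waveDer b ε))

lemma pairing_eq (b : ℝ → Ell) (ε : ℝ) :
    pairing b ε = ε * inner ℝ (serL2 (b ε)) (serL2 (waveDer b ε)) := by
  rw [pairing, map_smul, real_inner_smul_left]

lemma eventually_inner_pos (h : IsProfile δ b ν) :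
    ∀ᶠ ε in 𝓝 (0 : ℝ), 0 < (inner ℝ (serL2 (b ε)) (serL2 (waveDer b ε)) : ℝ) := by
  have h1 : ContinuousAt (fun ε => (inner ℝ (serL2 (b ε)) (serL2 (waveDer b ε)) : ℝ)) 0 :=
    ContinuousAt.inner (serL2.continuous.continuousAt.comp (h.smooth 0 h.zero_mem).continuousAt)
      (serL2.continuous.continuousAt.comp (h.contDiffAt_waveDer h.zero_mem).continuousAt)
  refine h1.eventually_const_lt ?_
  beta_reduce
  rw [h.at_zero, h.waveDer_zero, inner_serL2_cosVec]
  norm_num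

/-- The projection `P₀⁺(ε)`. -/
def projPlus (b : ℝ → Ell) (ε : ℝ) : LZ →L[ℝ] LZ :=
  ((pairing b ε)⁻¹ • innerSL ℝ (serL2 (ε • b ε))).smulRight (serL2 (waveDer b ε))

/-- The projection `P₀⁻(ε)`. -/
def projMinus (b : ℝ → Ell) (ε : ℝ) : LZ →L[ℝ] LZ :=
  (-(pairing b ε)⁻¹ • innerSL ℝ (antiL2 (waveDer b ε))).smulRight (derL2 (ε • b ε))

lemma projPlus_apply (b : ℝ → Ell) (ε : ℝ) (g : LZ) : projPlus b ε g =
    ((pairing b ε)⁻¹ * inner ℝ g (serL2 (ε • b ε))) • serL2 (waveDer b ε) := by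
  rw [real_inner_comm]; rfl

lemma projMinus_apply (b : ℝ → Ell) (ε : ℝ) (g : LZ) : projMinus b ε g =
    (-(pairing b ε)⁻¹ * inner ℝ g (antiL2 (waveDer b ε))) • derL2 (ε • b ε) := by
  rw [real_inner_comm]; rfl

lemma projPlus_serL2 (hD : pairing b ε ≠ 0) :
    projPlus b ε (serL2 (waveDer b ε)) = serL2 (waveDer b ε) := by
  rw [projPlus_apply, real_inner_comm, ← pairing, inv_mul_cancel₀ hD, one_smul]

lemma projPlus_derL2 : projPlus b ε (derL2 (ε • b ε)) = 0 := by
  rw [projPlus_apply, inner_derL2_serL2, mul_zero, zero_smul]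

lemma projMinus_serL2 : projMinus b ε (serL2 (waveDer b ε)) = 0 := by
  rw [projMinus_apply, inner_serL2_antiL2, mul_zero, zero_smul]

lemma projMinus_derL2 (hD : pairing b ε ≠ 0) :
    projMinus b ε (derL2 (ε • b ε)) = derL2 (ε • b ε) := by
  rw [projMinus_apply, inner_derL2_antiL2, ← pairing, neg_mul_neg, inv_mul_cancel₀ hD, one_smul]

lemma projPlus_eq_zero {g : LZ} (h : inner ℝ g (serL2 (ε • b ε)) = (0 : ℝ)) :
    projPlus b ε g = 0 := by
  rw [projPlus_apply, h, mul_zero, zero_smul]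

lemma projMinus_eq_zero {g : LZ} (h : inner ℝ g (antiL2 (waveDer b ε)) = (0 : ℝ)) :
    projMinus b ε g = 0 := by
  rw [projMinus_apply, h, mul_zero, zero_smul]

/-- Both L(P⁺ + P⁻)g and (P⁺ + P⁻)Lg equal v'(ε)D⁻¹⟨g, u⟩u', where D is `pairing`. -/
lemma isLin_proj (h : IsProfile δ b ν) (hε : ε ∈ Ioo (-δ) δ) {g w : LZ}
    (hl : IsLin (linCoeff b ν ε) g w) :
    IsLin (linCoeff b ν ε) (projPlus b ε g + projMinus b ε g)
      (projPlus b ε w + projMinus b ε w) := by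
  rw [projPlus_eq_zero (h.inner_lin_serL2 hε hl), zero_add, projMinus_apply b ε w,
    h.inner_lin_antiL2 hε hl, projPlus_apply, projMinus_apply b ε g]
  have h1 := ((h.isLin_serL2 hε).smul ((pairing b ε)⁻¹ * inner ℝ g (serL2 (ε • b ε)))).add
    ((h.isLin_derL2 hε).smul (-(pairing b ε)⁻¹ * inner ℝ g (antiL2 (waveDer b ε))))
  rw [smul_zero, add_zero, smul_smul] at h1
  convert h1 using 2
  ring

lemma deriv_seriesZero_amplitude (h : IsProfile δ b ν) (hε : ε ∈ Ioo (-δ) δ) (x : ℝ) :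
    deriv (fun e => seriesZero (e • b e) x) ε = cosSeries (waveDer b ε) (x : Torus) := by
  have h1 : HasDerivAt (fun e => evalSeries x (e • b e) - coord 0 (e • b e))
      (evalSeries x (waveDer b ε) - coord 0 (waveDer b ε)) ε :=
    ((evalSeries x).hasFDerivAt.comp_hasDerivAt ε (h.hasDerivAt_wave hε)).sub
      ((coord 0).hasFDerivAt.comp_hasDerivAt ε (h.hasDerivAt_wave hε))
  rw [h.coord_zero_waveDer hε, sub_zero, evalSeries_apply] at h1
  exact h1.deriv

lemma deriv_seriesZero (c : Ell) (x : ℝ) : deriv (seriesZero c) x = derivSeries c (x : Torus) :=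
  congrFun (seriesZero_diff_fn c) (x : Torus)

/-- The spectral projections of the linearized operator for the eigenvalue `0`. -/
lemma isZeroModeProjection (h : IsProfile δ b ν) (hε : ε ∈ Ioo (-δ) δ) (hε0 : ε ≠ 0)
    (hD : pairing b ε ≠ 0) {u : ℝ → SmoothZero} {v : ℝ → ℝ}
    (hu : ∀ᶠ e in 𝓝 ε, u e = seriesZero (e • b e)) (hv : v ε = ν ε) :
    IsZeroModeProjection u v ε (projPlus b ε) (projMinus b ε) where
  idem_plus g := by
    change projPlus b ε (projPlus b ε g) = projPlus b ε g
    rw [projPlus_apply b ε g, map_smul, projPlus_serL2 hD]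
  idem_minus g := by
    change projMinus b ε (projMinus b ε g) = projMinus b ε g
    rw [projMinus_apply b ε g, map_smul, projMinus_derL2 hD]
  plus_minus g := by
    change projPlus b ε (projMinus b ε g) = 0
    rw [projMinus_apply b ε g, map_smul, projPlus_derL2, smul_zero]
  minus_plus g := by
    change projMinus b ε (projPlus b ε g) = 0
    rw [projPlus_apply b ε g, map_smul, projMinus_serL2, smul_zero]
  range_plus w := by
    change (∃ g : LZ, projPlus b ε g = w) ↔ _
    have h1 : ∀ x : ℝ, deriv (fun e => u e x) ε = cosSeries (waveDer b ε) (x : Torus) := fun x => by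
      rw [← h.deriv_seriesZero_amplitude hε]
      refine EventuallyEq.deriv_eq (hu.mono fun e he => ?_)
      change u e x = seriesZero (e • b e) x
      rw [he]
    simp only [h1]
    have h2 := fun c => ae_real_eq_iff (h.coef_cosSeries_waveDer_zero hε) w c
    rw [exists_congr h2]
    constructor
    · rintro ⟨g, rfl⟩
      exact ⟨_, projPlus_apply b ε g⟩
    · rintro ⟨c, rfl⟩
      refine ⟨c • serL2 (waveDer b ε), ?_⟩
      rw [map_smul, projPlus_serL2 hD]; rfl
  range_minus w := by
    change (∃ g : LZ, projMinus b ε g = w) ↔ _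
    have h1 : ∀ x : ℝ, deriv (u ε) x = derivSeries (ε • b ε) (x : Torus) := fun x => by
      rw [hu.self_of_nhds, deriv_seriesZero]
    simp only [h1, ← mul_assoc]
    have h2 := fun c : ℝ => ae_real_eq_iff (coef_derivSeries_zero (ε • b ε)) w (c * -ε⁻¹)
    rw [exists_congr h2]
    constructor
    · rintro ⟨g, rfl⟩
      -- The factor -ε undoes the normalization -ε⁻¹ of φ₀⁻.
      refine ⟨(-(pairing b ε)⁻¹ * inner ℝ g (antiL2 (waveDer b ε))) * -ε, ?_⟩
      rw [projMinus_apply, mul_assoc, neg_mul_neg, mul_inv_cancel₀ hε0, mul_one]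
      rfl
    · rintro ⟨c, rfl⟩
      refine ⟨(c * -ε⁻¹) • derL2 (ε • b ε), ?_⟩
      rw [map_smul, projMinus_derL2 hD]; rfl
  commute g w hl := by
    rw [hu.self_of_nhds, hv] at hl ⊢
    exact (h.isLinearization_iff hε _ _).2 (h.isLin_proj hε ((h.isLinearization_iff hε _ _).1 hl))

end IsProfile

/-! ### A smooth implicit function -/

/-- The implicit function theorem for a smooth equation, with smoothness of the solution at all
points of a ball. -/
lemma exists_smooth_implicitFunction {E₁ E₂ F : Type*} [NormedAddCommGroup E₁] [NormedSpace ℝ E₁]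
    [CompleteSpace E₁] [NormedAddCommGroup E₂] [NormedSpace ℝ E₂] [CompleteSpace E₂]
    [NormedAddCommGroup F] [NormedSpace ℝ F] [CompleteSpace F] {f : E₁ × E₂ → F} {u : E₁ × E₂}
    (hf : ∀ᶠ p in 𝓝 u, ContDiffAt ℝ ∞ f p) (h0 : f u = 0)
    (hinv : (fderiv ℝ f u ∘L .inr ℝ E₁ E₂).IsInvertible) :
    ∃ Φ : E₁ → E₂, Φ u.1 = u.2 ∧ (∀ᶠ p in 𝓝 u, f p = 0 → Φ p.1 = p.2) ∧
      ∃ r > 0, (∃ K, LipschitzOnWith K Φ (Metric.ball u.1 r)) ∧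
        ∀ q ∈ Metric.ball u.1 r, f (q, Φ q) = 0 ∧ ContDiffAt ℝ ∞ Φ q := by
  have pn : (∞ : WithTop ℕ∞) ≠ 0 := by simp
  have hfu := hf.self_of_nhds
  set Φ := hfu.implicitFunction pn hinv with hΦ
  have hΦu : Φ u.1 = u.2 := hfu.implicitFunction_apply_self pn hinv
  have hΦc : ContDiffAt ℝ ∞ Φ u.1 := hfu.contDiffAt_implicitFunction pn hinv
  have hsol : ∀ᶠ q in 𝓝 u.1, f (q, Φ q) = 0 := by
    have := hfu.eventually_apply_implicitFunction pn hinv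
    rwa [h0] at this
  -- Smoothness of class ∞ at one point only gives, for each finite order, a neighbourhood that may
  -- shrink with the order. Since invertibility is an open condition, the theorem can be applied
  -- afresh at every nearby (q, Φ q).
  have hopen : ∀ᶠ p in 𝓝 u, (fderiv ℝ f p ∘L .inr ℝ E₁ E₂).IsInvertible := by
    have h1 : ContinuousAt (fderiv ℝ f) u :=
      (hfu.fderiv_right (m := 0) (by simp)).continuousAt
    have h2 : ContinuousAt (fun p => fderiv ℝ f p ∘L .inr ℝ E₁ E₂) u :=
      h1.clm_comp continuousAt_const
    obtain ⟨e, he⟩ := hinv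
    have h3 := ContinuousLinearEquiv.nhds e
    rw [he] at h3
    exact h2 h3
  have hgood : ∀ᶠ q in 𝓝 u.1, ContDiffAt ℝ ∞ f (q, Φ q) ∧
      (fderiv ℝ f (q, Φ q) ∘L .inr ℝ E₁ E₂).IsInvertible := by
    have h1 : Tendsto (fun q => (q, Φ q)) (𝓝 u.1) (𝓝 u) := by
      have : ContinuousAt (fun q => (q, Φ q)) u.1 := continuousAt_id.prodMk hΦc.continuousAt
      unfold ContinuousAt at this
      beta_reduce at this
      rwa [hΦu] at this
    exact h1.eventually (hf.and hopen)
  obtain ⟨K, s, hs, hK⟩ := (hΦc.of_le (m := 1) (by simp)).exists_lipschitzOnWith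
  obtain ⟨r, hr, hball⟩ := Metric.eventually_nhds_iff_ball.1 (hsol.and (hgood.and hs))
  refine ⟨Φ, hΦu, ?_, r, hr, ⟨K, hK.mono fun q hq => (hball q hq).2.2⟩, fun q hq =>
    ⟨(hball q hq).1, ?_⟩⟩
  · have := hfu.eventually_apply_eq_iff_implicitFunction pn hinv
    rw [h0] at this
    exact this.mono fun p hp => hp.1
  · obtain ⟨hq0, ⟨hqf, hqi⟩, -⟩ := hball q hq
    have h1 := hqf.contDiffAt_implicitFunction pn hqi
    refine h1.congr_of_eventuallyEq ?_
    have h2 := hqf.eventually_apply_eq_iff_implicitFunction pn hqi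
    have hc : ContinuousAt Φ q := (hK.mono fun q hq => (hball q hq).2.2).continuousOn.continuousAt
      (Metric.isOpen_ball.mem_nhds hq)
    have h3 : ContinuousAt (fun q => (q, Φ q)) q := continuousAt_id.prodMk hc
    -- Local uniqueness identifies Φ near q with the implicit function constructed at q.
    filter_upwards [h3.eventually h2, Metric.isOpen_ball.mem_nhds hq] with q' hq' hb'
    have h4 := hq'.1 ((hball q' hb').1.trans hq0.symm)
    exact h4.symm

/-! ### Translates of series -/

lemma incl_transL {m k : ℕ} (h : m ≤ k) (a : ℝ) (F : HSob k) :
    HSob.incl h (HSob.transL a F) = HSob.transL a (HSob.incl h F) := rfl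

/-- A compatible family of maps into every H^k can absorb any loss of derivatives: for class C^j the
curve is started in H^(m+j+1). -/
lemma contDiff_transL_comp {E : Type*} [NormedAddCommGroup E] [NormedSpace ℝ E]
    {S : ∀ k : ℕ, E →L[ℝ] HSob k} (hS : ∀ {m k : ℕ} (h : m ≤ k) (c : E), HSob.incl h (S k c) = S m c)
    (m : ℕ) : ContDiff ℝ ∞ fun a => (HSob.transL a).comp (S m) := by
  refine contDiff_infty.2 fun j => ?_
  have h : m ≤ m + j + 1 := by omega
  have h1 := (HSob.contDiff_transIncl j h le_rfl).clm_comp (contDiff_const (c := S (m + j + 1)))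
  have h2 : (fun a => (HSob.transIncl h a).comp (S (m + j + 1))) =
      fun a => (HSob.transL a).comp (S m) := by
    funext a
    refine ContinuousLinearMap.ext fun c => ?_
    rw [ContinuousLinearMap.comp_apply, ContinuousLinearMap.comp_apply, ← hS h]
    rfl
  rw [h2] at h1
  exact h1

lemma incl_serSob {m k : ℕ} (h : m ≤ k) (c : Ell) : HSob.incl h (serSob k c) = serSob m c :=
  HSob.ext_coef fun n => by rw [HSob.comp_zero_incl, comp_zero_serSob, comp_zero_serSob]

/-- The antiderivative of the cosine series in `H^k`. -/
def antiSob (k : ℕ) : Ell →L[ℝ] HSob k :=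
  -- On mean zero functions ∂ₓ⁻¹ = -∂ₓ|D|⁻².
  -((HSob.der.comp (serSob (k + 1))).comp (invLam.comp invLam))

lemma comp_zero_antiSob (k : ℕ) (c : Ell) : HSob.comp 0 (antiSob k c) = antiL2 c :=
  LZ.ext_coef fun n => by
    have h : antiSob k c = -HSob.der (serSob (k + 1) (invLam (invLam c))) := rfl
    rw [h, map_neg, map_neg, HSob.coef_der, comp_zero_serSob]
    rcases eq_or_ne n 0 with rfl | hn
    · rw [LZ.coef_zero, LZ.coef_zero]; simp
    · rw [coef_serL2 _ hn, ← coef_derivSeries, derivSeries_invLam, ← neg_one_smul ℝ (sinSeries _),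
        coef_smul_fn, coef_sinSeries, coef_cosSeries_invLam, antiL2, ContinuousLinearMap.comp_apply,
        coef_zeroMean, if_neg hn]
      have hs : (n.sign : ℂ) * n.sign = 1 := by
        have : n.sign * n.sign = 1 := by
          rw [← Int.sign_mul, Int.sign_eq_one_of_pos (mul_self_pos.2 hn)]
        exact_mod_cast this
      push_cast
      linear_combination (-(coef (antiderivSeries c) n) * Complex.I ^ 2) * hs -
        coef (antiderivSeries c) n * Complex.I_sq

lemma incl_antiSob {m k : ℕ} (h : m ≤ k) (c : Ell) : HSob.incl h (antiSob k c) = antiSob m c :=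
  HSob.ext_coef fun n => by rw [HSob.comp_zero_incl, comp_zero_antiSob, comp_zero_antiSob]

lemma comp_zero_der_serSob (k : ℕ) (c : Ell) :
    HSob.comp 0 (HSob.der (serSob (k + 1) c)) = derL2 c :=
  LZ.ext_coef fun n => by rw [HSob.coef_der, coef_derL2, comp_zero_serSob]

lemma comp_zero_der_antiSob (k : ℕ) (c : Ell) :
    HSob.comp 0 (HSob.der (antiSob (k + 1) c)) = serL2 c :=
  LZ.ext_coef fun n => by rw [HSob.coef_der, ← coef_antiL2, comp_zero_antiSob]

/-- The translate of the cosine series, as a map to `L²`. -/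
def transSer (a : ℝ) : Ell →L[ℝ] LZ := (HSob.comp 0).comp ((HSob.transL a).comp (serSob 0))

/-- The translate of the antiderivative of the cosine series, as a map to `L²`. -/
def transAnti (a : ℝ) : Ell →L[ℝ] LZ := (HSob.comp 0).comp ((HSob.transL a).comp (antiSob 0))

lemma transSer_apply (a : ℝ) (c : Ell) : transSer a c = LZ.trans a (serL2 c) := by
  rw [← comp_zero_serSob 0 c]; rfl

lemma transAnti_apply (a : ℝ) (c : Ell) : transAnti a c = LZ.trans a (antiL2 c) := by
  rw [← comp_zero_antiSob 0 c]; rfl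

lemma contDiff_transSer : ContDiff ℝ ∞ transSer :=
  contDiff_const.clm_comp (contDiff_transL_comp incl_serSob 0)

lemma contDiff_transAnti : ContDiff ℝ ∞ transAnti :=
  contDiff_const.clm_comp (contDiff_transL_comp incl_antiSob 0)

lemma LZ.trans_zero (f : LZ) : LZ.trans 0 f = f := LZ.ext_coef fun n => by rw [LZ.coef_trans]; simp

lemma hasDerivAt_trans_zero (F : HSob 1) :
    HasDerivAt (fun t => LZ.trans t (HSob.comp 0 F)) (-(HSob.comp 0 (HSob.der F))) 0 := by
  have h := (HSob.comp 0).hasFDerivAt.comp_hasDerivAt (0 : ℝ) (HSob.hasDerivAt_transL F 0)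
  rw [HSob.transL_zero, map_neg] at h
  exact h

/-- Moves the translation off f, on which it is merely continuous, onto the series, on which it is
smooth. -/
lemma LZ.inner_trans (a : ℝ) (f g : LZ) : inner ℝ (LZ.trans a f) g = inner ℝ f (LZ.trans (-a) g) := by
  have h1 : LZ.trans a (LZ.trans (-a) g) = g := LZ.ext_coef fun n => by
    have h2 : fourier (-n) ((-a : ℝ) : Torus) = fourier n (a : Torus) := by simp [fourier_apply]
    rw [LZ.coef_trans, LZ.coef_trans, h2, ← mul_assoc, ← fourier_add, neg_add_cancel, fourier_zero,
      one_mul]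
  conv_lhs => rw [← h1]
  exact (LZ.trans a).inner_map_map f _

/-! ### The modulation equations -/

/-- The equations `P₀^± g = 0` for `h(x) = σ b(x + a) + g(x + a)`, where `b` is the profile with
parameter `εσ`; here `p = ((ε, h), (σ, a))`. -/
def modEq (b : ℝ → Ell) (p : (ℝ × LZ) × (ℝ × ℝ)) : ℝ × ℝ :=
  (inner ℝ p.1.2 (transSer (-p.2.2) (b (p.1.1 * p.2.1))) -
    p.2.1 * inner ℝ (serL2 (b (p.1.1 * p.2.1))) (serL2 (b (p.1.1 * p.2.1))),
   inner ℝ p.1.2 (transAnti (-p.2.2) (waveDer b (p.1.1 * p.2.1))))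

namespace IsProfile

variable {δ : ℝ} {b : ℝ → Ell} {ν : ℝ → ℝ}

/-- The function h enters linearly, while a and the parameter act only on series; so the equations
are smooth with h merely in L². -/
lemma contDiffAt_modEq (h : IsProfile δ b ν) {p : (ℝ × LZ) × (ℝ × ℝ)}
    (hp : p.1.1 * p.2.1 ∈ Ioo (-δ) δ) : ContDiffAt ℝ ∞ (modEq b) p := by
  have he : ContDiffAt ℝ ∞ (fun p : (ℝ × LZ) × (ℝ × ℝ) => p.1.1 * p.2.1) p := by fun_prop
  have ha : ContDiffAt ℝ ∞ (fun p : (ℝ × LZ) × (ℝ × ℝ) => -p.2.2) p := by fun_prop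
  have hh : ContDiffAt ℝ ∞ (fun p : (ℝ × LZ) × (ℝ × ℝ) => p.1.2) p := by fun_prop
  have hσ : ContDiffAt ℝ ∞ (fun p : (ℝ × LZ) × (ℝ × ℝ) => p.2.1) p := by fun_prop
  have hb : ContDiffAt ℝ ∞ (fun p : (ℝ × LZ) × (ℝ × ℝ) => b (p.1.1 * p.2.1)) p :=
    ((h.smooth _ hp).of_le le_top).comp p he
  have hw : ContDiffAt ℝ ∞ (fun p : (ℝ × LZ) × (ℝ × ℝ) => waveDer b (p.1.1 * p.2.1)) p :=
    (h.contDiffAt_waveDer hp).comp p he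
  have hs : ContDiffAt ℝ ∞ (fun p : (ℝ × LZ) × (ℝ × ℝ) => serL2 (b (p.1.1 * p.2.1))) p :=
    serL2.contDiff.contDiffAt.comp p hb
  have h1 : ContDiffAt ℝ ∞ (fun p : (ℝ × LZ) × (ℝ × ℝ) =>
      transSer (-p.2.2) (b (p.1.1 * p.2.1))) p :=
    (contDiff_transSer.contDiffAt.comp p ha).clm_apply hb
  have h2 : ContDiffAt ℝ ∞ (fun p : (ℝ × LZ) × (ℝ × ℝ) =>
      transAnti (-p.2.2) (waveDer b (p.1.1 * p.2.1))) p :=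
    (contDiff_transAnti.contDiffAt.comp p ha).clm_apply hw
  exact ((hh.inner ℝ h1).sub (hσ.mul (hs.inner ℝ hs))).prodMk (hh.inner ℝ h2)

lemma modEq_self (b : ℝ → Ell) (ε : ℝ) : modEq b ((ε, serL2 (b ε)), (1, 0)) = 0 := by
  simp only [modEq, neg_zero, mul_one, one_mul, transSer_apply, transAnti_apply, LZ.trans_zero,
    sub_self, inner_serL2_antiL2]
  rfl

/-- At ε = 0 the profile is cos x for all σ. The σ-derivative of the first equation is -⟨cos, cos⟩ =
-1/2, its a-derivative vanishes by parity, and the a-derivative of the second equation is ⟨cos, cos⟩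
= 1/2. -/
lemma hasFDerivAt_modEq (h : IsProfile δ b ν) :
    HasFDerivAt (fun y : ℝ × ℝ => modEq b ((0, serL2 cosVec), y))
      (((-(1 / 2) : ℝ) • ContinuousLinearMap.fst ℝ ℝ ℝ).prod
        ((1 / 2 : ℝ) • ContinuousLinearMap.snd ℝ ℝ ℝ)) (1, 0) := by
  have hd : ∀ F : HSob 1, HasDerivAt (fun a : ℝ => (inner ℝ (serL2 cosVec)
      (LZ.trans (-a) (HSob.comp 0 F)) : ℝ))
      (inner ℝ (serL2 cosVec) (HSob.comp 0 (HSob.der F))) 0 := fun F => by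
    have h1 := hasDerivAt_trans_zero F
    have h2 : HasDerivAt (fun a : ℝ => LZ.trans (-a) (HSob.comp 0 F))
        (HSob.comp 0 (HSob.der F)) 0 := by
      have h3 : HasDerivAt (fun t => LZ.trans t (HSob.comp 0 F))
        (-(HSob.comp 0 (HSob.der F))) (-(0 : ℝ)) := by rwa [neg_zero]
      have := h3.scomp (0 : ℝ) (hasDerivAt_neg (0 : ℝ))
      rw [neg_one_smul, neg_neg] at this
      exact this
    exact (innerSL ℝ (serL2 cosVec)).hasFDerivAt.comp_hasDerivAt (0 : ℝ) h2
  have hd1 := hd (serSob 1 cosVec)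
  rw [comp_zero_serSob, comp_zero_der_serSob, real_inner_comm, inner_derL2_serL2] at hd1
  have hd2 := hd (antiSob 1 cosVec)
  rw [comp_zero_antiSob, comp_zero_der_antiSob, inner_serL2_cosVec] at hd2
  have hs : HasFDerivAt (fun y : ℝ × ℝ => y.2) (.snd ℝ ℝ ℝ) ((1 : ℝ), (0 : ℝ)) := hasFDerivAt_snd
  have h1 : HasFDerivAt (fun y : ℝ × ℝ => (inner ℝ (serL2 cosVec)
      (LZ.trans (-y.2) (serL2 cosVec)) : ℝ) - y.1 * (1 / 2))
      ((-(1 / 2) : ℝ) • ContinuousLinearMap.fst ℝ ℝ ℝ) (1, 0) := by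
    have := (HasDerivAt.comp_hasFDerivAt ((1 : ℝ), (0 : ℝ)) hd1 hs).sub
      ((hasFDerivAt_fst (𝕜 := ℝ) (p := ((1 : ℝ), (0 : ℝ)))).mul_const (1 / 2 : ℝ))
    refine this.congr_fderiv ?_
    ext <;> simp
  have h2 : HasFDerivAt (fun y : ℝ × ℝ => (inner ℝ (serL2 cosVec)
      (LZ.trans (-y.2) (antiL2 cosVec)) : ℝ))
      ((1 / 2 : ℝ) • ContinuousLinearMap.snd ℝ ℝ ℝ) (1, 0) := by
    have := HasDerivAt.comp_hasFDerivAt ((1 : ℝ), (0 : ℝ)) hd2 hs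
    refine this.congr_fderiv ?_
    ext <;> simp
  have h3 := h1.prodMk h2
  refine h3.congr_of_eventuallyEq (Eventually.of_forall fun y => ?_)
  simp only [modEq, zero_mul, h.at_zero, h.waveDer_zero, transSer_apply, transAnti_apply,
    inner_serL2_cosVec]

lemma isInvertible_fderiv_modEq (h : IsProfile δ b ν) :
    (fderiv ℝ (modEq b) ((0, serL2 cosVec), (1, 0)) ∘L
      .inr ℝ (ℝ × LZ) (ℝ × ℝ)).IsInvertible := by
  have h1 : HasFDerivAt (modEq b) (fderiv ℝ (modEq b) ((0, serL2 cosVec), (1, 0)))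
      ((0, serL2 cosVec), (1, 0)) := by
    refine ((h.contDiffAt_modEq ?_).differentiableAt (by simp)).hasFDerivAt
    simpa using h.zero_mem
  have h2 : HasFDerivAt (fun y : ℝ × ℝ => (((0 : ℝ), serL2 cosVec), y))
      (.inr ℝ (ℝ × LZ) (ℝ × ℝ)) (1, 0) := hasFDerivAt_prodMk_right _ _
  have h3 := (h1.comp ((1 : ℝ), (0 : ℝ)) h2).unique h.hasFDerivAt_modEq
  rw [h3]
  refine ⟨ContinuousLinearEquiv.equivOfInverse
    (((-(1 / 2) : ℝ) • ContinuousLinearMap.fst ℝ ℝ ℝ).prod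
        ((1 / 2 : ℝ) • ContinuousLinearMap.snd ℝ ℝ ℝ))
    (((-2 : ℝ) • ContinuousLinearMap.fst ℝ ℝ ℝ).prod
        ((2 : ℝ) • ContinuousLinearMap.snd ℝ ℝ ℝ)) ?_ ?_, rfl⟩
  · rintro ⟨x, y⟩; simp
  · rintro ⟨x, y⟩; simp

/-- Solution of the modulation equations near the rescaled wave. -/
lemma exists_modulation (h : IsProfile δ b ν) :
    ∃ r > 0, ∃ K : ℝ, 0 ≤ K ∧ ∃ Φ : ℝ × LZ → ℝ × ℝ, ∀ (ε : ℝ) (f : LZ), |ε| < r →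
      ‖f - serL2 (b ε)‖ < r → ContDiffAt ℝ ∞ Φ (ε, f) ∧
      ‖Φ (ε, f) - (1, 0)‖ ≤ K * ‖f - serL2 (b ε)‖ ∧ modEq b ((ε, f), Φ (ε, f)) = 0 := by
  have hsm : ∀ᶠ p in 𝓝 (((0 : ℝ), serL2 cosVec), ((1 : ℝ), (0 : ℝ))),
      ContDiffAt ℝ ∞ (modEq b) p := by
    have hc : Continuous fun p : (ℝ × LZ) × (ℝ × ℝ) => p.1.1 * p.2.1 := by fun_prop
    have h1 := hc.continuousAt (x := (((0 : ℝ), serL2 cosVec), ((1 : ℝ), (0 : ℝ))))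
      (isOpen_Ioo.mem_nhds (by simpa using h.zero_mem : (0 : ℝ) * 1 ∈ Ioo (-δ) δ))
    exact mem_of_superset h1 fun p hp => h.contDiffAt_modEq hp
  have h0 : modEq b ((0, serL2 cosVec), (1, 0)) = 0 := by
    rw [← h.at_zero]; exact modEq_self b 0
  obtain ⟨Φ, -, huniq, r, hr, ⟨K, hK⟩, hsol⟩ :=
    exists_smooth_implicitFunction hsm h0 h.isInvertible_fderiv_modEq
  have hcb : ContinuousAt (fun ε : ℝ => serL2 (b ε)) 0 :=
    serL2.continuous.continuousAt.comp (h.smooth 0 h.zero_mem).continuousAt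
  -- The exact profile is solved by σ = 1, a = 0, and local uniqueness says that Φ picks this
  -- solution for all small ε.
  have e1 : ∀ᶠ ε in 𝓝 (0 : ℝ), Φ (ε, serL2 (b ε)) = (1, 0) := by
    have hc : ContinuousAt (fun ε : ℝ => ((ε, serL2 (b ε)), ((1 : ℝ), (0 : ℝ)))) 0 :=
      (continuousAt_id.prodMk hcb).prodMk continuousAt_const
    have hc' : Tendsto (fun ε : ℝ => ((ε, serL2 (b ε)), ((1 : ℝ), (0 : ℝ)))) (𝓝 0)
        (𝓝 (((0 : ℝ), serL2 cosVec), ((1 : ℝ), (0 : ℝ)))) := by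
      rw [← h.at_zero]; exact hc
    exact (hc'.eventually huniq).mono fun ε hε => hε (modEq_self b ε)
  have e2 : ∀ᶠ ε in 𝓝 (0 : ℝ), ‖serL2 (b ε) - serL2 cosVec‖ < r / 2 := by
    have := Metric.continuousAt_iff'.1 hcb (r / 2) (half_pos hr)
    simpa only [dist_eq_norm, h.at_zero] using this
  obtain ⟨s, hs, hball⟩ := Metric.eventually_nhds_iff.1 (e1.and e2)
  refine ⟨min s (r / 2), lt_min hs (half_pos hr), K, K.2, Φ, fun ε f hε hf => ?_⟩
  have hε1 : dist ε 0 < s := by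
    rw [dist_zero_right, norm_eq_abs]; exact hε.trans_le (min_le_left _ _)
  obtain ⟨hb1, hb2⟩ := hball hε1
  have hmem : ∀ f : LZ, ‖f - serL2 (b ε)‖ < r / 2 →
      (ε, f) ∈ Metric.ball ((0 : ℝ), serL2 cosVec) r := fun f hf => by
    rw [Metric.mem_ball, Prod.dist_eq, max_lt_iff]
    constructor
    · rw [dist_zero_right, norm_eq_abs]
      linarith [hε.trans_le (min_le_right _ _)]
    · rw [dist_eq_norm]
      have : f - serL2 cosVec = (f - serL2 (b ε)) + (serL2 (b ε) - serL2 cosVec) := by abel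
      rw [this]
      linarith [norm_add_le (f - serL2 (b ε)) (serL2 (b ε) - serL2 cosVec)]
  have hm1 := hmem f (hf.trans_le (min_le_right _ _))
  have hm2 := hmem (serL2 (b ε)) (by rw [sub_self, norm_zero]; exact half_pos hr)
  refine ⟨(hsol _ hm1).2, ?_, (hsol _ hm1).1⟩
  -- The two points share the parameter ε, so the Lipschitz bound involves only the distance of f
  -- from the profile, uniformly in ε.
  have hl := hK.dist_le_mul _ hm1 _ hm2
  rw [hb1, dist_eq_norm, Prod.dist_eq, dist_self, dist_eq_norm,
    max_eq_right (norm_nonneg _)] at hl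
  exact hl

end IsProfile

/-! ### The modulated decomposition -/

/-- On `(-ρ, ρ)` the profile is bounded and the waves depend on the parameter in a Lipschitz way. -/
lemma IsProfile.exists_bounds {δ : ℝ} {b : ℝ → Ell} {ν : ℝ → ℝ} (h : IsProfile δ b ν) :
    ∃ B : ℝ, 0 ≤ B ∧ ∀ᶠ s in 𝓝[>] (0 : ℝ), ∀ ε e : ℝ, |ε| < s → |e| < s →
      ‖b ε‖ ≤ B ∧ ‖ε • b ε - e • b e‖ ≤ B * |e - ε| := by
  obtain ⟨K, t, ht, hK⟩ :=
    ((h.contDiffAt_wave h.zero_mem).of_le (m := 1) le_top).exists_lipschitzOnWith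
  have h1 : ∀ᶠ ε in 𝓝 (0 : ℝ), ‖b ε‖ < ‖b 0‖ + 1 :=
    (h.smooth 0 h.zero_mem).continuousAt.norm.eventually_lt_const (by linarith)
  obtain ⟨r, hr, hball⟩ := Metric.eventually_nhds_iff.1 (h1.and ht)
  refine ⟨max (‖b 0‖ + 1) K, le_max_of_le_right K.2, ?_⟩
  filter_upwards [Ioo_mem_nhdsGT hr] with s hs ε e hε he
  have hb : ∀ x : ℝ, |x| < s → dist x 0 < r := fun x hx => by
    rw [dist_zero_right, norm_eq_abs]; exact hx.trans hs.2
  refine ⟨(hball (hb ε hε)).1.le.trans (le_max_left _ _), ?_⟩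
  have h2 := hK.dist_le_mul _ (hball (hb ε hε)).2 _ (hball (hb e he)).2
  rw [dist_eq_norm, dist_eq_norm, norm_eq_abs, abs_sub_comm] at h2
  exact h2.trans (mul_le_mul_of_nonneg_right (le_max_right _ _) (abs_nonneg _))

/-- The remainder `f(· - a) - u_e` in the decomposition of `f`. -/
def remainder (b : ℝ → Ell) {k : ℕ} (e a : ℝ) (F : HSob k) : HSob k :=
  HSob.transL a F - serSob k (e • b e)

lemma incl_remainder (b : ℝ → Ell) {m k : ℕ} (h : m ≤ k) (e a : ℝ) (F : HSob k) :
    HSob.incl h (remainder b e a F) = remainder b e a (HSob.incl h F) := by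
  rw [remainder, remainder, map_sub, incl_transL, incl_serSob]

lemma comp_zero_remainder (b : ℝ → Ell) {k : ℕ} (e a : ℝ) (F : HSob k) :
    HSob.comp 0 (remainder b e a F) = LZ.trans a (HSob.comp 0 F) - serL2 (e • b e) := by
  rw [remainder, map_sub, comp_zero_serSob, HSob.comp_transL]

lemma exists_norm_transL_serSob_sub_le (m : ℕ) :
    ∃ C : ℝ, 0 ≤ C ∧ ∀ (a : ℝ) (c : Ell),
      ‖HSob.transL a (serSob m c) - serSob m c‖ ≤ C * ‖c‖ * |a| := by
  let D : Ell →L[ℝ] HSob m := HSob.der.comp (serSob (m + 1))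
  refine ⟨‖(HSob.incl le_rfl : HSob m →L[ℝ] HSob m)‖ * ‖D‖, by positivity, fun a c => ?_⟩
  have h1 := HSob.norm_transIncl_sub_le (le_refl m) (serSob (m + 1) c) 0 a
  have h2 : ∀ t, HSob.transIncl ((le_refl m).trans m.le_succ) t (serSob (m + 1) c) =
      HSob.transL t (serSob m c) := fun t => by
    rw [HSob.transIncl_apply, incl_transL, incl_serSob]
  rw [h2, h2, HSob.transL_zero, sub_zero] at h1
  refine h1.trans ?_
  have h3 : ‖HSob.der (serSob (m + 1) c)‖ ≤ ‖D‖ * ‖c‖ := D.le_opNorm c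
  calc _ ≤ ‖(HSob.incl le_rfl : HSob m →L[ℝ] HSob m)‖ * (‖D‖ * ‖c‖) * |a| := by gcongr
    _ = _ := by ring

/-- Split T_aF - u_e as T_a(F - u_ε) + (T_au_ε - u_ε) + (u_ε - u_e). The first term is isometric to
F - u_ε. The second gains a factor |ε| from u_ε = εb(ε), which is essential since |a| is controlled
only by ‖F - u_ε‖/|ε|. -/
lemma exists_norm_remainder_le {b : ℝ → Ell} {B s : ℝ} (hB0 : 0 ≤ B)
    (hB : ∀ ε e : ℝ, |ε| < s → |e| < s → ‖b ε‖ ≤ B ∧ ‖ε • b ε - e • b e‖ ≤ B * |e - ε|) (m : ℕ) :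
    ∃ C : ℝ, 0 ≤ C ∧ ∀ (ε e a : ℝ) (F : HSob m), |ε| < s → |e| < s →
      ‖remainder b e a F‖ ≤ ‖F - serSob m (ε • b ε)‖ + C * (|ε| * |a| + |e - ε|) := by
  obtain ⟨C, hC0, hC⟩ := exists_norm_transL_serSob_sub_le m
  refine ⟨C * B + ‖serSob m‖ * B, by positivity, fun ε e a F hε he => ?_⟩
  obtain ⟨h1, h2⟩ := hB ε e hε he
  have h3 : remainder b e a F = HSob.transL a (F - serSob m (ε • b ε)) +
      (HSob.transL a (serSob m (ε • b ε)) - serSob m (ε • b ε)) +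
      serSob m (ε • b ε - e • b e) := by
    rw [map_sub (HSob.transL a), map_sub (serSob m), remainder]; abel
  have h4 : ‖HSob.transL a (serSob m (ε • b ε)) - serSob m (ε • b ε)‖ ≤ C * B * (|ε| * |a|) := by
    refine (hC a (ε • b ε)).trans ?_
    rw [norm_smul, norm_eq_abs]
    calc C * (|ε| * ‖b ε‖) * |a| ≤ C * (|ε| * B) * |a| := by gcongr
      _ = _ := by ring
  have h5 : ‖serSob m (ε • b ε - e • b e)‖ ≤ ‖serSob m‖ * B * |e - ε| := by
    refine ((serSob m).le_opNorm _).trans ?_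
    rw [mul_assoc]
    gcongr
  have h6 : ‖HSob.transL a (F - serSob m (ε • b ε))‖ = ‖F - serSob m (ε • b ε)‖ :=
    HSob.norm_transL _ _
  rw [h3]
  refine (norm_add₃_le).trans ?_
  rw [h6]
  have h7 : 0 ≤ C * B * |e - ε| := by positivity
  have h8 : 0 ≤ ‖serSob m‖ * B * (|ε| * |a|) := by positivity
  linarith

lemma remainder_ae {δ : ℝ} {b : ℝ → Ell} {ν : ℝ → ℝ} (h : IsProfile δ b ν) {k : ℕ} {e : ℝ}
    (he : e ∈ Ioo (-δ) δ) (a : ℝ) (F : HSob k) :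
    ∀ᵐ x : Torus, l2fn (HSob.comp 0 F) x = (seriesZero (e • b e)).fn (x + (a : Torus)) +
      l2fn (HSob.comp 0 (remainder b e a F)) (x + (a : Torus)) := by
  rw [← ae_torusMeasure_iff]
  have h1 : ∀ᵐ y ∂torusMeasure, l2fn (HSob.comp 0 F) (y - (a : Torus)) =
      (seriesZero (e • b e)).fn y + l2fn (HSob.comp 0 (remainder b e a F)) y := by
    have h2 : HSob.comp 0 (remainder b e a F) + serL2 (e • b e) =
        LZ.trans a (HSob.comp 0 F) := by
      rw [comp_zero_remainder]; abel
    have h3 := Lp.coeFn_add (HSob.comp 0 (remainder b e a F) : L2Zero).1 (serL2 (e • b e) : L2Zero).1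
    have h4 := LZ.trans_ae a (HSob.comp 0 F)
    rw [← h2] at h4
    filter_upwards [h3, h4, zeroMean_ae (h.coef_cosSeries_wave_zero he)] with y hy3 hy4 hy5
    rw [h.fn_eq he, ← hy5, ← hy4]
    exact hy3.trans (add_comm _ _)
  have h2 := (measurePreserving_add_right torusMeasure (a : Torus)).quasiMeasurePreserving.ae h1
  filter_upwards [h2] with x hx
  rwa [add_sub_cancel_right] at hx

/-- The pairings of the remainder with u_e and with the antiderivative of ∂_εu_e are multiples of
the two components of `modEq` at F/ε₀; for the second, the wave drops out by parity. -/
lemma proj_remainder {b : ℝ → Ell} {k : ℕ} {ε₀ σ a : ℝ} (hε₀ : ε₀ ≠ 0) {F : HSob k}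
    (h : modEq b ((ε₀, ε₀⁻¹ • HSob.comp 0 F), (σ, a)) = 0) :
    IsProfile.projPlus b (ε₀ * σ) (HSob.comp 0 (remainder b (ε₀ * σ) a F)) = 0 ∧
    IsProfile.projMinus b (ε₀ * σ) (HSob.comp 0 (remainder b (ε₀ * σ) a F)) = 0 := by
  have h1 := congrArg Prod.fst h
  have h2 := congrArg Prod.snd h
  simp only [modEq, transSer_apply, transAnti_apply, ← LZ.inner_trans,
    real_inner_smul_left, Prod.fst_zero, Prod.snd_zero] at h1 h2
  constructor
  · apply IsProfile.projPlus_eq_zero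
    rw [comp_zero_remainder, map_smul, inner_sub_left, real_inner_smul_right, real_inner_smul_left,
      real_inner_smul_right]
    field_simp at h1
    linear_combination (ε₀ * σ) * h1
  · apply IsProfile.projMinus_eq_zero
    rw [comp_zero_remainder, inner_sub_left, inner_serL2_antiL2, sub_zero]
    exact (mul_eq_zero.1 h2).resolve_left (inv_ne_zero hε₀)

namespace IsProfile

variable {δ : ℝ} {b : ℝ → Ell} {ν : ℝ → ℝ}

/-- Only the translate of F loses derivatives; the subtracted wave depends smoothly on its parameter
in every Sobolev norm. -/
lemma contDiffAt_remainder (h : IsProfile δ b ν) {k : ℕ} {e a : HSob k → ℝ} {F : HSob k}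
    (he : ContDiffAt ℝ ∞ e F) (ha : ContDiffAt ℝ ∞ a F) (heδ : e F ∈ Ioo (-δ) δ) {j : ℕ}
    (hj : j ≤ k) : ContDiffAt ℝ j
      (fun F => HSob.incl (Nat.sub_le k j) (remainder b (e F) (a F) F)) F := by
  have hj' : ((j : ℕ) : WithTop ℕ∞) ≤ ((⊤ : ℕ∞) : WithTop ℕ∞) := by exact_mod_cast le_top
  have h0 : ContDiffAt ℝ j (fun F => (a F, F)) F := (ha.of_le hj').prodMk contDiffAt_id
  have h1 : ContDiffAt ℝ j (fun F => HSob.transIncl (Nat.sub_le k j) (a F) F) F :=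
    ContDiffAt.comp F (f := fun F => (a F, F))
      (g := fun p : ℝ × HSob k => HSob.transIncl (Nat.sub_le k j) p.1 p.2)
      (HSob.contDiff_transIncl_uncurry j (Nat.sub_le k j) (by omega)).contDiffAt h0
  have h2 : ContDiffAt ℝ j (fun F => e F • b (e F)) F :=
    ContDiffAt.comp F (g := fun e => e • b e) ((h.contDiffAt_wave heδ).of_le le_top) (he.of_le hj')
  have h3 : ContDiffAt ℝ j (fun F => serSob (k - j) (e F • b (e F))) F :=
    ContDiffAt.comp F (serSob (k - j)).contDiff.contDiffAt h2
  have h4 : (fun F => HSob.incl (Nat.sub_le k j) (remainder b (e F) (a F) F)) =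
      fun F => HSob.transIncl (Nat.sub_le k j) (a F) F - serSob (k - j) (e F • b (e F)) :=
    funext fun F => by rw [remainder, map_sub, incl_serSob, HSob.transIncl_apply]
  rw [h4]
  exact h1.sub h3

/-- The modulation equations are solved for F/ε₀ and rescaled back. The same e and a serve for the
estimates in both norms, because both are governed by the L² distance alone. -/
lemma exists_decomposition (h : IsProfile δ b ν) {ρ B : ℝ} (hρ : 0 < ρ) (hρδ : ρ ≤ δ) (hB0 : 0 ≤ B)
    (hB : ∀ ε e : ℝ, |ε| < ρ → |e| < ρ → ‖b ε‖ ≤ B ∧ ‖ε • b ε - e • b e‖ ≤ B * |e - ε|)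
    (k m : ℕ) (hm : m ≤ k) :
    ∃ r : ℝ, 0 < r ∧ r ≤ ρ ∧ ∃ C : ℝ, ∀ ε₀ : ℝ, |ε₀| < r → ∃ (e a : HSob k → ℝ),
      ∀ F : HSob k, ‖F - serSob k (ε₀ • b ε₀)‖ < r * |ε₀| →
        0 < |e F| ∧ |e F| < ρ ∧
        projPlus b (e F) (HSob.comp 0 (remainder b (e F) (a F) F)) = 0 ∧
        projMinus b (e F) (HSob.comp 0 (remainder b (e F) (a F) F)) = 0 ∧
        |e F - ε₀| + ‖HSob.incl hm (remainder b (e F) (a F) F)‖ ≤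
          C * ‖HSob.incl hm (F - serSob k (ε₀ • b ε₀))‖ ∧
        |e F - ε₀| + ‖remainder b (e F) (a F) F‖ ≤ C * ‖F - serSob k (ε₀ • b ε₀)‖ ∧
        ContDiffAt ℝ ∞ e F ∧ ContDiffAt ℝ ∞ a F ∧
        ∀ j : ℕ, j ≤ k → ContDiffAt ℝ j
          (fun F => HSob.incl (Nat.sub_le k j) (remainder b (e F) (a F) F)) F := by
  obtain ⟨r₁, hr₁, K, hK0, Φ, hΦ⟩ := h.exists_modulation
  obtain ⟨Cm, hCm0, hCm⟩ := exists_norm_remainder_le hB0 hB m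
  obtain ⟨Ck, hCk0, hCk⟩ := exists_norm_remainder_le hB0 hB k
  -- K r ≤ 1/2 keeps σ in [1/2, 3/2], so e = ε₀σ does not vanish; with r ≤ ρ/2 it also stays below
  -- ρ.
  set r : ℝ := min r₁ (min (ρ / 2) (1 / (2 * (K + 1)))) with hr
  have hr0 : 0 < r := by positivity
  have hrr₁ : r ≤ r₁ := min_le_left _ _
  have hrρ : r ≤ ρ / 2 := (min_le_right _ _).trans (min_le_left _ _)
  have hrK : K * r ≤ 1 / 2 := by
    have h1 : r ≤ 1 / (2 * (K + 1)) := (min_le_right _ _).trans (min_le_right _ _)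
    calc K * r ≤ K * (1 / (2 * (K + 1))) := by gcongr
      _ ≤ 1 / 2 := by rw [mul_one_div, div_le_iff₀ (by positivity)]; linarith
  -- In the constant, K bounds |e - ε₀|, the 1 comes from F - u_{ε₀} itself, and 2K bounds |ε₀||a| +
  -- |e - ε₀| in the remainder estimate.
  refine ⟨r, hr0, by linarith, K + 1 + (Cm + Ck) * (2 * K), fun ε₀ hε₀ => ?_⟩
  let q : HSob k → ℝ × LZ := fun F => (ε₀, ε₀⁻¹ • HSob.comp 0 F)
  have hq : ContDiff ℝ ∞ q := contDiff_const.prodMk ((HSob.comp 0).contDiff.const_smul ε₀⁻¹)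
  refine ⟨fun F => ε₀ * (Φ (q F)).1, fun F => (Φ (q F)).2, fun F hF => ?_⟩
  -- For ε₀ = 0 the ball is empty.
  have hne : ε₀ ≠ 0 := by
    rintro rfl
    rw [abs_zero, mul_zero] at hF
    exact absurd hF (norm_nonneg _).not_gt
  have hpos : 0 < |ε₀| := abs_pos.2 hne
  set d : ℝ := ‖HSob.comp 0 (F - serSob k (ε₀ • b ε₀))‖ with hd
  have hdk : d ≤ ‖F - serSob k (ε₀ • b ε₀)‖ := HSob.norm_comp_le _ _
  have hdm : d ≤ ‖HSob.incl hm (F - serSob k (ε₀ • b ε₀))‖ :=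
    HSob.norm_comp_le 0 (HSob.incl hm (F - serSob k (ε₀ • b ε₀)))
  have hq1 : ‖ε₀⁻¹ • HSob.comp 0 F - serL2 (b ε₀)‖ = |ε₀|⁻¹ * d := by
    have : ε₀⁻¹ • HSob.comp 0 F - serL2 (b ε₀) =
        ε₀⁻¹ • HSob.comp 0 (F - serSob k (ε₀ • b ε₀)) := by
      rw [map_sub (HSob.comp 0), comp_zero_serSob, map_smul serL2, smul_sub, smul_smul,
        inv_mul_cancel₀ hne, one_smul]
    rw [this, norm_smul, norm_inv, norm_eq_abs]
  have hq2 : |ε₀|⁻¹ * d < r := by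
    rw [inv_mul_lt_iff₀ hpos, mul_comm]; exact hdk.trans_lt hF
  obtain ⟨hΦs, hΦl, hΦ0⟩ := hΦ ε₀ (ε₀⁻¹ • HSob.comp 0 F) (hε₀.trans_le hrr₁)
    (by rw [hq1]; exact hq2.trans_le hrr₁)
  rw [hq1] at hΦl
  have hΦq : ContDiffAt ℝ ∞ (fun F => Φ (q F)) F := ContDiffAt.comp F hΦs hq.contDiffAt
  have hes : ContDiffAt ℝ ∞ (fun F => ε₀ * (Φ (q F)).1) F := contDiffAt_const.mul hΦq.fst
  have has : ContDiffAt ℝ ∞ (fun F => (Φ (q F)).2) F := hΦq.snd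
  set σ : ℝ := (Φ (q F)).1 with hσ
  set a : ℝ := (Φ (q F)).2 with ha
  have hσ1 : |σ - 1| ≤ K * (|ε₀|⁻¹ * d) := (norm_fst_le (Φ (q F) - (1, 0))).trans hΦl
  have ha1 : |a| ≤ K * (|ε₀|⁻¹ * d) := by
    have := (norm_snd_le (Φ (q F) - (1, 0))).trans hΦl
    rwa [Prod.snd_sub, sub_zero] at this
  have hσ2 : |σ - 1| ≤ 1 / 2 := hσ1.trans ((by gcongr : K * (|ε₀|⁻¹ * d) ≤ K * r).trans hrK)
  have hσ3 := abs_le.1 hσ2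
  have hσpos : 0 < σ := by linarith [hσ3.1]
  have hee : |ε₀ * σ - ε₀| ≤ K * d := by
    rw [← mul_sub_one, abs_mul]
    calc |ε₀| * |σ - 1| ≤ |ε₀| * (K * (|ε₀|⁻¹ * d)) := by gcongr
      _ = K * d := by field_simp
  have hea : |ε₀| * |a| ≤ K * d := by
    calc |ε₀| * |a| ≤ |ε₀| * (K * (|ε₀|⁻¹ * d)) := by gcongr
      _ = K * d := by field_simp
  have he0 : 0 < |ε₀ * σ| := abs_pos.2 (mul_ne_zero hne hσpos.ne')
  have heρ : |ε₀ * σ| < ρ := by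
    rw [abs_mul, abs_of_pos hσpos]
    calc |ε₀| * σ ≤ |ε₀| * (3 / 2) := by gcongr; linarith [hσ3.2]
      _ < r * (3 / 2) := by gcongr
      _ ≤ ρ := by linarith
  have hε₀ρ : |ε₀| < ρ := by linarith
  have hd0 : 0 ≤ d := norm_nonneg _
  obtain ⟨hp1, hp2⟩ := proj_remainder hne (σ := σ) (a := a) hΦ0
  have hKd : 0 ≤ K * d := by positivity
  -- Common to both norms: x is the H^m or the H^k distance, and either dominates the L² distance d.
  have est : ∀ {x C y : ℝ}, 0 ≤ C → C ≤ Cm + Ck → d ≤ x →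
      y ≤ x + C * (|ε₀| * |a| + |ε₀ * σ - ε₀|) →
      |ε₀ * σ - ε₀| + y ≤ (K + 1 + (Cm + Ck) * (2 * K)) * x := fun {x C y} hC hCC hx hy => by
    have h1 : C * (|ε₀| * |a| + |ε₀ * σ - ε₀|) ≤ (Cm + Ck) * (2 * (K * x)) := by
      have hKx : K * d ≤ K * x := by gcongr
      gcongr
      linarith
    have h2 : K * d ≤ K * x := by gcongr
    linarith
  refine ⟨he0, heρ, hp1, hp2, ?_, ?_, hes, has, fun j hj => ?_⟩
  · rw [incl_remainder]
    refine est hCm0 (by linarith) hdm ?_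
    have := hCm ε₀ (ε₀ * σ) a (HSob.incl hm F) hε₀ρ heρ
    rwa [← incl_serSob hm, ← map_sub] at this
  · exact est hCk0 (by linarith) hdk (hCk ε₀ (ε₀ * σ) a F hε₀ρ heρ)
  · exact h.contDiffAt_remainder hes has (abs_lt.1 (heρ.trans_le hρδ)) hj

end IsProfile

/-- A range of parameters on which a given branch coincides with the constructed one. -/
lemma IsProfile.exists_radius {δ δ₁ : ℝ} {b : ℝ → Ell} {u : ℝ → SmoothZero} {ν v : ℝ → ℝ}
    (h : IsProfile δ₁ b ν) (huv : IsBifurcationCurve δ u v) :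
    ∃ ρ : ℝ, 0 < ρ ∧ ρ ≤ δ₁ ∧ ρ ≤ δ ∧
      (∃ B : ℝ, 0 ≤ B ∧ ∀ ε e : ℝ, |ε| < ρ → |e| < ρ →
        ‖b ε‖ ≤ B ∧ ‖ε • b ε - e • b e‖ ≤ B * |e - ε|) ∧
      ∀ e : ℝ, |e| < ρ → (u e = seriesZero (e • b e) ∧ v e = ν e) ∧
        0 < (inner ℝ (serL2 (b e)) (serL2 (waveDer b e)) : ℝ) := by
  obtain ⟨B, hB0, hB⟩ := h.exists_bounds
  have hev : ∀ᶠ e in 𝓝 (0 : ℝ), (u e = seriesZero (e • b e) ∧ v e = ν e) ∧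
      0 < (inner ℝ (serL2 (b e)) (serL2 (waveDer b e)) : ℝ) :=
    (huv.eventually_eq h.isBifurcationCurve).and h.eventually_inner_pos
  obtain ⟨ρ₀, hρ₀, hball⟩ := Metric.eventually_nhds_iff.1 hev
  obtain ⟨ρ, hBρ, hρ0, hρ⟩ := (hB.and (Ioo_mem_nhdsGT (lt_min (lt_min h.pos huv.pos) hρ₀))).exists
  refine ⟨ρ, hρ0, hρ.le.trans ((min_le_left _ _).trans (min_le_left _ _)),
    hρ.le.trans ((min_le_left _ _).trans (min_le_right _ _)), ⟨B, hB0, hBρ⟩, fun e he => ?_⟩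
  refine hball ?_
  rw [dist_zero_right, norm_eq_abs]
  exact he.trans (hρ.trans_le (min_le_right _ _))

end BurgersHilbert

end

/-! ### Transfer to an arbitrary branch and conclusion -/

set_option maxHeartbeats 1000000 in
open BurgersHilbert in
theorem mainTheorem8 :
    -- the curve of traveling waves exists
    (∃ (δ : ℝ) (u : ℝ → SmoothZero) (v : ℝ → ℝ), IsBifurcationCurve δ u v) ∧
    ∀ (δ : ℝ) (u : ℝ → SmoothZero) (v : ℝ → ℝ), IsBifurcationCurve δ u v →
    -- the spectral projections `P₀^±(ε)` exist for `0 < |ε| < ρ`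
    ∃ ρ : ℝ, 0 < ρ ∧ ρ ≤ δ ∧ ∃ Pp Pm : ℝ → (L2Zero →L[ℝ] L2Zero),
      (∀ ε : ℝ, 0 < |ε| → |ε| < ρ → IsZeroModeProjection u v ε (Pp ε) (Pm ε)) ∧
      ∀ (k : ℕ) (hk : 2 ≤ k), ∃ r : ℝ, 0 < r ∧ r ≤ ρ ∧ ∃ C : ℝ,
        ∀ ε₀ : ℝ, |ε₀| < r →
        ∃ (e a : Sob k → ℝ) (g : Sob k → Sob k),
          (∀ f : Sob k, ‖f - (u ε₀).toSob k‖ < r * |ε₀| →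
            0 < |e f| ∧ |e f| < ρ ∧
            (∀ᵐ x : Torus, sobFn f x = (u (e f)).fn (x + (a f : Torus)) +
              sobFn (g f) (x + (a f : Torus))) ∧
            Pp (e f) (sobToL2 (g f)) = 0 ∧ Pm (e f) (sobToL2 (g f)) = 0 ∧
            |e f - ε₀| + ‖sobIncl hk (g f)‖ ≤ C * ‖sobIncl hk (f - (u ε₀).toSob k)‖ ∧
            |e f - ε₀| + ‖g f‖ ≤ C * ‖f - (u ε₀).toSob k‖) ∧
          ContDiffOn ℝ ∞ e (Metric.ball ((u ε₀).toSob k) (r * |ε₀|)) ∧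
          ContDiffOn ℝ ∞ a (Metric.ball ((u ε₀).toSob k) (r * |ε₀|)) ∧
          ∀ j : ℕ, j ≤ k →
            ContDiffOn ℝ j (fun f => sobIncl (Nat.sub_le k j) (g f))
              (Metric.ball ((u ε₀).toSob k) (r * |ε₀|)) := by
  obtain ⟨δ₁, b, ν, h⟩ := exists_isProfile
  refine ⟨⟨δ₁, _, ν, h.isBifurcationCurve⟩, fun δ u v huv => ?_⟩
  obtain ⟨ρ, hρ0, hρδ₁, hρδ, ⟨B, hB0, hBρ⟩, hgood⟩ := h.exists_radius huv
  -- Below ρ the given curve coincides with the constructed one, so all results on the profile apply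
  -- to it.
  have hmem : ∀ e : ℝ, |e| < ρ → e ∈ Ioo (-δ₁) δ₁ := fun e he => abs_lt.1 (he.trans_le hρδ₁)
  refine ⟨ρ, hρ0, hρδ, IsProfile.projPlus b, IsProfile.projMinus b, fun ε hε0 hε => ?_,
    fun k hk => ?_⟩
  · refine h.isZeroModeProjection (hmem ε hε) (abs_pos.1 hε0) ?_ ?_ (hgood ε hε).1.2
    · rw [IsProfile.pairing_eq]
      exact mul_ne_zero (abs_pos.1 hε0) (hgood ε hε).2.ne'
    · have : ∀ᶠ e in nhds ε, |e| < ρ := continuous_abs.continuousAt.eventually_lt_const hε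
      exact this.mono fun e he => (hgood e he).1.1
  · obtain ⟨r, hr0, hrρ, C, hC⟩ := h.exists_decomposition hρ0 hρδ₁ hB0 hBρ k 2 hk
    refine ⟨r, hr0, hrρ, C, fun ε₀ hε₀ => ?_⟩
    obtain ⟨e, a, hea⟩ := hC ε₀ hε₀
    have hu0 : (u ε₀).toSob k = serSob k (ε₀ • b ε₀) := by
      rw [(hgood ε₀ (hε₀.trans_le hrρ)).1.1]
      exact toHSob_seriesZero k _
    refine ⟨e, a, fun F => remainder b (e F) (a F) F, fun F hF => ?_, ?_, ?_, fun j hj => ?_⟩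
    · rw [hu0] at hF ⊢
      obtain ⟨h1, h2, h3, h4, h5, h6, -⟩ := hea F hF
      refine ⟨h1, h2, ?_, h3, h4, h5, h6⟩
      rw [(hgood _ h2).1.1]
      exact remainder_ae h (hmem _ h2) (a F) F
    · rw [hu0]
      intro F hF
      exact (hea F (mem_ball_iff_norm.1 hF)).2.2.2.2.2.2.1.contDiffWithinAt
    · rw [hu0]
      intro F hF
      exact (hea F (mem_ball_iff_norm.1 hF)).2.2.2.2.2.2.2.1.contDiffWithinAt
    · rw [hu0]
      intro F hF
      exact ((hea F (mem_ball_iff_norm.1 hF)).2.2.2.2.2.2.2.2 j hj).contDiffWithinAt
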